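/- Let $\mathbb{D}=\{z\in\mathbb{C}:|z|<1\}$. A one-parameter semigroup is a family $(\phi_t)_{t\ge 0}$ of holomorphic self-maps of $\mathbb{D}$ with $\phi_0=\mathrm{id}$, $\phi_{s+t}=\phi_s\circ\phi_t$ for all $s,t\ge0$, and $\phi_t(z)\to z$ as $t\to0^+$ for every $z\in\mathbb{D}$. Its infinitesimal generator is the holomorphic function $G:\mathbb{D}\to\mathbb{C}$ with $\frac{d}{dt}\phi_t(z)=G(\phi_t(z))$ for all $z\in\mathbb{D}$, $t\ge0$. Write $\angle\lim$ for angular (non-tangential) limits. A point $\sigma\in\partial\mathbb{D}$ is a boundary regular fixed point (BRFP) of a holomorphic map $f:\mathbb{D}\to\mathbb{D}$ if $\angle\lim_{z\to\sigma}f(z)=\sigma$ and the angular derivative $f'(\sigma)=\angle\lim_{z\to\sigma}\frac{f(z)-\sigma}{z-\sigma}$ exists finitely; it is a BRFP of $(\phi_t)$ if it is a BRFP of every $\phi_t$, and then the spectral value of $(\phi_t)$ at $\sigma$ is the number $\angle\lim_{z\to\sigma}\frac{G(z)}{\sigma-z}$. The Denjoy--Wolff point of a holomorphic map $f:\mathbb{D}\to\mathbb{D}$,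 $f\neq\mathrm{id}$, is its fixed point in $\mathbb{D}$ if there is one, and otherwise the unique BRFP $\tau\in\partial\mathbb{D}$ of $f$ with $f'(\tau)\le1$; the semigroup $(\phi_t)$ has Denjoy--Wolff point $\tau$ if every $\phi_t\ne\mathrm{id}$ does. Let $F=\{\sigma_1,\dots,\sigma_n\}\subset\partial\mathbb{D}$ be a set of $n$ pairwise distinct points and let $\tau\in\overline{\mathbb{D}}\setminus F$. Let $\mathrm{Gen}_\tau(F)$ be the set consisting of $G\equiv0$ and of all infinitesimal generators $G$ of one-parameter semigroups $(\phi_t)$ with Denjoy--Wolff point $\tau$ which have BRFPs at $\sigma_1,\dots,\sigma_n$ with spectral values $\lambda_1,\dots,\lambda_n<0$ satisfying $\sum_{k=1}^n|\lambda_k|\le1$. **Theorem.** A function $G:\mathbb{D}\to\mathbb{C}$, $G\not\equiv0$, is an extreme point of $\mathrm{Gen}_\tau(F)$ if and only if there exist $b\in\mathbb{R}$ and $L=(\lambda_1,\dots,\lambda_n)\in(-\infty,0)^n$ with $\sum_{k=1}^n|\lambda_k|=1$ such that $$G(z)=\frac{(\tau-z)(1-\overline{\tau}z)}{ib+p_0(z;F,L)}\quad\text{for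 all }z\in\mathbb{D},\qquad\text{where}\qquad p_0(z;F,L):=\sum_{k=1}^n\frac{|\tau-\sigma_k|^2}{2|\lambda_k|}\,\frac{\sigma_k+z}{\sigma_k-z}.$$ -/

import Mathlib

open scoped Complex.UnitDisc ComplexConjugate Topology NNReal

namespace DiscSemigroup

noncomputable section

/-- A complex valued function on the open unit disc is holomorphic. Functions in `Hol(𝔻)` are
represented as functions on the type `𝔻`, so that equality of functions is equality on the disc;
the extension by zero is used only in order to apply Mathlib's notion of differentiability. -/
def IsHol (f : 𝔻 → ℂ) : Prop :=
  DifferentiableOn ℂ (fun z : ℂ => if h : ‖z‖ < 1 then f (Complex.UnitDisc.mk z h) else 0)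
    (Metric.ball 0 1)

/-- The Stolz angle of opening `M` with vertex at the boundary point `σ`. -/
def stolzAngle (σ : ℂ) (M : ℝ) : Set 𝔻 :=
  {z | ‖σ - (z : ℂ)‖ < M * (1 - ‖(z : ℂ)‖)}

/-- The angular (non-tangential) limit of `f` at the boundary point `σ` exists and equals `l`:
`f z → l` as `z → σ` within every Stolz angle with vertex `σ`. -/
def HasAngularLimit (f : 𝔻 → ℂ) (σ l : ℂ) : Prop :=
  ∀ M : ℝ, 1 < M →
    Filter.Tendsto f
      (Filter.comap (fun z : 𝔻 => (z : ℂ)) (𝓝 σ) ⊓ Filter.principal (stolzAngle σ M)) (𝓝 l)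

/-- `σ` is a boundary fixed point of the self-map `f`. -/
def IsBoundaryFixedPoint (f : 𝔻 → 𝔻) (σ : ℂ) : Prop :=
  ‖σ‖ = 1 ∧ HasAngularLimit (fun z => (f z : ℂ)) σ σ

/-- The angular derivative of the self-map `f` at its boundary fixed point `σ` exists finitely and
equals `d`. -/
def HasAngularDerivAt (f : 𝔻 → 𝔻) (σ d : ℂ) : Prop :=
  HasAngularLimit (fun z => ((f z : ℂ) - σ) / ((z : ℂ) - σ)) σ d

/-- `σ` is a boundary regular fixed point (BRFP) of the self-map `f`. -/
def IsBRFP (f : 𝔻 → 𝔻) (σ : ℂ) : Prop :=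
  IsBoundaryFixedPoint f σ ∧ ∃ d : ℂ, HasAngularDerivAt f σ d

/-- `τ` is the Denjoy-Wolff point of the holomorphic self-map `f ≠ id`: either `τ` is a fixed point
in the open disc, or `f` has no fixed points in the open disc and `τ` is a BRFP on the unit circle
with angular derivative at most `1`. -/
def IsDWPoint (f : 𝔻 → 𝔻) (τ : ℂ) : Prop :=
  (∃ w : 𝔻, (w : ℂ) = τ ∧ f w = w) ∨
  ((∀ w : 𝔻, f w ≠ w) ∧ IsBoundaryFixedPoint f τ ∧
    ∃ d : ℝ, d ≤ 1 ∧ HasAngularDerivAt f τ (d : ℂ))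

/-- `(φ_t)_{t ≥ 0}` is a one-parameter semigroup of holomorphic self-maps of the unit disc. -/
structure IsSemigroup (φ : ℝ≥0 → 𝔻 → 𝔻) : Prop where
  hol : ∀ t, IsHol (fun z => (φ t z : ℂ))
  zero : ∀ z, φ 0 z = z
  add : ∀ s t z, φ (s + t) z = φ s (φ t z)
  tendsto : ∀ z, Filter.Tendsto (fun t => φ t z) (𝓝[>] 0) (𝓝 z)

/-- `G` is the infinitesimal generator of `(φ_t)`: it is holomorphic and
`d φ_t(z) / dt = G (φ_t(z))` for all `z ∈ 𝔻` and all `t ≥ 0` (one-sided derivative at `t = 0`). -/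
def IsGenerator (φ : ℝ≥0 → 𝔻 → 𝔻) (G : 𝔻 → ℂ) : Prop :=
  IsHol G ∧ ∀ (z : 𝔻) (t : ℝ≥0),
    HasDerivWithinAt (fun s : ℝ => (φ s.toNNReal z : ℂ)) (G (φ t z)) (Set.Ici 0) (t : ℝ)

/-- All the maps `φ_t ≠ id` of the semigroup have Denjoy-Wolff point `τ`; for the trivial semigroup
this holds for every `τ`. -/
def HasDWPoint (φ : ℝ≥0 → 𝔻 → 𝔻) (τ : ℂ) : Prop :=
  ∀ t, φ t ≠ id → IsDWPoint (φ t) τ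

/-- `σ` is a boundary regular fixed point of the semigroup `(φ_t)`. -/
def IsSemigroupBRFP (φ : ℝ≥0 → 𝔻 → 𝔻) (σ : ℂ) : Prop :=
  ∀ t, IsBRFP (φ t) σ

/-- `l` is the spectral value at the BRFP `σ` of the semigroup generated by `G`, i.e. the angular
limit of `G z / (σ - z)` at `σ`. -/
def HasSpectralValue (G : 𝔻 → ℂ) (σ : ℂ) (l : ℝ) : Prop :=
  HasAngularLimit (fun z => G z / (σ - (z : ℂ))) σ (l : ℂ)

/-- The class `Gen_τ(F)`, `F = {σ_1, …, σ_n}`: the zero function and all infinitesimal generators of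
one-parameter semigroups with Denjoy-Wolff point `τ` that have BRFPs at `σ_1, …, σ_n` with repelling
spectral values `l_1, …, l_n < 0` subject to `∑ |l_k| ≤ 1`. -/
def GenClass {n : ℕ} (τ : ℂ) (σ : Fin n → ℂ) : Set (𝔻 → ℂ) :=
  {G | G = 0 ∨ ∃ φ : ℝ≥0 → 𝔻 → 𝔻,
    IsSemigroup φ ∧ IsGenerator φ G ∧ HasDWPoint φ τ ∧ (∀ k, IsSemigroupBRFP φ (σ k)) ∧
    ∃ l : Fin n → ℝ, (∀ k, l k < 0 ∧ HasSpectralValue G (σ k) (l k)) ∧ ∑ k, |l k| ≤ 1}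

/-- `p₀(z; F, L) = ∑ α_k (σ_k + z) / (σ_k - z)` with `α_k = |τ - σ_k|² / (2 |l_k|)`. -/
def p0 {n : ℕ} (τ : ℂ) (σ : Fin n → ℂ) (L : Fin n → ℝ) (z : ℂ) : ℂ :=
  ∑ k, ((‖τ - σ k‖ ^ 2 / (2 * |L k|) : ℝ) : ℂ) * ((σ k + z) / (σ k - z))

end

end DiscSemigroup

/-!
By Berkson and Porta, a nonzero `G` generates a semigroup with Denjoy-Wolff point `τ` if and only if
`G z = (τ - z) (1 - conj τ * z) p z` for some holomorphic `p ≠ 0` with nonnegative real part. Having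
a BRFP at `σ_k` with spectral value `l_k < 0` means that the Herglotz measure of `1 / p` has an atom
of mass `α_k = |τ - σ_k|² / (2 |l_k|)` at `σ_k`. Hence `Re (1 / p) ≥ Re (p₀ L)`, that is,
`Re p ≥ |p|² Re (p₀ L)`.

Let `∑ |l_k| = 1` and `1 / p = i b + p₀ L`, so that equality holds, and let `p` be a convex
combination of `p₁` and `p₂` in the class. The spectral values combine in the same way, and the
right-hand side is a positive combination of the terms `|p|² / |l_k|`. As `(x, y) ↦ |x|² / y` is
jointly convex, the quotients `p_i / |l_{i,k}|` all equal `p / |l_k|`; since the absolute values of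
the spectral values sum to `1` for both `p₁` and `p₂`, this gives `p₁ = p₂ = p`.

Conversely, suppose that the Herglotz measure of `p` charges `n + 1` disjoint sets. Rescaling it on
these sets and adding an imaginary constant gives `n + 2` real parameters, whereas keeping the zeros
at the `σ_k` and the sum of the spectral values imposes only `n + 1` real linear conditions: `G` is
not extreme. For an extreme point the measure is therefore a sum of at most `n` point masses, `p` is
a rational function of degree at most `n` vanishing at `σ_1, …, σ_n`, and `1 / p` is `p₀ L` up to an
additive imaginary constant.
-/

namespace DiscSemigroup

open Metric Set Filter MeasureTheory

local notation "𝕊" => sphere (0 : ℂ) 1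

/-- A holomorphic function on the unit disc with nonnegative real part. The function is defined on
all of `ℂ` and only its values on the disc are constrained. -/
structure IsHerglotz (p : ℂ → ℂ) : Prop where
  differentiableOn : DifferentiableOn ℂ p (ball 0 1)
  re_nonneg : ∀ z, ‖z‖ < 1 → 0 ≤ (p z).re

/-- The Herglotz transform of a measure on the unit circle: the holomorphic function on the disc
whose real part is the Poisson integral of the measure. -/
noncomputable def herglotz (μ : Measure 𝕊) (z : ℂ) : ℂ := ∫ ζ : 𝕊, (ζ + z) / (ζ - z) ∂μ

theorem sub_ne_zero_of_norm_eq_one {σ z : ℂ} (hσ : ‖σ‖ = 1) (hz : ‖z‖ < 1) : σ - z ≠ 0 := by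
  rintro h
  rw [sub_eq_zero.1 h] at hσ
  exact hz.ne hσ

theorem re_add_div_sub {σ : ℂ} (hσ : ‖σ‖ = 1) (z : ℂ) :
    ((σ + z) / (σ - z)).re = (1 - ‖z‖ ^ 2) / ‖σ - z‖ ^ 2 := by
  have h1 : ‖σ‖ ^ 2 = 1 := by rw [hσ, one_pow]
  rw [Complex.sq_norm, Complex.normSq_apply] at h1
  rw [Complex.div_re, ← add_div, Complex.sq_norm, Complex.sq_norm, Complex.normSq_apply z]
  congr 1
  simp only [Complex.add_re, Complex.sub_re, Complex.add_im, Complex.sub_im]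
  linarith

section Transform

variable {μ : Measure 𝕊}

theorem norm_coe_sphere (ζ : 𝕊) : ‖(ζ : ℂ)‖ = 1 := norm_eq_of_mem_sphere ζ

theorem integrable_of_continuous_sphere [IsFiniteMeasure μ] {E : Type*} [NormedAddCommGroup E]
    {f : 𝕊 → E} (hf : Continuous f) : Integrable f μ :=
  hf.integrable_of_hasCompactSupport (HasCompactSupport.of_compactSpace f)

theorem continuous_herglotz_kernel {z : ℂ} (hz : ‖z‖ < 1) :
    Continuous fun ζ : 𝕊 => ((ζ : ℂ) + z) / (ζ - z) :=
  Continuous.div (by fun_prop) (by fun_prop)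
    fun ζ => sub_ne_zero_of_norm_eq_one (norm_coe_sphere ζ) hz

theorem continuous_poisson_kernel {z : ℂ} (hz : ‖z‖ < 1) :
    Continuous fun ζ : 𝕊 => (1 - ‖z‖ ^ 2) / ‖(ζ : ℂ) - z‖ ^ 2 :=
  Continuous.div (by fun_prop) (by fun_prop) fun ζ =>
    pow_ne_zero 2 (norm_ne_zero_iff.2 (sub_ne_zero_of_norm_eq_one (norm_coe_sphere ζ) hz))

theorem poisson_kernel_nonneg {z : ℂ} (hz : ‖z‖ < 1) (ζ : ℂ) :
    0 ≤ (1 - ‖z‖ ^ 2) / ‖ζ - z‖ ^ 2 :=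
  div_nonneg (by nlinarith [norm_nonneg z]) (by positivity)

theorem integrable_herglotz_kernel [IsFiniteMeasure μ] {z : ℂ} (hz : ‖z‖ < 1) :
    Integrable (fun ζ : 𝕊 => ((ζ : ℂ) + z) / (ζ - z)) μ :=
  integrable_of_continuous_sphere (continuous_herglotz_kernel hz)

theorem re_herglotz [IsFiniteMeasure μ] {z : ℂ} (hz : ‖z‖ < 1) :
    (herglotz μ z).re = ∫ ζ : 𝕊, (1 - ‖z‖ ^ 2) / ‖(ζ : ℂ) - z‖ ^ 2 ∂μ := by
  rw [herglotz, ← RCLike.re_eq_complex_re, ← integral_re (integrable_herglotz_kernel hz)]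
  exact integral_congr_ae (.of_forall fun ζ => re_add_div_sub (norm_coe_sphere ζ) z)

theorem herglotz_zero_right : herglotz μ 0 = μ.real univ := by
  have hone : ∀ ζ : 𝕊, ((ζ : ℂ) + 0) / (ζ - 0) = 1 := fun ζ => by
    rw [add_zero, sub_zero, div_self (ne_zero_of_mem_unit_sphere ζ)]
  simp only [herglotz, hone, integral_const, Complex.real_smul, mul_one]

theorem differentiableOn_herglotz [IsFiniteMeasure μ] :
    DifferentiableOn ℂ (herglotz μ) (ball 0 1) := by
  intro z₀ hz₀
  rw [mem_ball_zero_iff] at hz₀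
  set d := (1 - ‖z₀‖) / 2 with hd
  have hd0 : 0 < d := by linarith
  have hlt : ∀ z ∈ ball z₀ d, ‖z‖ < 1 := fun z hz => by
    have := norm_lt_of_mem_ball hz
    linarith
  have hdist : ∀ z ∈ ball z₀ d, ∀ ζ : 𝕊, d ≤ ‖(ζ : ℂ) - z‖ := fun z hz ζ => by
    have h1 := norm_lt_of_mem_ball hz
    have h2 := norm_sub_norm_le (ζ : ℂ) z
    rw [norm_coe_sphere] at h2
    linarith
  refine (hasDerivAt_integral_of_dominated_loc_of_deriv_le
    (F := fun z (ζ : 𝕊) => ((ζ : ℂ) + z) / (ζ - z))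
    (F' := fun z (ζ : 𝕊) => 2 * (ζ : ℂ) / (ζ - z) ^ 2) (bound := fun _ => 2 / d ^ 2)
    (ball_mem_nhds z₀ hd0) ?_ (integrable_herglotz_kernel hz₀) ?_ ?_ (integrable_const _)
    ?_).2.differentiableAt.differentiableWithinAt
  · filter_upwards [ball_mem_nhds z₀ hd0] with z hz
    exact (integrable_herglotz_kernel (hlt z hz)).aestronglyMeasurable
  · refine (Continuous.div (by fun_prop) (by fun_prop) fun ζ => ?_).aestronglyMeasurable
    exact pow_ne_zero 2 (sub_ne_zero_of_norm_eq_one (norm_coe_sphere ζ) hz₀)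
  · refine .of_forall fun ζ z hz => ?_
    rw [norm_div, norm_mul, norm_pow, norm_coe_sphere, mul_one, Complex.norm_ofNat]
    gcongr
    exact hdist z hz ζ
  · refine .of_forall fun ζ z hz => ?_
    have hne := sub_ne_zero_of_norm_eq_one (norm_coe_sphere ζ) (hlt z hz)
    refine (((hasDerivAt_id z).const_add (ζ : ℂ)).div ((hasDerivAt_id z).const_sub (ζ : ℂ))
      hne).congr_deriv ?_
    simp only [id]
    ring

theorem isHerglotz_herglotz [IsFiniteMeasure μ] : IsHerglotz (herglotz μ) where
  differentiableOn := differentiableOn_herglotz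
  re_nonneg z hz := by
    rw [re_herglotz hz]
    exact integral_nonneg fun ζ => poisson_kernel_nonneg hz ζ

end Transform

section Representation

/-- The normalized arc length measure on the unit circle. -/
noncomputable def arcMeasure : Measure 𝕊 :=
  ENNReal.ofReal (2 * Real.pi)⁻¹ • (volume.restrict (Ioc 0 (2 * Real.pi))).map
    fun θ => ⟨circleMap 0 1 θ, circleMap_mem_sphere 0 zero_le_one θ⟩

theorem measurable_circleMap_sphere :
    Measurable fun θ => (⟨circleMap 0 1 θ, circleMap_mem_sphere 0 zero_le_one θ⟩ : 𝕊) :=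
  ((continuous_circleMap 0 1).subtype_mk _).measurable

instance : IsFiniteMeasure arcMeasure :=
  Measure.smul_finite _ ENNReal.ofReal_ne_top

theorem integral_arcMeasure {E : Type*} [NormedAddCommGroup E] [NormedSpace ℝ E] {f : ℂ → E}
    (hf : Continuous fun ζ : 𝕊 => f ζ) :
    ∫ ζ : 𝕊, f ζ ∂arcMeasure = Real.circleAverage f 0 1 := by
  rw [arcMeasure, integral_smul_measure, integral_map measurable_circleMap_sphere.aemeasurable
    hf.aestronglyMeasurable, Real.circleAverage_def,
    intervalIntegral.integral_of_le Real.two_pi_pos.le, ENNReal.toReal_ofReal (by positivity)]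

theorem integral_arcMeasure_poisson {f : ℂ → ℂ} (hf : DiffContOnCl ℂ f (ball 0 1)) {z : ℂ}
    (hz : ‖z‖ < 1) :
    ∫ ζ : 𝕊, (f ζ).re * ((1 - ‖z‖ ^ 2) / ‖(ζ : ℂ) - z‖ ^ 2) ∂arcMeasure = (f z).re := by
  have hcont : Continuous fun ζ : 𝕊 => f ζ := hf.continuousOn_ball.comp_continuous
    continuous_subtype_val fun ζ => sphere_subset_closedBall ζ.2
  have hint : Continuous fun ζ : 𝕊 => ((1 - ‖z‖ ^ 2) / ‖(ζ : ℂ) - z‖ ^ 2) • f ζ :=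
    (continuous_poisson_kernel hz).smul hcont
  rw [← hf.circleAverage_poissonKernel_smul' (mem_ball_zero_iff.2 hz)]
  have hcongr : Real.circleAverage (fun ζ => ((‖ζ - 0‖ ^ 2 - ‖z - 0‖ ^ 2) /
      ‖(ζ - 0) - (z - 0)‖ ^ 2) • f ζ) 0 1 =
      Real.circleAverage (fun ζ => ((1 - ‖z‖ ^ 2) / ‖ζ - z‖ ^ 2) • f ζ) 0 1 :=
    Real.circleAverage_congr_sphere fun ζ hζ => by
      rw [abs_one, mem_sphere_zero_iff_norm] at hζ
      simp only [sub_zero, hζ, one_pow]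
  rw [hcongr, ← integral_arcMeasure hint, ← RCLike.re_eq_complex_re,
    ← integral_re (integrable_of_continuous_sphere hint)]
  refine integral_congr_ae (.of_forall fun ζ => ?_)
  simp only [RCLike.re_eq_complex_re, Complex.real_smul, Complex.re_ofReal_mul]
  exact mul_comm _ _

theorem IsHerglotz.continuous_comp_mul_sphere {p : ℂ → ℂ} (hp : IsHerglotz p) {r : ℝ}
    (hr : |r| < 1) : Continuous fun ζ : 𝕊 => p (r * ζ) :=
  hp.differentiableOn.continuousOn.comp_continuous (by fun_prop) fun ζ => by
    rwa [mem_ball_zero_iff, norm_mul, norm_coe_sphere, mul_one, Complex.norm_real]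

theorem IsHerglotz.exists_measure_dilation {p : ℂ → ℂ} (hp : IsHerglotz p) {r : ℝ}
    (hr : |r| < 1) : ∃ μ : FiniteMeasure 𝕊, ∀ z, ‖z‖ < 1 →
      ∫ ζ : 𝕊, (1 - ‖z‖ ^ 2) / ‖(ζ : ℂ) - z‖ ^ 2 ∂(μ : Measure 𝕊) = (p (r * z)).re := by
  have hmaps : MapsTo (fun z : ℂ => r * z) (closedBall 0 1) (ball 0 1) := fun z hz => by
    rw [mem_closedBall_zero_iff] at hz
    rw [mem_ball_zero_iff, norm_mul, Complex.norm_real, Real.norm_eq_abs]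
    nlinarith [abs_nonneg r, norm_nonneg z]
  have hcl : DiffContOnCl ℂ (fun z => p (r * z)) (ball 0 1) := by
    refine DifferentiableOn.diffContOnCl ?_
    rw [closure_ball 0 one_ne_zero]
    exact hp.differentiableOn.comp (by fun_prop) hmaps
  have hcont : Continuous fun ζ : 𝕊 => (p (r * ζ)).re :=
    Complex.continuous_re.comp (hp.continuous_comp_mul_sphere hr)
  have hnonneg : ∀ ζ : 𝕊, 0 ≤ (p (r * ζ)).re := fun ζ =>
    hp.re_nonneg _ (mem_ball_zero_iff.1 (hmaps (sphere_subset_closedBall ζ.2)))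
  let ν := arcMeasure.withDensity fun ζ : 𝕊 => ENNReal.ofReal (p (r * ζ)).re
  have hfin : IsFiniteMeasure ν :=
    isFiniteMeasure_withDensity_ofReal (integrable_of_continuous_sphere hcont).2
  refine ⟨⟨ν, hfin⟩, fun z hz => ?_⟩
  calc ∫ ζ : 𝕊, (1 - ‖z‖ ^ 2) / ‖(ζ : ℂ) - z‖ ^ 2 ∂ν
      = ∫ ζ : 𝕊, (p (r * ζ)).re * ((1 - ‖z‖ ^ 2) / ‖(ζ : ℂ) - z‖ ^ 2) ∂arcMeasure := by
        rw [integral_withDensity_eq_integral_toReal_smul hcont.measurable.ennreal_ofReal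
          (.of_forall fun _ => ENNReal.ofReal_lt_top)]
        simp only [ENNReal.toReal_ofReal (hnonneg _), smul_eq_mul]
    _ = (p (r * z)).re := integral_arcMeasure_poisson hcl hz

theorem IsHerglotz.exists_re_eq_integral {p : ℂ → ℂ} (hp : IsHerglotz p) :
    ∃ μ : FiniteMeasure 𝕊, ∀ z, ‖z‖ < 1 →
      (p z).re = ∫ ζ : 𝕊, (1 - ‖z‖ ^ 2) / ‖(ζ : ℂ) - z‖ ^ 2 ∂(μ : Measure 𝕊) := by
  choose! ν hν using fun (r : ℝ) (hr : |r| < 1) => hp.exists_measure_dilation hr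
  have hlt : ∀ᶠ r : ℝ in 𝓝[<] 1, |r| < 1 := by
    filter_upwards [self_mem_nhdsWithin, nhdsWithin_le_nhds (lt_mem_nhds one_pos)] with r h1 h0
    rwa [abs_of_pos h0]
  have hmass : ∀ r : ℝ, |r| < 1 → ((ν r).mass : ℝ) = (p 0).re := fun r hr => by
    have h := hν r hr 0 (by simp)
    have hone : ∀ ζ : 𝕊, (1 - ‖(0 : ℂ)‖ ^ 2) / ‖(ζ : ℂ) - 0‖ ^ 2 = 1 := fun ζ => by
      simp
    rw [mul_zero] at h
    simpa [hone] using h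
  obtain ⟨μ, -, hμ⟩ := (isCompact_setOfPred_finiteMeasure_eq_of_compactSpace 𝕊
    (p 0).re.toNNReal).exists_mapClusterPt (f := 𝓝[<] (1 : ℝ)) (u := ν) (by
      rw [le_principal_iff, mem_map]
      filter_upwards [hlt] with r hr
      rw [mem_preimage, mem_ofPred_eq, ← hmass r hr, Real.toNNReal_coe])
  obtain ⟨U, hU, hUμ⟩ := mapClusterPt_iff_ultrafilter.1 hμ
  refine ⟨μ, fun z hz => ?_⟩
  have hlim : Tendsto (fun r : ℝ => (p (r * z)).re) U (𝓝 (p z).re) := by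
    have hcont : ContinuousAt p ((1 : ℝ) * z) := (hp.differentiableOn.differentiableAt
      (isOpen_ball.mem_nhds (by simpa using hz))).continuousAt
    have hmul : Tendsto (fun r : ℝ => (r : ℂ) * z) (𝓝 1) (𝓝 ((1 : ℝ) * z)) :=
      Continuous.tendsto (by fun_prop) 1
    have h := Complex.continuous_re.continuousAt.tendsto.comp (hcont.tendsto.comp hmul)
    rw [Complex.ofReal_one, one_mul] at h
    exact h.mono_left (hU.trans nhdsWithin_le_nhds)
  let P : BoundedContinuousFunction 𝕊 ℝ :=
    BoundedContinuousFunction.mkOfCompact ⟨_, continuous_poisson_kernel hz⟩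
  refine tendsto_nhds_unique hlim
    ((FiniteMeasure.tendsto_iff_forall_integral_tendsto.1 hUμ P).congr' ?_)
  filter_upwards [hU hlt] with r hr
  exact hν r hr z hz

theorem IsHerglotz.exists_eq_herglotz {p : ℂ → ℂ} (hp : IsHerglotz p) :
    ∃ (μ : Measure 𝕊) (_ : IsFiniteMeasure μ) (b : ℝ),
      ∀ z, ‖z‖ < 1 → p z = Complex.I * b + herglotz μ z := by
  obtain ⟨μ, hμ⟩ := hp.exists_re_eq_integral
  have hre : ∀ z ∈ ball (0 : ℂ) 1, (p z - herglotz μ z).re = 0 := fun z hz => by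
    rw [mem_ball_zero_iff] at hz
    rw [Complex.sub_re, hμ z hz, re_herglotz hz, sub_self]
  have han := (hp.differentiableOn.sub
    (differentiableOn_herglotz (μ := μ))).analyticOnNhd isOpen_ball
  obtain ⟨b, hb⟩ := han.eq_re_add_const_mul_I_of_re_eq_const hre isOpen_ball
    (isConnected_ball one_pos)
  refine ⟨μ, inferInstance, b, fun z hz => ?_⟩
  have := hb z (mem_ball_zero_iff.2 hz)
  rw [Pi.sub_apply, Complex.ofReal_zero, zero_add] at this
  rw [mul_comm, ← this, sub_add_cancel]

end Representation

section AngularLimit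

/-- The filter of angular approach to `σ` within the Stolz angle of opening `M`. -/
noncomputable abbrev angularFilter (σ : ℂ) (M : ℝ) : Filter 𝔻 :=
  comap (fun z : 𝔻 => (z : ℂ)) (𝓝 σ) ⊓ 𝓟 (stolzAngle σ M)

variable {f g : 𝔻 → ℂ} {σ a b : ℂ} {M : ℝ}

theorem tendsto_coe_angularFilter : Tendsto (fun z : 𝔻 => (z : ℂ)) (angularFilter σ M) (𝓝 σ) :=
  tendsto_comap.mono_left inf_le_left

theorem eventually_mem_stolzAngle : ∀ᶠ z in angularFilter σ M, z ∈ stolzAngle σ M :=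
  mem_inf_of_right (mem_principal_self _)

theorem exists_tendsto_radius_angularFilter (hσ : ‖σ‖ = 1) :
    ∃ γ : ℝ → 𝔻, (∀ᶠ r : ℝ in 𝓝[<] 1, (γ r : ℂ) = r * σ) ∧
      ∀ M : ℝ, 1 < M → Tendsto γ (𝓝[<] 1) (angularFilter σ M) := by
  have hγ : ∀ r : ℝ, ∃ w : 𝔻, r ∈ Ioo 0 1 → (w : ℂ) = r * σ := fun r => by
    by_cases hr : r ∈ Ioo 0 1
    · refine ⟨Complex.UnitDisc.mk (r * σ) ?_, fun _ => rfl⟩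
      rw [norm_mul, hσ, mul_one, Complex.norm_real, Real.norm_of_nonneg hr.1.le]
      exact hr.2
    · exact ⟨0, fun h => absurd h hr⟩
  choose γ hγ using hγ
  have hIoo : ∀ᶠ r : ℝ in 𝓝[<] 1, r ∈ Ioo 0 1 := Ioo_mem_nhdsLT one_pos
  refine ⟨γ, hIoo.mono hγ, fun M hM => tendsto_inf.2 ⟨tendsto_comap_iff.2 ?_, ?_⟩⟩
  · have hlim : Tendsto (fun r : ℝ => (r : ℂ) * σ) (𝓝[<] 1) (𝓝 σ) := by
      have h : Tendsto (fun r : ℝ => (r : ℂ) * σ) (𝓝 1) (𝓝 (((1 : ℝ) : ℂ) * σ)) :=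
        Continuous.tendsto (by fun_prop) 1
      rw [Complex.ofReal_one, one_mul] at h
      exact h.mono_left nhdsWithin_le_nhds
    exact hlim.congr' (hIoo.mono fun r hr => (hγ r hr).symm)
  · refine tendsto_principal.2 (hIoo.mono fun r hr => ?_)
    have hsub : σ - r * σ = ((1 - r : ℝ) : ℂ) * σ := by push_cast; ring
    rw [stolzAngle, mem_ofPred_eq, hγ r hr, hsub, norm_mul, norm_mul, hσ, Complex.norm_real,
      Complex.norm_real, Real.norm_of_nonneg hr.1.le, Real.norm_of_nonneg (by linarith [hr.2])]
    nlinarith [hr.2]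

theorem neBot_angularFilter (hσ : ‖σ‖ = 1) (hM : 1 < M) : (angularFilter σ M).NeBot := by
  obtain ⟨γ, -, hγ⟩ := exists_tendsto_radius_angularFilter hσ
  exact (hγ M hM).neBot

theorem hasAngularLimit_of_continuousAt {F : ℂ → ℂ} (hF : ContinuousAt F σ) :
    HasAngularLimit (fun z => F z) σ (F σ) := fun _ _ =>
  hF.tendsto.comp tendsto_coe_angularFilter

theorem hasAngularLimit_const (c : ℂ) : HasAngularLimit (fun _ => c) σ c :=
  fun _ _ => tendsto_const_nhds

namespace HasAngularLimit

theorem unique (hσ : ‖σ‖ = 1) (ha : HasAngularLimit f σ a) (hb : HasAngularLimit f σ b) :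
    a = b := by
  have := neBot_angularFilter hσ one_lt_two
  exact tendsto_nhds_unique (ha 2 one_lt_two) (hb 2 one_lt_two)

theorem add (hf : HasAngularLimit f σ a) (hg : HasAngularLimit g σ b) :
    HasAngularLimit (fun z => f z + g z) σ (a + b) := fun M hM => (hf M hM).add (hg M hM)

theorem sub (hf : HasAngularLimit f σ a) (hg : HasAngularLimit g σ b) :
    HasAngularLimit (fun z => f z - g z) σ (a - b) := fun M hM => (hf M hM).sub (hg M hM)

theorem mul (hf : HasAngularLimit f σ a) (hg : HasAngularLimit g σ b) :
    HasAngularLimit (fun z => f z * g z) σ (a * b) := fun M hM => (hf M hM).mul (hg M hM)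

theorem div (hf : HasAngularLimit f σ a) (hg : HasAngularLimit g σ b) (hb : b ≠ 0) :
    HasAngularLimit (fun z => f z / g z) σ (a / b) := fun M hM => (hf M hM).div (hg M hM) hb

theorem sum {ι : Type*} (s : Finset ι) {F : ι → 𝔻 → ℂ} {l : ι → ℂ}
    (h : ∀ i ∈ s, HasAngularLimit (F i) σ (l i)) :
    HasAngularLimit (fun z => ∑ i ∈ s, F i z) σ (∑ i ∈ s, l i) :=
  fun M hM => tendsto_finsetSum s fun i hi => h i hi M hM

theorem congr (hf : HasAngularLimit f σ a) (h : ∀ z, f z = g z) : HasAngularLimit g σ a :=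
  funext h ▸ hf

theorem congr_lim (hf : HasAngularLimit f σ a) (h : a = b) : HasAngularLimit f σ b := h ▸ hf

theorem tendsto_radius {F : ℂ → ℂ} (hσ : ‖σ‖ = 1)
    (hF : HasAngularLimit (fun z => F z) σ a) :
    Tendsto (fun r : ℝ => F (r * σ)) (𝓝[<] 1) (𝓝 a) := by
  obtain ⟨γ, hγ, hlim⟩ := exists_tendsto_radius_angularFilter hσ
  refine ((hF 2 one_lt_two).comp (hlim 2 one_lt_two)).congr' (hγ.mono fun r hr => ?_)
  rw [Function.comp_apply, hr]

end HasAngularLimit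

end AngularLimit

section BoundaryBehaviour

variable {μ : Measure 𝕊} {σ : 𝕊}

theorem one_sub_norm_le_norm_sub (ζ : 𝕊) (z : ℂ) : 1 - ‖z‖ ≤ ‖(ζ : ℂ) - z‖ := by
  simpa only [norm_coe_sphere] using norm_sub_norm_le (ζ : ℂ) z

theorem norm_div_sub_le_of_mem_stolzAngle {M : ℝ} {z : 𝔻} (hz : z ∈ stolzAngle σ M) (ζ : 𝕊) :
    ‖((σ : ℂ) - z) / (ζ - z)‖ ≤ M := by
  have h1 : 0 < 1 - ‖(z : ℂ)‖ := sub_pos.2 z.norm_lt_one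
  have h2 : ‖(σ : ℂ) - z‖ < M * (1 - ‖(z : ℂ)‖) := hz
  have hM : 0 ≤ M := by
    by_contra! hM
    nlinarith [norm_nonneg ((σ : ℂ) - z)]
  have h3 := one_sub_norm_le_norm_sub ζ z
  rw [norm_div, div_le_iff₀ (h1.trans_le h3)]
  exact h2.le.trans (by gcongr)

theorem hasAngularLimit_sub_mul_herglotz [IsFiniteMeasure μ] :
    HasAngularLimit (fun z => (σ - z) * herglotz μ z) σ (2 * σ * μ.real {σ}) := by
  intro M hM
  have hlim : ∫ ζ : 𝕊, indicator {σ} (fun _ => 2 * (σ : ℂ)) ζ ∂μ = 2 * σ * μ.real {σ} := by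
    rw [integral_indicator_const _ (measurableSet_singleton σ), Complex.real_smul, mul_comm]
  simp only [herglotz, ← integral_const_mul]
  rw [← hlim]
  refine tendsto_integral_filter_of_dominated_convergence (fun _ => M * 2) ?_ ?_
    (integrable_const _) (.of_forall fun ζ => ?_)
  · exact .of_forall fun z =>
      ((integrable_herglotz_kernel z.norm_lt_one).const_mul _).aestronglyMeasurable
  · filter_upwards [eventually_mem_stolzAngle] with z hz
    refine .of_forall fun ζ => ?_
    rw [mul_div_left_comm, mul_comm, norm_mul]
    have h : ‖(ζ : ℂ) + z‖ ≤ 2 := by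
      linarith [norm_add_le (ζ : ℂ) z, norm_coe_sphere ζ, z.norm_lt_one]
    exact mul_le_mul (norm_div_sub_le_of_mem_stolzAngle hz ζ) h (norm_nonneg _) (by linarith)
  · rcases eq_or_ne ζ σ with rfl | hne
    · rw [indicator_of_mem (mem_singleton ζ), two_mul]
      refine (tendsto_coe_angularFilter.const_add (ζ : ℂ)).congr fun z => ?_
      rw [mul_div_cancel₀ _ (sub_ne_zero_of_norm_eq_one (norm_coe_sphere ζ) z.norm_lt_one)]
    · rw [indicator_of_notMem (by simpa using hne)]
      have hne' : (ζ : ℂ) - σ ≠ 0 := sub_ne_zero.2 (Subtype.coe_ne_coe.2 hne)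
      have hcont : ContinuousAt (fun z : ℂ => ((σ : ℂ) - z) * ((ζ + z) / (ζ - z))) σ := by
        fun_prop (disch := exact hne')
      simpa using hasAngularLimit_of_continuousAt hcont M hM

theorem herglotz_kernel_sub_div {z : ℂ} (hz : ‖z‖ < 1) {ζ : 𝕊} (hζ : ζ ≠ σ) :
    (((ζ : ℂ) + z) / (ζ - z) - (ζ + σ) / (ζ - σ)) / (σ - z) = -2 * ζ / ((ζ - z) * (ζ - σ)) := by
  have h1 := sub_ne_zero_of_norm_eq_one (norm_coe_sphere ζ) hz
  have h2 := sub_ne_zero_of_norm_eq_one (norm_coe_sphere σ) hz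
  have h3 : (ζ : ℂ) - σ ≠ 0 := sub_ne_zero.2 (Subtype.coe_ne_coe.2 hζ)
  field_simp
  ring

theorem conj_mul_div_normSq_sub {ζ : 𝕊} (hζ : ζ ≠ σ) :
    -2 * (ζ : ℂ) / ((ζ - σ) * (ζ - σ)) = conj (σ : ℂ) * (2 * ((‖(ζ : ℂ) - σ‖ ^ 2)⁻¹ : ℝ)) := by
  have h3 : (ζ : ℂ) - σ ≠ 0 := sub_ne_zero.2 (Subtype.coe_ne_coe.2 hζ)
  have h4 : conj (ζ : ℂ) - conj (σ : ℂ) ≠ 0 := by rwa [← map_sub, map_ne_zero]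
  have hζ1 : (ζ : ℂ) * conj (ζ : ℂ) = 1 := by simp [Complex.mul_conj']
  have hσ1 : (σ : ℂ) * conj (σ : ℂ) = 1 := by simp [Complex.mul_conj']
  have hsq : ((‖(ζ : ℂ) - σ‖ ^ 2 : ℝ) : ℂ) = (ζ - σ) * (conj (ζ : ℂ) - conj (σ : ℂ)) := by
    rw [← map_sub, Complex.mul_conj', Complex.ofReal_pow]
  rw [Complex.ofReal_inv, hsq]
  field_simp
  linear_combination hσ1 - hζ1

theorem integrable_herglotz_kernel_self
    (hint : Integrable (fun ζ : 𝕊 => (‖(ζ : ℂ) - σ‖ ^ 2)⁻¹) μ) :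
    Integrable (fun ζ : 𝕊 => ((ζ : ℂ) + σ) / (ζ - σ)) μ := by
  refine (hint.const_mul 4).mono' ?_ (.of_forall fun ζ => ?_)
  · exact (Measurable.div (by fun_prop) (by fun_prop)).aestronglyMeasurable
  · have hadd := norm_add_le (ζ : ℂ) σ
    have hsub := norm_sub_le (ζ : ℂ) σ
    rw [norm_coe_sphere, norm_coe_sphere] at hadd hsub
    rw [norm_div, sq, mul_inv]
    rcases eq_or_ne ‖(ζ : ℂ) - σ‖ 0 with h | h
    · simp [h]
    · rw [div_le_iff₀ (by positivity), mul_assoc, mul_assoc, inv_mul_cancel₀ h, mul_one]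
      have : 2⁻¹ ≤ ‖(ζ : ℂ) - σ‖⁻¹ := inv_anti₀ (by positivity) (by linarith)
      linarith

theorem re_herglotz_self
    (hint : Integrable (fun ζ : 𝕊 => (‖(ζ : ℂ) - σ‖ ^ 2)⁻¹) μ) : (herglotz μ σ).re = 0 := by
  rw [herglotz, ← RCLike.re_eq_complex_re, ← integral_re (integrable_herglotz_kernel_self hint)]
  refine integral_eq_zero_of_ae (.of_forall fun ζ => ?_)
  change (((ζ : ℂ) + σ) / (ζ - σ)).re = 0
  rw [re_add_div_sub (norm_coe_sphere ζ), norm_coe_sphere, one_pow, sub_self, zero_div]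

theorem norm_div_mul_sub_le_of_mem_stolzAngle {M : ℝ} {z : 𝔻} (hz : z ∈ stolzAngle σ M) {ζ : 𝕊}
    (hζ : ζ ≠ σ) :
    ‖-2 * (ζ : ℂ) / ((ζ - z) * (ζ - σ))‖ ≤ 2 * (1 + M) * (‖(ζ : ℂ) - σ‖ ^ 2)⁻¹ := by
  have h1 := sub_ne_zero_of_norm_eq_one (norm_coe_sphere ζ) z.norm_lt_one
  have h2 : (ζ : ℂ) - σ ≠ 0 := sub_ne_zero.2 (Subtype.coe_ne_coe.2 hζ)
  have hsplit : -2 * (ζ : ℂ) / ((ζ - z) * (ζ - σ)) =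
      -2 * ζ * (1 - (σ - z) / (ζ - z)) / (ζ - σ) ^ 2 := by
    field_simp
    ring
  have hnorm : ‖1 - ((σ : ℂ) - z) / (ζ - z)‖ ≤ 1 + M := by
    simpa using (norm_sub_le 1 (((σ : ℂ) - z) / (ζ - z))).trans
      (add_le_add_right (norm_div_sub_le_of_mem_stolzAngle hz ζ) _)
  rw [hsplit, norm_div, norm_mul, norm_mul, norm_pow, norm_coe_sphere, norm_neg,
    Complex.norm_ofNat, mul_one, div_eq_mul_inv]
  gcongr

theorem hasAngularLimit_herglotz_sub_div [IsFiniteMeasure μ] (h0 : μ {σ} = 0)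
    (hint : Integrable (fun ζ : 𝕊 => (‖(ζ : ℂ) - σ‖ ^ 2)⁻¹) μ) :
    HasAngularLimit (fun z => (herglotz μ z - herglotz μ σ) / (σ - z)) σ
      (conj (σ : ℂ) * (2 * ∫ ζ : 𝕊, (‖(ζ : ℂ) - σ‖ ^ 2)⁻¹ ∂μ : ℝ)) := by
  intro M hM
  have hne : ∀ᵐ ζ ∂μ, ζ ≠ σ := measure_eq_zero_iff_ae_notMem.1 h0
  have hself := integrable_herglotz_kernel_self hint
  have hlim : ∫ ζ : 𝕊, -2 * (ζ : ℂ) / ((ζ - σ) * (ζ - σ)) ∂μ =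
      conj (σ : ℂ) * (2 * ∫ ζ : 𝕊, (‖(ζ : ℂ) - σ‖ ^ 2)⁻¹ ∂μ : ℝ) := by
    rw [Complex.ofReal_mul, Complex.ofReal_ofNat, ← integral_complex_ofReal,
      ← integral_const_mul, ← integral_const_mul]
    exact integral_congr_ae (hne.mono fun ζ hζ => conj_mul_div_normSq_sub hζ)
  have hquot : ∀ z : 𝔻, (herglotz μ z - herglotz μ σ) / (σ - z) =
      ∫ ζ : 𝕊, -2 * (ζ : ℂ) / ((ζ - z) * (ζ - σ)) ∂μ := fun z => by
    rw [herglotz, herglotz, ← integral_sub (integrable_herglotz_kernel z.norm_lt_one) hself,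
      ← integral_div]
    exact integral_congr_ae (hne.mono fun ζ hζ => herglotz_kernel_sub_div z.norm_lt_one hζ)
  simp only [hquot]
  rw [← hlim]
  refine tendsto_integral_filter_of_dominated_convergence
    (fun ζ : 𝕊 => 2 * (1 + M) * (‖(ζ : ℂ) - σ‖ ^ 2)⁻¹) ?_ ?_ (hint.const_mul _) (hne.mono ?_)
  · exact .of_forall fun z =>
      (Measurable.div (by fun_prop) (by fun_prop)).aestronglyMeasurable
  · filter_upwards [eventually_mem_stolzAngle] with z hz
    exact hne.mono fun ζ hζ => norm_div_mul_sub_le_of_mem_stolzAngle hz hζ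
  · intro ζ hζ
    have h2 : (ζ : ℂ) - σ ≠ 0 := sub_ne_zero.2 (Subtype.coe_ne_coe.2 hζ)
    have hcont : ContinuousAt (fun z : ℂ => -2 * (ζ : ℂ) / ((ζ - z) * (ζ - σ))) σ := by
      fun_prop (disch := exact mul_ne_zero h2 h2)
    exact hasAngularLimit_of_continuousAt hcont M hM

theorem measure_singleton_eq_zero_of_hasAngularLimit_div [IsFiniteMeasure μ] {b l : ℂ}
    (h : HasAngularLimit (fun z => (b + herglotz μ z) / (σ - z)) σ l) : μ {σ} = 0 := by
  have hsub : HasAngularLimit (fun z => (σ : ℂ) - z) σ 0 := by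
    have hcont : ContinuousAt (fun z : ℂ => (σ : ℂ) - z) σ := by fun_prop
    simpa using hasAngularLimit_of_continuousAt hcont
  have hzero : HasAngularLimit (fun z => (σ - z) * herglotz μ z) σ 0 := by
    refine (((hsub.mul (hsub.mul h)).sub (hsub.mul (hasAngularLimit_const b))).congr fun z => ?_)
      |>.congr_lim (by ring)
    have := sub_ne_zero_of_norm_eq_one (norm_coe_sphere σ) z.norm_lt_one
    field_simp
    ring
  have hmass := (hasAngularLimit_sub_mul_herglotz (μ := μ) (σ := σ)).unique (norm_coe_sphere σ)
    hzero
  simpa [ne_zero_of_mem_unit_sphere σ, measureReal_eq_zero_iff] using hmass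

theorem integral_inv_normSq_sub_radius_le [IsFiniteMeasure μ] {b r : ℝ} (hr : r ∈ Ioo 0 1) :
    ∫ ζ : 𝕊, (‖(ζ : ℂ) - r * σ‖ ^ 2)⁻¹ ∂μ ≤
      ‖(Complex.I * b + herglotz μ (r * σ)) / (σ - r * σ)‖ := by
  have hnorm : ‖(r : ℂ) * σ‖ = r := by
    rw [norm_mul, norm_coe_sphere, mul_one, Complex.norm_real, Real.norm_of_nonneg hr.1.le]
  have hr1 : 0 < 1 - r := sub_pos.2 hr.2
  have hden : ‖(σ : ℂ) - r * σ‖ = 1 - r := by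
    rw [← one_sub_mul, norm_mul, norm_coe_sphere, mul_one, ← Complex.ofReal_one,
      ← Complex.ofReal_sub, Complex.norm_real, Real.norm_of_nonneg hr1.le]
  have hre := re_herglotz (μ := μ) (hnorm.trans_lt hr.2)
  simp only [hnorm, div_eq_mul_inv] at hre
  rw [integral_const_mul] at hre
  have hle : (herglotz μ (r * σ)).re ≤ ‖Complex.I * b + herglotz μ (r * σ)‖ := by
    simpa using Complex.re_le_norm (Complex.I * b + herglotz μ (r * σ))
  have hI : 0 ≤ ∫ ζ : 𝕊, (‖(ζ : ℂ) - r * σ‖ ^ 2)⁻¹ ∂μ := integral_nonneg fun ζ => by positivity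
  rw [norm_div, hden, le_div_iff₀ hr1]
  nlinarith [mul_nonneg (mul_nonneg hr1.le hr.1.le) hI]

theorem integrable_inv_normSq_sub_of_hasAngularLimit_div [IsFiniteMeasure μ] {b : ℝ} {l : ℂ}
    (h : HasAngularLimit (fun z => (Complex.I * b + herglotz μ z) / (σ - z)) σ l) :
    Integrable (fun ζ : 𝕊 => (‖(ζ : ℂ) - σ‖ ^ 2)⁻¹) μ := by
  have h0 : μ {σ} = 0 := measure_singleton_eq_zero_of_hasAngularLimit_div h
  have hne : ∀ᵐ ζ ∂μ, ζ ≠ σ := measure_eq_zero_iff_ae_notMem.1 h0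
  have hIoo : ∀ᶠ r : ℝ in 𝓝[<] 1, r ∈ Ioo 0 1 := Ioo_mem_nhdsLT one_pos
  have hmeas : ∀ w : ℂ, Measurable fun ζ : 𝕊 => ‖(‖(ζ : ℂ) - w‖ ^ 2)⁻¹‖ₑ := fun w => by fun_prop
  have hlim : ∀ᵐ ζ : 𝕊 ∂μ, Tendsto (fun r : ℝ => ‖(‖(ζ : ℂ) - r * σ‖ ^ 2)⁻¹‖ₑ) (𝓝[<] 1)
      (𝓝 ‖(‖(ζ : ℂ) - σ‖ ^ 2)⁻¹‖ₑ) := by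
    filter_upwards [hne] with ζ hζ
    have h2 : ‖(ζ : ℂ) - (1 : ℝ) * σ‖ ^ 2 ≠ 0 := by
      rw [Complex.ofReal_one, one_mul]
      exact pow_ne_zero 2 (norm_ne_zero_iff.2 (sub_ne_zero.2 (Subtype.coe_ne_coe.2 hζ)))
    have hcont : ContinuousAt (fun r : ℝ => (‖(ζ : ℂ) - r * σ‖ ^ 2)⁻¹) 1 := by
      fun_prop (disch := exact h2)
    simpa using (hcont.tendsto.mono_left nhdsWithin_le_nhds).enorm
  have hbound : ∀ᶠ r : ℝ in 𝓝[<] 1,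
      ∫⁻ ζ : 𝕊, ‖(‖(ζ : ℂ) - r * σ‖ ^ 2)⁻¹‖ₑ ∂μ ≤ ENNReal.ofReal (‖l‖ + 1) := by
    filter_upwards [hIoo, (HasAngularLimit.tendsto_radius (norm_coe_sphere σ)
      (F := fun z => (Complex.I * b + herglotz μ z) / (σ - z)) h).norm.eventually
      (eventually_le_nhds (lt_add_one ‖l‖))] with r hr hle
    have hlt : ‖(r : ℂ) * σ‖ < 1 := by
      simpa [norm_coe_sphere, abs_of_pos hr.1] using hr.2
    have hint : Integrable (fun ζ : 𝕊 => (‖(ζ : ℂ) - r * σ‖ ^ 2)⁻¹) μ :=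
      integrable_of_continuous_sphere (Continuous.inv₀ (by fun_prop) fun ζ => pow_ne_zero 2
        (norm_ne_zero_iff.2 (sub_ne_zero_of_norm_eq_one (norm_coe_sphere ζ) hlt)))
    rw [← ofReal_integral_norm_eq_lintegral_enorm hint]
    refine ENNReal.ofReal_le_ofReal (le_trans (le_of_eq ?_)
      ((integral_inv_normSq_sub_radius_le hr).trans hle))
    exact integral_congr_ae (.of_forall fun ζ => Real.norm_of_nonneg (by positivity))
  refine ⟨Measurable.aestronglyMeasurable (by fun_prop), ?_⟩
  calc ∫⁻ ζ : 𝕊, ‖(‖(ζ : ℂ) - σ‖ ^ 2)⁻¹‖ₑ ∂μ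
      = ∫⁻ ζ : 𝕊, liminf (fun r : ℝ => ‖(‖(ζ : ℂ) - r * σ‖ ^ 2)⁻¹‖ₑ) (𝓝[<] 1) ∂μ :=
        lintegral_congr_ae (hlim.mono fun ζ hζ => hζ.liminf_eq.symm)
    _ ≤ liminf (fun r : ℝ => ∫⁻ ζ : 𝕊, ‖(‖(ζ : ℂ) - r * σ‖ ^ 2)⁻¹‖ₑ ∂μ) (𝓝[<] 1) :=
        lintegral_liminf_le fun r => hmeas _
    _ ≤ ENNReal.ofReal (‖l‖ + 1) := liminf_le_of_frequently_le' hbound.frequently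
    _ < ⊤ := ENNReal.ofReal_lt_top

end BoundaryBehaviour

section Uniqueness

variable {μ ν : Measure 𝕊}

theorem integrable_cauchy_kernel_mul_zpow [IsFiniteMeasure μ] {z : ℂ} (hz : ‖z‖ < 1) (n : ℤ) :
    Integrable (fun ζ : 𝕊 => (ζ : ℂ) / (ζ - z) * (ζ : ℂ) ^ n) μ :=
  integrable_of_continuous_sphere ((Continuous.div (by fun_prop) (by fun_prop) fun ζ =>
    sub_ne_zero_of_norm_eq_one (norm_coe_sphere ζ) hz).mul
    (continuous_subtype_val.zpow₀ n fun ζ => .inl (ne_zero_of_mem_unit_sphere ζ)))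

theorem herglotz_eq_integral_cauchy_kernel [IsFiniteMeasure μ] {z : ℂ} (hz : ‖z‖ < 1) :
    herglotz μ z = 2 * (∫ ζ : 𝕊, (ζ : ℂ) / (ζ - z) ∂μ) - μ.real univ := by
  have hint : Integrable (fun ζ : 𝕊 => (ζ : ℂ) / (ζ - z)) μ := by
    simpa only [zpow_zero, mul_one] using integrable_cauchy_kernel_mul_zpow (μ := μ) hz 0
  have hone : (μ.real univ : ℂ) = ∫ _ : 𝕊, (1 : ℂ) ∂μ := by
    rw [integral_const, Complex.real_smul, mul_one]
  rw [hone, ← integral_const_mul, ← integral_sub (hint.const_mul 2) (integrable_const 1), herglotz]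
  refine integral_congr_ae (.of_forall fun ζ => ?_)
  have := sub_ne_zero_of_norm_eq_one (norm_coe_sphere ζ) hz
  field_simp
  ring

theorem continuousAt_integral_cauchy_kernel [IsFiniteMeasure μ] (n : ℤ) :
    ContinuousAt (fun z => ∫ ζ : 𝕊, (ζ : ℂ) / (ζ - z) * (ζ : ℂ) ^ n ∂μ) 0 := by
  have hlt : ∀ᶠ z : ℂ in 𝓝 0, ‖z‖ < 2⁻¹ :=
    continuous_norm.tendsto' 0 0 norm_zero (Iio_mem_nhds (by norm_num))
  refine continuousAt_of_dominated (bound := fun _ => 2) ?_ ?_ (integrable_const _)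
    (.of_forall fun ζ => ?_)
  · filter_upwards [hlt] with z hz
    exact (integrable_cauchy_kernel_mul_zpow (by linarith) n).aestronglyMeasurable
  · filter_upwards [hlt] with z hz
    refine .of_forall fun ζ => ?_
    have h := one_sub_norm_le_norm_sub ζ z
    rw [norm_mul, norm_div, norm_zpow, norm_coe_sphere, one_zpow, mul_one, one_div]
    exact inv_le_of_inv_le₀ two_pos (by linarith)
  · have hζ : (ζ : ℂ) - 0 ≠ 0 := by simpa using ne_zero_of_mem_unit_sphere ζ
    fun_prop (disch := exact hζ)

theorem integral_cauchy_kernel_mul_zpow_eq [IsFiniteMeasure μ] [IsFiniteMeasure ν]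
    (h : ∀ z, ‖z‖ < 1 → herglotz μ z = herglotz ν z) (n : ℕ) {z : ℂ} (hz : ‖z‖ < 1) :
    ∫ ζ : 𝕊, (ζ : ℂ) / (ζ - z) * (ζ : ℂ) ^ (-n : ℤ) ∂μ =
      ∫ ζ : 𝕊, (ζ : ℂ) / (ζ - z) * (ζ : ℂ) ^ (-n : ℤ) ∂ν := by
  induction n generalizing z with
  | zero =>
    have h0 := h 0 (by simp)
    have hz := herglotz_eq_integral_cauchy_kernel (μ := μ) hz ▸
      herglotz_eq_integral_cauchy_kernel (μ := ν) hz ▸ h z hz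
    rw [herglotz_zero_right, herglotz_zero_right] at h0
    simpa [h0] using hz
  | succ n ih =>
    have hstep : ∀ (ρ : Measure 𝕊) [IsFiniteMeasure ρ] (w : ℂ), ‖w‖ < 1 → w ≠ 0 →
        ∫ ζ : 𝕊, (ζ : ℂ) / (ζ - w) * (ζ : ℂ) ^ (-(n + 1 : ℕ) : ℤ) ∂ρ =
          ((∫ ζ : 𝕊, (ζ : ℂ) / (ζ - w) * (ζ : ℂ) ^ (-n : ℤ) ∂ρ) -
            ∫ ζ : 𝕊, (ζ : ℂ) / (ζ - 0) * (ζ : ℂ) ^ (-n : ℤ) ∂ρ) / w := by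
      intro ρ _ w hw hw0
      rw [← integral_sub (integrable_cauchy_kernel_mul_zpow hw _)
        (integrable_cauchy_kernel_mul_zpow (by simp) _), ← integral_div]
      refine integral_congr_ae (.of_forall fun ζ => ?_)
      have h1 := sub_ne_zero_of_norm_eq_one (norm_coe_sphere ζ) hw
      have h2 : (ζ : ℂ) ≠ 0 := ne_zero_of_mem_unit_sphere ζ
      simp only [zpow_neg, zpow_natCast, sub_zero]
      field_simp
      ring
    have hpunctured : ∀ w : ℂ, ‖w‖ < 1 → w ≠ 0 →
        ∫ ζ : 𝕊, (ζ : ℂ) / (ζ - w) * (ζ : ℂ) ^ (-(n + 1 : ℕ) : ℤ) ∂μ =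
          ∫ ζ : 𝕊, (ζ : ℂ) / (ζ - w) * (ζ : ℂ) ^ (-(n + 1 : ℕ) : ℤ) ∂ν := fun w hw hw0 => by
      rw [hstep μ w hw hw0, hstep ν w hw hw0, ih hw, ih (by simp)]
    rcases eq_or_ne z 0 with rfl | hz0
    · have hball : ball (0 : ℂ) 1 ∈ 𝓝 0 := ball_mem_nhds 0 one_pos
      refine tendsto_nhds_unique (l := 𝓝[≠] (0 : ℂ))
        ((continuousAt_integral_cauchy_kernel (μ := μ) _).tendsto.mono_left
          nhdsWithin_le_nhds)
        (((continuousAt_integral_cauchy_kernel (μ := ν) _).tendsto.mono_left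
          nhdsWithin_le_nhds).congr' ?_)
      filter_upwards [self_mem_nhdsWithin, nhdsWithin_le_nhds hball] with w hw0 hw
      exact (hpunctured w (mem_ball_zero_iff.1 hw) hw0).symm
    · exact hpunctured z hz hz0

theorem integral_zpow_eq_of_herglotz_eq [IsFiniteMeasure μ] [IsFiniteMeasure ν]
    (h : ∀ z, ‖z‖ < 1 → herglotz μ z = herglotz ν z) (n : ℤ) :
    ∫ ζ : 𝕊, (ζ : ℂ) ^ n ∂μ = ∫ ζ : 𝕊, (ζ : ℂ) ^ n ∂ν := by
  have hneg : ∀ m : ℕ, ∫ ζ : 𝕊, (ζ : ℂ) ^ (-m : ℤ) ∂μ = ∫ ζ : 𝕊, (ζ : ℂ) ^ (-m : ℤ) ∂ν :=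
    fun m => by
      simpa [ne_zero_of_mem_unit_sphere] using
        integral_cauchy_kernel_mul_zpow_eq h m (z := 0) (by simp)
  have hconj : ∀ (m : ℕ) (ζ : 𝕊), (ζ : ℂ) ^ (m : ℤ) = conj ((ζ : ℂ) ^ (-m : ℤ)) := fun m ζ => by
    rw [map_zpow₀, ← Complex.inv_eq_conj (norm_coe_sphere ζ), inv_zpow, zpow_neg, inv_inv]
  obtain ⟨m, rfl | rfl⟩ := n.eq_nat_or_neg
  · simp only [hconj, integral_conj, hneg]
  · exact hneg m

theorem exists_eq_zpow_of_mem_closure {f : BoundedContinuousFunction 𝕊 ℂ}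
    {e : BoundedContinuousFunction 𝕊 ℂ} (he : ∀ ζ, e ζ = ζ)
    (hf : f ∈ Submonoid.closure ({e} ∪ star {e})) : ∃ n : ℤ, ∀ ζ : 𝕊, f ζ = (ζ : ℂ) ^ n := by
  induction hf using Submonoid.closure_induction with
  | mem f hf =>
    rcases hf with rfl | hf
    · exact ⟨1, by simpa using he⟩
    · rw [Set.mem_star, mem_singleton_iff] at hf
      refine ⟨-1, fun ζ => ?_⟩
      rw [← star_star f, hf, zpow_neg_one, Complex.inv_eq_conj (norm_coe_sphere ζ), ← he ζ]
      rfl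
  | one => exact ⟨0, fun ζ => (zpow_zero (ζ : ℂ)).symm⟩
  | mul f g _ _ hf hg =>
    obtain ⟨n, hn⟩ := hf
    obtain ⟨m, hm⟩ := hg
    exact ⟨n + m, fun ζ => by
      rw [BoundedContinuousFunction.mul_apply, hn, hm, zpow_add₀ (ne_zero_of_mem_unit_sphere ζ)]⟩

theorem eq_of_forall_integral_zpow_eq [IsFiniteMeasure μ] [IsFiniteMeasure ν]
    (h : ∀ n : ℤ, ∫ ζ : 𝕊, (ζ : ℂ) ^ n ∂μ = ∫ ζ : 𝕊, (ζ : ℂ) ^ n ∂ν) : μ = ν := by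
  let e : BoundedContinuousFunction 𝕊 ℂ :=
    BoundedContinuousFunction.mkOfCompact ⟨fun ζ => ζ, continuous_subtype_val⟩
  refine ext_of_forall_mem_subalgebra_integral_eq_of_polish (𝕜 := ℂ)
    (A := StarAlgebra.adjoin ℂ {e}) (fun ζ ζ' hne => ?_) fun f hf => ?_
  · exact ⟨e, ⟨_, StarSubalgebra.mem_map.2
      ⟨e, StarAlgebra.self_mem_adjoin_singleton ℂ e, rfl⟩, rfl⟩, Subtype.coe_ne_coe.2 hne⟩
  · have hspan : f ∈ Submodule.span ℂ (Submonoid.closure ({e} ∪ star {e}) : Set _) := by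
      rw [← Algebra.adjoin_eq_span]
      exact hf
    clear hf
    induction hspan using Submodule.span_induction with
    | mem f hf =>
      obtain ⟨n, hn⟩ := exists_eq_zpow_of_mem_closure (e := e) (fun _ => rfl) hf
      simp only [hn, h n]
    | zero => simp
    | add f g _ _ hf hg =>
      simp only [BoundedContinuousFunction.add_apply]
      rw [integral_add (f.integrable μ) (g.integrable μ),
        integral_add (f.integrable ν) (g.integrable ν), hf, hg]
    | smul c f _ hf =>
      simp only [BoundedContinuousFunction.smul_apply, integral_smul, hf]

theorem eq_of_herglotz_eq [IsFiniteMeasure μ] [IsFiniteMeasure ν]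
    (h : ∀ z, ‖z‖ < 1 → herglotz μ z = herglotz ν z) : μ = ν :=
  eq_of_forall_integral_zpow_eq (integral_zpow_eq_of_herglotz_eq h)

end Uniqueness

section Decomposition

variable {μ : Measure 𝕊}

theorem herglotz_restrict_add_compl [IsFiniteMeasure μ] {S : Set 𝕊} (hS : MeasurableSet S) {z : ℂ}
    (hz : ‖z‖ < 1) :
    herglotz (μ.restrict S) z + herglotz (μ.restrict Sᶜ) z = herglotz μ z :=
  integral_add_compl hS (integrable_herglotz_kernel hz)

theorem herglotz_restrict_finset [IsFiniteMeasure μ] (S : Finset 𝕊) {z : ℂ} (hz : ‖z‖ < 1) :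
    herglotz (μ.restrict S) z = ∑ ζ ∈ S, (μ.real {ζ} : ℂ) * ((ζ + z) / (ζ - z)) := by
  rw [herglotz, setIntegral_finset S (integrable_herglotz_kernel hz).integrableOn]
  simp only [Complex.real_smul]

theorem isHerglotz_herglotz_sub_sum [IsFiniteMeasure μ] {ι : Type*} [Fintype ι] {σ : ι → 𝕊}
    (hσ : Function.Injective σ) :
    IsHerglotz fun z => herglotz μ z - ∑ k, (μ.real {σ k} : ℂ) * ((σ k + z) / (σ k - z)) := by
  have hrest : ∀ z, ‖z‖ < 1 → herglotz μ z - ∑ k, (μ.real {σ k} : ℂ) * ((σ k + z) / (σ k - z)) =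
      herglotz (μ.restrict (Finset.univ.map ⟨σ, hσ⟩ : Finset 𝕊)ᶜ) z := fun z hz => by
    rw [← herglotz_restrict_add_compl (Finset.univ.map ⟨σ, hσ⟩).measurableSet hz,
      herglotz_restrict_finset _ hz, Finset.sum_map, Function.Embedding.coeFn_mk,
      add_sub_cancel_left]
  refine ⟨differentiableOn_herglotz.congr fun z hz => hrest z (mem_ball_zero_iff.1 hz),
    fun z hz => ?_⟩
  rw [hrest z hz]
  exact isHerglotz_herglotz.re_nonneg z hz

theorem herglotz_sum_smul_restrict [IsFiniteMeasure μ] {ι : Type*} [Fintype ι] (U : ι → Set 𝕊)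
    (c : ι → ℝ≥0) {z : ℂ} (hz : ‖z‖ < 1) :
    herglotz (∑ j, c j • μ.restrict (U j)) z = ∑ j, (c j : ℂ) * herglotz (μ.restrict (U j)) z := by
  rw [herglotz, integral_finsetSum_measure fun j _ => integrable_herglotz_kernel hz]
  refine Finset.sum_congr rfl fun j _ => ?_
  rw [integral_smul_nnreal_measure, herglotz]
  rfl

theorem eq_zero_of_sum_smul_herglotz_restrict_eq [IsFiniteMeasure μ] {ι : Type*} [Fintype ι]
    {U : ι → Set 𝕊} (hU : ∀ j, MeasurableSet (U j)) (hdisj : Pairwise (Function.onFun Disjoint U))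
    (hμ : ∀ j, μ (U j) ≠ 0) {c : ι → ℝ} {b : ℝ}
    (h : ∀ z, ‖z‖ < 1 → ∑ j, (c j : ℂ) * herglotz (μ.restrict (U j)) z = Complex.I * b) :
    c = 0 := by
  have hb : b = 0 := by
    have h0 := congrArg Complex.im (h 0 (by simp))
    simpa [herglotz_zero_right] using h0.symm
  have heq := eq_of_herglotz_eq (μ := ∑ j, (c j).toNNReal • μ.restrict (U j))
    (ν := ∑ j, (-c j).toNNReal • μ.restrict (U j)) fun z hz => by
      rw [herglotz_sum_smul_restrict U _ hz, herglotz_sum_smul_restrict U _ hz, ← sub_eq_zero,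
        ← Finset.sum_sub_distrib]
      simp only [← sub_mul, ← Complex.ofReal_sub, Real.coe_toNNReal',
        max_zero_sub_max_neg_zero_eq_self, h z hz, hb, Complex.ofReal_zero, mul_zero]
  have heval : ∀ (a : ι → ℝ≥0) (i : ι), (∑ j, a j • μ.restrict (U j)) (U i) = a i * μ (U i) :=
    fun a i => by
      rw [Measure.finsetSum_apply, Finset.sum_eq_single i]
      · rw [Measure.smul_apply, Measure.restrict_apply_self, ENNReal.smul_def, smul_eq_mul]
      · intro j _ hji
        rw [Measure.smul_apply, Measure.restrict_apply (hU i), (hdisj hji.symm).inter_eq,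
          measure_empty, smul_zero]
      · simp
  funext i
  have hi := congrArg (fun ρ : Measure 𝕊 => ρ (U i)) heq
  simp only [heval] at hi
  rw [ENNReal.mul_left_inj (hμ i) (measure_ne_top _ _), ENNReal.coe_inj] at hi
  have := congrArg ((↑) : ℝ≥0 → ℝ) hi
  rwa [← sub_eq_zero, Real.coe_toNNReal', Real.coe_toNNReal',
    max_zero_sub_max_neg_zero_eq_self] at this

theorem exists_finset_or_exists_disjoint_of_card (n : ℕ) :
    (∃ S : Finset 𝕊, S.card ≤ n ∧ μ (S : Set 𝕊)ᶜ = 0) ∨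
      ∃ U : Fin (n + 1) → Set 𝕊, (∀ j, MeasurableSet (U j)) ∧
        Pairwise (Function.onFun Disjoint U) ∧ ∀ j, μ (U j) ≠ 0 := by
  have hcompl : μ μ.supportᶜ = 0 := Measure.measure_compl_support
  rcases le_or_gt μ.support.encard n with hle | hlt
  · have hfin : μ.support.Finite := finite_of_encard_le_coe hle
    refine .inl ⟨hfin.toFinset, ?_, by rwa [hfin.coe_toFinset]⟩
    rwa [hfin.encard_eq_coe_toFinset_card, Nat.cast_le] at hle
  · obtain ⟨T, hT, hcard⟩ := exists_subset_encard_eq (Order.add_one_le_of_lt hlt)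
    have hfin : T.Finite := finite_of_encard_eq_coe (k := n + 1) (by exact_mod_cast hcard)
    obtain ⟨U, hU, hdisj⟩ := hfin.t2_separation
    have hTcard : hfin.toFinset.card = n + 1 := by
      rw [hfin.encard_eq_coe_toFinset_card] at hcard
      exact_mod_cast hcard
    let x := hfin.toFinset.equivFinOfCardEq hTcard |>.symm
    have hx : ∀ j, (x j : 𝕊) ∈ T := fun j => hfin.mem_toFinset.1 (x j).2
    refine .inr ⟨fun j => U (x j), fun j => (hU _).2.measurableSet, fun i j hij => ?_, fun j => ?_⟩
    · exact hdisj (hx i) (hx j) fun h => hij (x.injective (Subtype.ext h))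
    · exact ((Measure.mem_support_iff_forall _).1 (hT (hx j)) _
        ((hU _).2.mem_nhds (hU _).1)).ne'

end Decomposition

section HyperbolicContraction

theorem one_sub_sq_norm_pos {z : ℂ} (hz : ‖z‖ < 1) : 0 < 1 - ‖z‖ ^ 2 :=
  sub_pos.2 (pow_lt_one₀ (norm_nonneg z) hz two_ne_zero)

theorem norm_herglotz_kernel_sub_le {z w : ℂ} (hz : ‖z‖ < 1) (hw : ‖w‖ < 1) (ζ : 𝕊) :
    ‖((ζ : ℂ) + z) / (ζ - z) - (ζ + w) / (ζ - w)‖ ≤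
      ‖z - w‖ * (1 / ‖(ζ : ℂ) - z‖ ^ 2 + 1 / ‖(ζ : ℂ) - w‖ ^ 2) := by
  have hζz := sub_ne_zero_of_norm_eq_one (norm_coe_sphere ζ) hz
  have hζw := sub_ne_zero_of_norm_eq_one (norm_coe_sphere ζ) hw
  have heq : ((ζ : ℂ) + z) / (ζ - z) - (ζ + w) / (ζ - w) =
      (z - w) * ((2 * ζ) * ((ζ - z)⁻¹ * (ζ - w)⁻¹)) := by
    field_simp
    ring
  rw [heq, norm_mul, norm_mul, norm_mul, norm_mul, norm_coe_sphere, norm_inv, norm_inv,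
    one_div, one_div, ← inv_pow, ← inv_pow, Complex.norm_ofNat]
  gcongr
  linarith [two_mul_le_add_sq ‖(ζ : ℂ) - z‖⁻¹ ‖(ζ : ℂ) - w‖⁻¹]

theorem IsHerglotz.norm_sub_le {p : ℂ → ℂ} (hp : IsHerglotz p) {z w : ℂ} (hz : ‖z‖ < 1)
    (hw : ‖w‖ < 1) :
    ‖p z - p w‖ ≤ ‖z - w‖ * ((p z).re / (1 - ‖z‖ ^ 2) + (p w).re / (1 - ‖w‖ ^ 2)) := by
  obtain ⟨μ, _, b, hμ⟩ := hp.exists_eq_herglotz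
  have hpoisson {u : ℂ} (hu : ‖u‖ < 1) :
      (p u).re / (1 - ‖u‖ ^ 2) = ∫ ζ : 𝕊, 1 / ‖(ζ : ℂ) - u‖ ^ 2 ∂μ := by
    rw [hμ u hu, Complex.add_re, Complex.I_mul_re, Complex.ofReal_im, neg_zero, zero_add,
      re_herglotz hu, ← integral_div]
    simp only [div_right_comm _ _ (1 - ‖u‖ ^ 2), div_self (one_sub_sq_norm_pos hu).ne']
  have hint {u : ℂ} (hu : ‖u‖ < 1) : Integrable (fun ζ : 𝕊 => 1 / ‖(ζ : ℂ) - u‖ ^ 2) μ :=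
    integrable_of_continuous_sphere <| Continuous.div (by fun_prop) (by fun_prop) fun ζ =>
      pow_ne_zero 2 (norm_ne_zero_iff.2 (sub_ne_zero_of_norm_eq_one (norm_coe_sphere ζ) hu))
  rw [hpoisson hz, hpoisson hw, ← integral_add (hint hz) (hint hw), ← integral_const_mul, hμ z hz,
    hμ w hw, add_sub_add_left_eq_sub, herglotz, herglotz,
    ← integral_sub (integrable_herglotz_kernel hz) (integrable_herglotz_kernel hw)]
  exact norm_integral_le_of_norm_le (((hint hz).add (hint hw)).const_mul _)
    (.of_forall (norm_herglotz_kernel_sub_le hz hw))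

theorem IsHerglotz.hasDerivAt {p : ℂ → ℂ} (hp : IsHerglotz p) {z : ℂ} (hz : ‖z‖ < 1) :
    HasDerivAt p (deriv p z) z :=
  (hp.differentiableOn.differentiableAt
    (isOpen_ball.mem_nhds (mem_ball_zero_iff.2 hz))).hasDerivAt

theorem IsHerglotz.norm_deriv_mul_le {p : ℂ → ℂ} (hp : IsHerglotz p) {w : ℂ} (hw : ‖w‖ < 1) :
    ‖deriv p w‖ * (1 - ‖w‖ ^ 2) ≤ 2 * (p w).re := by
  have hd := hp.hasDerivAt hw
  have hre : ContinuousAt (fun z => (p z).re) w :=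
    Complex.continuous_re.continuousAt.comp hd.continuousAt
  have hpos := one_sub_sq_norm_pos hw
  have hlim : Tendsto (fun z => (p z).re / (1 - ‖z‖ ^ 2) + (p w).re / (1 - ‖w‖ ^ 2)) (𝓝[≠] w)
      (𝓝 ((p w).re / (1 - ‖w‖ ^ 2) + (p w).re / (1 - ‖w‖ ^ 2))) :=
    ((hre.div (by fun_prop) hpos.ne').add continuousAt_const).tendsto.mono_left nhdsWithin_le_nhds
  have hle : ‖deriv p w‖ ≤ (p w).re / (1 - ‖w‖ ^ 2) + (p w).re / (1 - ‖w‖ ^ 2) := by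
    refine le_of_tendsto_of_tendsto (hasDerivAt_iff_tendsto_slope.1 hd).norm hlim ?_
    filter_upwards [nhdsWithin_le_nhds (isOpen_ball.mem_nhds (mem_ball_zero_iff.2 hw)),
      self_mem_nhdsWithin] with z hz hzw
    rw [slope_def_field, norm_div, div_le_iff₀' (norm_pos_iff.2 (sub_ne_zero.2 hzw))]
    exact hp.norm_sub_le (mem_ball_zero_iff.1 hz) hw
  rw [← add_div, le_div_iff₀ hpos] at hle
  linarith

/-- Holomorphic vector fields on the disc whose flow contracts the hyperbolic metric, expressed
infinitesimally. -/
structure IsContracting (G : ℂ → ℂ) : Prop where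
  differentiableOn : DifferentiableOn ℂ G (ball 0 1)
  re_deriv_le : ∀ z, ‖z‖ < 1 → (deriv G z).re * (1 - ‖z‖ ^ 2) + 2 * (conj z * G z).re ≤ 0

/-- The vector field with Denjoy-Wolff point `τ` and Berkson-Porta factor `p`. -/
def berksonPorta (τ : ℂ) (p : ℂ → ℂ) (z : ℂ) : ℂ :=
  (τ - z) * (1 - conj τ * z) * p z

theorem IsHerglotz.differentiableOn_berksonPorta {p : ℂ → ℂ} (hp : IsHerglotz p) (τ : ℂ) :
    DifferentiableOn ℂ (berksonPorta τ p) (ball 0 1) :=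
  DifferentiableOn.mul (by fun_prop) hp.differentiableOn

theorem ofReal_sq_norm (z : ℂ) : ((‖z‖ ^ 2 : ℝ) : ℂ) = z * conj z := by
  rw [Complex.mul_conj, Complex.normSq_eq_norm_sq]

theorem deriv_berksonPorta_mul_add {p : ℂ → ℂ} {z : ℂ} (hp : DifferentiableAt ℂ p z) (τ : ℂ) :
    deriv (berksonPorta τ p) z * (1 - ‖z‖ ^ 2 : ℝ) + (2 : ℝ) * (conj z * berksonPorta τ p z) =
      (-(‖τ - z‖ ^ 2 + ‖1 - conj τ * z‖ ^ 2) : ℝ) * p z +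
        (1 - ‖z‖ ^ 2 : ℝ) * ((τ - z) * (1 - conj τ * z) * deriv p z) := by
  have hτ : HasDerivAt (fun z : ℂ => τ - z) (-1) z := by
    simpa using (hasDerivAt_id z).const_sub τ
  have hconj : HasDerivAt (fun z : ℂ => 1 - conj τ * z) (-conj τ) z := by
    simpa using ((hasDerivAt_id z).const_mul (conj τ)).const_sub 1
  rw [show deriv (berksonPorta τ p) z = _ from ((hτ.mul hconj).mul hp.hasDerivAt).deriv,
    Complex.ofReal_neg, Complex.ofReal_add, Complex.ofReal_sub, ofReal_sq_norm, ofReal_sq_norm,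
    ofReal_sq_norm]
  simp only [berksonPorta, Pi.mul_apply, map_sub, map_mul, map_one, Complex.conj_conj]
  push_cast
  ring

theorem IsHerglotz.isContracting_berksonPorta {p : ℂ → ℂ} (hp : IsHerglotz p) (τ : ℂ) :
    IsContracting (berksonPorta τ p) where
  differentiableOn := hp.differentiableOn_berksonPorta τ
  re_deriv_le z hz := by
    have hre := congrArg Complex.re
      (deriv_berksonPorta_mul_add (hp.hasDerivAt hz).differentiableAt τ)
    rw [Complex.add_re, Complex.add_re, Complex.re_mul_ofReal, Complex.re_ofReal_mul,
      Complex.re_ofReal_mul, Complex.re_ofReal_mul] at hre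
    rw [hre]
    have hpos := one_sub_sq_norm_pos hz
    have hderiv : (1 - ‖z‖ ^ 2) * ((τ - z) * (1 - conj τ * z) * deriv p z).re ≤
        ‖τ - z‖ * ‖1 - conj τ * z‖ * (2 * (p z).re) := by
      calc _ ≤ (1 - ‖z‖ ^ 2) * (‖τ - z‖ * ‖1 - conj τ * z‖ * ‖deriv p z‖) := by
            rw [← norm_mul, ← norm_mul]
            gcongr
            exact Complex.re_le_norm _
        _ = ‖τ - z‖ * ‖1 - conj τ * z‖ * (‖deriv p z‖ * (1 - ‖z‖ ^ 2)) := by ring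
        _ ≤ _ := mul_le_mul_of_nonneg_left (hp.norm_deriv_mul_le hz) (by positivity)
    nlinarith [mul_nonneg (sq_nonneg (‖τ - z‖ - ‖1 - conj τ * z‖)) (hp.re_nonneg z hz)]

end HyperbolicContraction

section Trajectories

theorem exists_lipschitzOnWith_closedBall {G : ℂ → ℂ} (hG : DifferentiableOn ℂ G (ball 0 1))
    {ρ : ℝ} (hρ : ρ < 1) : ∃ K : ℝ≥0, LipschitzOnWith K G (closedBall 0 ρ) := by
  have hsub : closedBall (0 : ℂ) ρ ⊆ ball 0 1 := closedBall_subset_ball hρ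
  obtain ⟨K, hK⟩ := (isCompact_closedBall (0 : ℂ) ρ).exists_bound_of_continuousOn
    ((hG.deriv isOpen_ball).continuousOn.mono hsub)
  refine ⟨K.toNNReal, (convex_closedBall 0 ρ).lipschitzOnWith_of_nnnorm_deriv_le
    (fun z hz => hG.differentiableAt (isOpen_ball.mem_nhds (hsub hz))) fun z hz => ?_⟩
  rw [← NNReal.coe_le_coe, coe_nnnorm]
  exact (hK z hz).trans (Real.le_coe_toNNReal K)

/-- `x` solves `x' = G x` on `[0, T]` and stays in the disc. -/
def IsTraj (G : ℂ → ℂ) (T : ℝ) (x : ℝ → ℂ) : Prop :=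
  ∀ t ∈ Icc 0 T, ‖x t‖ < 1 ∧ HasDerivWithinAt x (G (x t)) (Icc 0 T) t

variable {G : ℂ → ℂ} {T : ℝ} {x y : ℝ → ℂ}

theorem IsTraj.continuousOn (hx : IsTraj G T x) : ContinuousOn x (Icc 0 T) :=
  fun t ht => (hx t ht).2.continuousWithinAt

theorem IsTraj.mono {S : ℝ} (hx : IsTraj G T x) (hST : S ≤ T) : IsTraj G S x :=
  fun t ht => (hx t ⟨ht.1, ht.2.trans hST⟩).imp_right
    fun h => h.mono (Icc_subset_Icc_right hST)

theorem IsTraj.hasDerivWithinAt_Ici (hx : IsTraj G T x) {t : ℝ} (ht : t ∈ Ico 0 T) :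
    HasDerivWithinAt x (G (x t)) (Ici t) t :=
  ((hx t (Ico_subset_Icc_self ht)).2.mono (Icc_subset_Icc_left ht.1)).mono_of_mem_nhdsWithin
    (Icc_mem_nhdsGE ht.2)

theorem IsTraj.exists_norm_le (hx : IsTraj G T x) : ∃ ρ < 1, ∀ t ∈ Icc 0 T, ‖x t‖ ≤ ρ := by
  rcases (Icc 0 T).eq_empty_or_nonempty with hempty | hne
  · exact ⟨0, one_pos, by simp [hempty]⟩
  · obtain ⟨t, ht, hmax⟩ := isCompact_Icc.exists_isMaxOn hne hx.continuousOn.norm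
    exact ⟨‖x t‖, (hx t ht).1, hmax⟩

theorem IsTraj.dist_le {K : ℝ≥0} {ρ : ℝ} (hG : LipschitzOnWith K G (closedBall 0 ρ))
    (hx : IsTraj G T x) (hy : IsTraj G T y) (hxρ : ∀ t ∈ Icc 0 T, ‖x t‖ ≤ ρ)
    (hyρ : ∀ t ∈ Icc 0 T, ‖y t‖ ≤ ρ) {t : ℝ} (ht : t ∈ Icc 0 T) :
    dist (x t) (y t) ≤ dist (x 0) (y 0) * Real.exp (K * t) := by
  simpa using dist_le_of_trajectories_ODE_of_mem (v := fun _ => G) (fun _ _ => hG) hx.continuousOn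
    (fun s hs => hx.hasDerivWithinAt_Ici hs)
    (fun s hs => mem_closedBall_zero_iff.2 (hxρ s (Ico_subset_Icc_self hs))) hy.continuousOn
    (fun s hs => hy.hasDerivWithinAt_Ici hs)
    (fun s hs => mem_closedBall_zero_iff.2 (hyρ s (Ico_subset_Icc_self hs))) le_rfl t ht

theorem IsTraj.eqOn (hG : DifferentiableOn ℂ G (ball 0 1)) (hx : IsTraj G T x) (hy : IsTraj G T y)
    (h0 : x 0 = y 0) : EqOn x y (Icc 0 T) := by
  obtain ⟨ρ₁, hρ₁, hxρ⟩ := hx.exists_norm_le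
  obtain ⟨ρ₂, hρ₂, hyρ⟩ := hy.exists_norm_le
  obtain ⟨K, hK⟩ := exists_lipschitzOnWith_closedBall hG (max_lt hρ₁ hρ₂)
  intro t ht
  have hdist := hx.dist_le hK hy (fun s hs => le_max_of_le_left (hxρ s hs))
    (fun s hs => le_max_of_le_right (hyρ s hs)) ht
  rwa [h0, dist_self, zero_mul, dist_le_zero] at hdist

end Trajectories

section Existence

variable {G : ℂ → ℂ} {T : ℝ} {x : ℝ → ℂ}

theorem exists_cutoff (hG : DifferentiableOn ℂ G (ball 0 1)) {ρ : ℝ} (hρ : ρ < 1) :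
    ∃ c : ℂ → ℝ, (∀ z, c z ∈ Icc 0 1) ∧ (∀ z, ‖z‖ ≤ ρ → c z = 1) ∧ (∀ z, 1 ≤ ‖z‖ → c z = 0) ∧
      HasCompactSupport (fun z => c z * G z) ∧ ContDiff ℝ 1 (fun z => c z * G z) := by
  have hmax : max ρ (1 / 2) < 1 := max_lt hρ (by norm_num)
  let χ : ContDiffBump (0 : ℂ) :=
    ⟨max ρ (1 / 2), (1 + max ρ (1 / 2)) / 2, by positivity, by linarith⟩
  have hχ (z : ℂ) (hz : χ.rOut ≤ ‖z‖) : χ z = 0 := χ.zero_of_le_dist (by simpa using hz)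
  have hrOut : χ.rOut < 1 := by change (1 + max ρ (1 / 2)) / 2 < 1; linarith
  refine ⟨χ, fun z => ⟨χ.nonneg, χ.le_one⟩, fun z hz => χ.one_of_mem_closedBall
    (mem_closedBall_zero_iff.2 (hz.trans (le_max_left _ _))), fun z hz => hχ z (hrOut.le.trans hz),
    .intro (isCompact_closedBall 0 χ.rOut) fun z hz => ?_, contDiff_iff_contDiffAt.2 fun z => ?_⟩
  · rw [mem_closedBall_zero_iff, not_le] at hz
    rw [hχ z hz.le, Complex.ofReal_zero, zero_mul]
  · rcases lt_or_ge ‖z‖ 1 with hz | hz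
    · have hGz : ContDiffAt ℝ 1 G z := ((hG.analyticAt (isOpen_ball.mem_nhds
        (mem_ball_zero_iff.2 hz))).contDiffAt (n := 1)).restrict_scalars ℝ
      exact (Complex.ofRealCLM.contDiff.contDiffAt.comp z χ.contDiffAt).mul hGz
    · have hzero : (fun z => (χ z : ℂ) * G z) =ᶠ[𝓝 z] fun _ => 0 := by
        filter_upwards [(continuous_norm.tendsto z).eventually (lt_mem_nhds (hrOut.trans_le hz))]
          with w hw
        rw [hχ w hw.le, Complex.ofReal_zero, zero_mul]
      exact contDiffAt_const.congr_of_eventuallyEq hzero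

theorem exists_isTraj_of_contDiff {V : ℂ → ℂ} (hsupp : HasCompactSupport V)
    (hV : ContDiff ℝ 1 V) (h0 : ∀ z, 1 ≤ ‖z‖ → V z = 0) {z : ℂ} (hz : ‖z‖ < 1) (hT : 0 ≤ T) :
    ∃ x, x 0 = z ∧ IsTraj V T x := by
  obtain ⟨K, hK⟩ := hV.lipschitzWith_of_hasCompactSupport hsupp one_ne_zero
  obtain ⟨B, hB⟩ := hsupp.exists_bound_of_continuous hV.continuous
  have hpl : IsPicardLindelof (fun _ => V) (tmin := 0) (tmax := T) ⟨0, left_mem_Icc.2 hT⟩ z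
      (B.toNNReal * ⟨T, hT⟩) 0 B.toNNReal K :=
    .of_time_independent (fun w _ => (hB w).trans (Real.le_coe_toNNReal B)) hK.lipschitzOnWith
      (by simp [hT]; rfl)
  obtain ⟨x, hx0, hx⟩ := hpl.exists_eq_forall_mem_Icc_hasDerivWithinAt₀
  refine ⟨x, hx0, fun t ht => ⟨?_, hx t ht⟩⟩
  by_contra! hxt
  have hsub : Icc 0 t ⊆ Icc 0 T := Icc_subset_Icc_right ht.2
  have hconst : EqOn x (fun _ => x t) (Icc 0 t) :=
    ODE_solution_unique_of_mem_Icc_left (v := fun _ => V) (s := fun _ => univ)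
      (fun _ _ => hK.lipschitzOnWith) (fun s hs => (hx s (hsub hs)).continuousWithinAt.mono hsub)
      (fun s hs => ((hx s (hsub (Ioc_subset_Icc_self hs))).mono
        (Icc_subset_Icc_right (hs.2.trans ht.2))).mono_of_mem_nhdsWithin (Icc_mem_nhdsLE hs.1))
      (fun _ _ => trivial) continuousOn_const
      (fun s _ => by simpa only [h0 _ hxt] using hasDerivWithinAt_const s _ (x t))
      (fun _ _ => trivial) rfl
  have hzt : z = x t := hx0.symm.trans (hconst (left_mem_Icc.2 ht.1))
  exact (hzt ▸ hz).not_ge hxt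

theorem hasDerivWithinAt_one_sub_sq_norm {d : ℂ} {s : Set ℝ} {t : ℝ}
    (h : HasDerivWithinAt x d s t) :
    HasDerivWithinAt (fun t => 1 - ‖x t‖ ^ 2) (-(2 * (conj (x t) * d).re)) s t := by
  simpa only [Complex.inner, mul_comm d] using h.norm_sq.const_sub 1

theorem IsTraj.one_sub_sq_norm_pos (hx : IsTraj G T x) {t : ℝ} (ht : t ∈ Icc 0 T) :
    0 < 1 - ‖x t‖ ^ 2 :=
  DiscSemigroup.one_sub_sq_norm_pos (hx t ht).1

theorem real_inner_mul_ofReal_mul_self (a w : ℂ) (c : ℝ) :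
    inner ℝ w (a * (c * w)) = c * ‖w‖ ^ 2 * a.re := by
  have hcomm : a * (c * w) * conj w = (c * ‖w‖ ^ 2 : ℝ) * a := by
    rw [Complex.ofReal_mul, ofReal_sq_norm]
    ring
  rw [Complex.inner, hcomm, Complex.re_ofReal_mul]

/- The trajectories below are reparametrised by a cutoff factor `c`, which is only used to construct
them; it is the hyperbolic speed `‖G‖ / (1 - ‖x‖²)` of `G`, not of `c * G`, that decreases. -/
theorem IsTraj.antitoneOn_sq_norm_div (hG : IsContracting G) {c : ℂ → ℝ} (hc : ∀ z, 0 ≤ c z)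
    (hx : IsTraj (fun z => c z * G z) T x) :
    AntitoneOn (fun t => ‖G (x t)‖ ^ 2 / (1 - ‖x t‖ ^ 2) ^ 2) (Icc 0 T) := by
  have hGx (t : ℝ) (ht : t ∈ Icc 0 T) : HasDerivWithinAt (fun t => G (x t))
      (deriv G (x t) * (c (x t) * G (x t))) (Icc 0 T) t := by
    rw [mul_comm]
    exact (hG.differentiableOn.differentiableAt (isOpen_ball.mem_nhds
      (mem_ball_zero_iff.2 (hx t ht).1))).hasDerivAt.scomp_hasDerivWithinAt t (hx t ht).2
  have hderiv (t : ℝ) (ht : t ∈ Icc 0 T) :=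
    (hGx t ht).norm_sq.div ((hasDerivWithinAt_one_sub_sq_norm (hx t ht).2).pow 2)
      (pow_ne_zero 2 (hx.one_sub_sq_norm_pos ht).ne')
  refine antitoneOn_of_hasDerivWithinAt_nonpos (convex_Icc 0 T)
    (fun t ht => (hderiv t ht).continuousWithinAt)
    (fun t ht => (hderiv t (interior_subset ht)).mono interior_subset) fun t ht => ?_
  have ht := interior_subset ht
  have hpos := hx.one_sub_sq_norm_pos ht
  refine div_nonpos_of_nonpos_of_nonneg ?_ (by positivity)
  rw [real_inner_mul_ofReal_mul_self, mul_left_comm (conj (x t)), Complex.re_ofReal_mul]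
  calc _ = 2 * c (x t) * ‖G (x t)‖ ^ 2 * (1 - ‖x t‖ ^ 2) *
        ((deriv G (x t)).re * (1 - ‖x t‖ ^ 2) + 2 * (conj (x t) * G (x t)).re) := by
        simp only [Pi.pow_apply]
        ring
    _ ≤ 0 := mul_nonpos_of_nonneg_of_nonpos
        (mul_nonneg (mul_nonneg (mul_nonneg two_pos.le (hc _)) (by positivity)) hpos.le)
        (hG.re_deriv_le _ (hx t ht).1)

theorem IsTraj.norm_le_mul (hG : IsContracting G) {c : ℂ → ℝ} (hc : ∀ z, 0 ≤ c z)
    (hx : IsTraj (fun z => c z * G z) T x) {t : ℝ} (ht : t ∈ Icc 0 T) :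
    ‖G (x t)‖ ≤ ‖G (x 0)‖ / (1 - ‖x 0‖ ^ 2) * (1 - ‖x t‖ ^ 2) := by
  have h0 : (0 : ℝ) ∈ Icc 0 T := left_mem_Icc.2 (ht.1.trans ht.2)
  have hle := hx.antitoneOn_sq_norm_div hG hc h0 ht ht.1
  simp only [← div_pow] at hle
  rw [← div_le_iff₀ (hx.one_sub_sq_norm_pos ht)]
  exact le_of_pow_le_pow_left₀ two_ne_zero
    (div_nonneg (norm_nonneg _) (hx.one_sub_sq_norm_pos h0).le) hle

theorem IsTraj.monotoneOn_one_sub_sq_norm_mul_exp {V : ℂ → ℂ} (hx : IsTraj V T x) {K : ℝ}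
    (hV : ∀ t ∈ Icc 0 T, ‖V (x t)‖ ≤ K * (1 - ‖x t‖ ^ 2)) :
    MonotoneOn (fun t => (1 - ‖x t‖ ^ 2) * Real.exp (2 * K * t)) (Icc 0 T) := by
  have hderiv (t : ℝ) (ht : t ∈ Icc 0 T) := (hasDerivWithinAt_one_sub_sq_norm (hx t ht).2).mul
    (((hasDerivAt_id t).const_mul (2 * K)).exp.hasDerivWithinAt)
  refine monotoneOn_of_hasDerivWithinAt_nonneg (convex_Icc 0 T)
    (fun t ht => (hderiv t ht).continuousWithinAt)
    (fun t ht => (hderiv t (interior_subset ht)).mono interior_subset) fun t ht => ?_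
  have ht := interior_subset ht
  have hle : (conj (x t) * V (x t)).re ≤ K * (1 - ‖x t‖ ^ 2) := by
    refine (Complex.re_le_norm _).trans (le_trans ?_ (hV t ht))
    rw [norm_mul, RCLike.norm_conj]
    exact mul_le_of_le_one_left (norm_nonneg _) (hx t ht).1.le
  simp only [id, mul_one]
  nlinarith [mul_nonneg (Real.exp_pos (2 * K * t)).le (sub_nonneg.2 hle)]

/-- A lower bound for `1 - ‖x t‖ ^ 2`, `t ∈ [0, T]`, along the trajectory of `G` that starts at
`z`. -/
noncomputable def boundaryGap (G : ℂ → ℂ) (T : ℝ) (z : ℂ) : ℝ :=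
  (1 - ‖z‖ ^ 2) * Real.exp (-(2 * (‖G z‖ / (1 - ‖z‖ ^ 2)) * T))

theorem boundaryGap_pos {z : ℂ} (hz : ‖z‖ < 1) : 0 < boundaryGap G T z :=
  mul_pos (one_sub_sq_norm_pos hz) (Real.exp_pos _)

theorem continuousAt_boundaryGap (hG : DifferentiableOn ℂ G (ball 0 1)) {z : ℂ} (hz : ‖z‖ < 1) :
    ContinuousAt (boundaryGap G T) z := by
  have hGz : ContinuousAt G z :=
    hG.continuousOn.continuousAt (isOpen_ball.mem_nhds (mem_ball_zero_iff.2 hz))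
  have hquot : ContinuousAt (fun z => ‖G z‖ / (1 - ‖z‖ ^ 2)) z :=
    hGz.norm.div (by fun_prop) (one_sub_sq_norm_pos hz).ne'
  exact ContinuousAt.mul (by fun_prop)
    (Real.continuous_exp.continuousAt.comp ((hquot.const_mul 2).mul_const T).neg)

theorem IsTraj.boundaryGap_le (hG : IsContracting G) {c : ℂ → ℝ} (hc : ∀ z, c z ∈ Icc 0 1)
    (hx : IsTraj (fun z => c z * G z) T x) {t : ℝ} (ht : t ∈ Icc 0 T) :
    boundaryGap G T (x 0) ≤ 1 - ‖x t‖ ^ 2 := by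
  have h0 : (0 : ℝ) ∈ Icc 0 T := left_mem_Icc.2 (ht.1.trans ht.2)
  set K := ‖G (x 0)‖ / (1 - ‖x 0‖ ^ 2) with hK
  have hmono := hx.monotoneOn_one_sub_sq_norm_mul_exp (K := K) (fun s hs => by
    rw [norm_mul, Complex.norm_real, Real.norm_of_nonneg (hc _).1]
    exact (mul_le_of_le_one_left (norm_nonneg _) (hc _).2).trans
      (hx.norm_le_mul hG (fun z => (hc z).1) hs)) h0 ht ht.1
  simp only [mul_zero, Real.exp_zero, mul_one] at hmono
  have hK0 : 0 ≤ K := div_nonneg (norm_nonneg _) (hx.one_sub_sq_norm_pos h0).le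
  rw [boundaryGap, ← hK, Real.exp_neg, ← div_eq_mul_inv, div_le_iff₀ (Real.exp_pos _)]
  refine hmono.trans (mul_le_mul_of_nonneg_left ?_ (hx.one_sub_sq_norm_pos ht).le)
  exact Real.exp_le_exp.2 (mul_le_mul_of_nonneg_left ht.2 (by positivity))

theorem IsContracting.exists_isTraj (hG : IsContracting G) {z : ℂ} (hz : ‖z‖ < 1) (hT : 0 ≤ T) :
    ∃ x, x 0 = z ∧ IsTraj G T x := by
  have hρ : √(1 - boundaryGap G T z) < 1 := by
    rw [Real.sqrt_lt' one_pos]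
    linarith [boundaryGap_pos (G := G) (T := T) hz]
  obtain ⟨c, hc, hc1, hc0, hsupp, hdiff⟩ := exists_cutoff hG.differentiableOn hρ
  obtain ⟨x, rfl, hx⟩ := exists_isTraj_of_contDiff hsupp hdiff
    (fun w hw => by rw [hc0 w hw, Complex.ofReal_zero, zero_mul]) hz hT
  refine ⟨x, rfl, fun t ht => ⟨(hx t ht).1, ?_⟩⟩
  have hone : c (x t) = 1 :=
    hc1 _ (Real.le_sqrt_of_sq_le (by linarith [hx.boundaryGap_le hG hc ht]))
  simpa only [hone, Complex.ofReal_one, one_mul] using (hx t ht).2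

end Existence

section Flow

variable {G : ℂ → ℂ} {T : ℝ} {x y : ℝ → ℂ}

theorem norm_sub_sub_deriv_mul_le (hG : DifferentiableOn ℂ G (ball 0 1)) {K : ℝ≥0} {ρ : ℝ}
    (hρ : ρ < 1) (hK : LipschitzOnWith K (deriv G) (closedBall 0 ρ)) {a b : ℂ} (ha : ‖a‖ ≤ ρ)
    (hb : ‖b‖ ≤ ρ) : ‖G b - G a - deriv G a * (b - a)‖ ≤ K * ‖b - a‖ ^ 2 := by
  have ha' : a ∈ closedBall 0 ρ := mem_closedBall_zero_iff.2 ha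
  have hmean := Convex.norm_image_sub_le_of_norm_hasDerivWithin_le (𝕜 := ℂ)
    (f := fun w => G w - deriv G a * w) (f' := fun w => deriv G w - deriv G a * 1)
    (s := closedBall 0 ρ ∩ closedBall a ‖b - a‖) (C := K * ‖b - a‖) (x := a) (y := b)
    (fun w hw => ((hG.differentiableAt (isOpen_ball.mem_nhds
      (closedBall_subset_ball hρ hw.1))).hasDerivAt.sub
        ((hasDerivAt_id w).const_mul (deriv G a))).hasDerivWithinAt)
    (fun w hw => by
      rw [mul_one, ← dist_eq_norm]
      exact (hK.dist_le_mul w hw.1 a ha').trans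
        (mul_le_mul_of_nonneg_left (mem_closedBall.1 hw.2) K.2))
    ((convex_closedBall _ _).inter (convex_closedBall _ _))
    ⟨ha', mem_closedBall_self (norm_nonneg _)⟩
    ⟨mem_closedBall_zero_iff.2 hb, mem_closedBall_iff_norm.2 le_rfl⟩
  calc ‖G b - G a - deriv G a * (b - a)‖
      = ‖G b - deriv G a * b - (G a - deriv G a * a)‖ := by congr 1; ring
    _ ≤ K * ‖b - a‖ * ‖b - a‖ := hmean
    _ = K * ‖b - a‖ ^ 2 := by ring

theorem exists_hasDerivWithinAt_Icc {f : ℝ → ℂ} (hf : ContinuousOn f (Icc 0 T)) :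
    ∃ A : ℝ → ℂ, A 0 = 0 ∧ ∀ t ∈ Icc 0 T, HasDerivWithinAt A (f t) (Icc 0 T) t := by
  refine ⟨fun t => ∫ s in (0 : ℝ)..t, f s, intervalIntegral.integral_same, fun t ht => ?_⟩
  have : Fact (t ∈ Icc 0 T) := ⟨ht⟩
  have hint : IntervalIntegrable f volume 0 t :=
    (hf.mono (by rw [uIcc_of_le ht.1]; exact Icc_subset_Icc_right ht.2)).intervalIntegrable
  exact intervalIntegral.integral_hasDerivWithinAt_right hint
    ⟨_, self_mem_nhdsWithin, hf.aestronglyMeasurable measurableSet_Icc⟩ (hf t ht)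

theorem IsTraj.hasDerivWithinAt_sub_mul_exp {A : ℝ → ℂ} (hx : IsTraj G T x) (hy : IsTraj G T y)
    {t : ℝ} (ht : t ∈ Icc 0 T) (hA : HasDerivWithinAt A (deriv G (y t)) (Icc 0 T) t) :
    HasDerivWithinAt (fun t => (x t - y t) * Complex.exp (-A t))
      (Complex.exp (-A t) * (G (x t) - G (y t) - deriv G (y t) * (x t - y t))) (Icc 0 T) t :=
  (((hx t ht).2.sub (hy t ht).2).mul hA.neg.cexp).congr_deriv (by
    simp only [Pi.neg_apply, Pi.sub_apply]
    ring)

theorem IsTraj.exists_norm_sub_sub_mul_le (hG : DifferentiableOn ℂ G (ball 0 1)) {ρ : ℝ}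
    (hρ : ρ < 1) (hT : 0 ≤ T) (hy : IsTraj G T y) (hyρ : ∀ t ∈ Icc 0 T, ‖y t‖ ≤ ρ) :
    ∃ (E : ℂ) (C : ℝ), ∀ x, IsTraj G T x → (∀ t ∈ Icc 0 T, ‖x t‖ ≤ ρ) →
      ‖x T - y T - (x 0 - y 0) * E‖ ≤ C * ‖x 0 - y 0‖ ^ 2 := by
  obtain ⟨K, hK⟩ := exists_lipschitzOnWith_closedBall hG hρ
  have hG' := hG.deriv isOpen_ball
  obtain ⟨K', hK'⟩ := exists_lipschitzOnWith_closedBall hG' hρ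
  obtain ⟨A, hA0, hA⟩ := exists_hasDerivWithinAt_Icc (hG'.continuousOn.comp hy.continuousOn
    fun t ht => mem_ball_zero_iff.2 (hy t ht).1)
  obtain ⟨M, hM⟩ := isCompact_Icc.exists_bound_of_continuousOn
    fun t ht => (hA t ht).neg.cexp.continuousWithinAt
  have hM0 : 0 ≤ M := (norm_nonneg _).trans (hM 0 (left_mem_Icc.2 hT))
  refine ⟨Complex.exp (A T), ‖Complex.exp (A T)‖ * (M * (K' * Real.exp (K * T) ^ 2) * T),
    fun x hx hxρ => ?_⟩
  have hdist (t : ℝ) (ht : t ∈ Icc 0 T) : ‖x t - y t‖ ≤ ‖x 0 - y 0‖ * Real.exp (K * T) := by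
    rw [← dist_eq_norm, ← dist_eq_norm]
    exact (hx.dist_le hK hy hxρ hyρ ht).trans (by gcongr; exact ht.2)
  have hmean := (convex_Icc 0 T).norm_image_sub_le_of_norm_hasDerivWithin_le
    (C := M * (K' * (‖x 0 - y 0‖ * Real.exp (K * T)) ^ 2))
    (fun t ht => hx.hasDerivWithinAt_sub_mul_exp hy ht (hA t ht))
    (fun t ht => ?_) (left_mem_Icc.2 hT) (right_mem_Icc.2 hT)
  · have hinv : Complex.exp (A T) * Complex.exp (-A T) = 1 := by
      rw [← Complex.exp_add, add_neg_cancel, Complex.exp_zero]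
    rw [hA0, neg_zero, Complex.exp_zero, mul_one, sub_zero, Real.norm_of_nonneg hT] at hmean
    calc ‖x T - y T - (x 0 - y 0) * Complex.exp (A T)‖
        = ‖Complex.exp (A T)‖ * ‖(x T - y T) * Complex.exp (-A T) - (x 0 - y 0)‖ := by
          rw [← norm_mul]
          congr 1
          linear_combination (-(x T - y T)) * hinv
      _ ≤ _ := mul_le_mul_of_nonneg_left hmean (norm_nonneg _)
      _ = _ := by ring
  · rw [norm_mul]
    refine mul_le_mul (hM t ht) ?_ (norm_nonneg _) hM0
    exact (norm_sub_sub_deriv_mul_le hG hρ hK' (hyρ t ht) (hxρ t ht)).trans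
      (by gcongr; exact hdist t ht)

/-- `X z` is a trajectory of `G` on `[0, ∞)` that starts at `z`, for every point `z` of the disc. -/
def IsFlow (G : ℂ → ℂ) (X : ℂ → ℝ → ℂ) : Prop :=
  ∀ z, ‖z‖ < 1 → X z 0 = z ∧ ∀ T, IsTraj G T (X z)

theorem IsContracting.exists_isTraj_forall (hG : IsContracting G) {z : ℂ} (hz : ‖z‖ < 1) :
    ∃ x, x 0 = z ∧ ∀ T, IsTraj G T x := by
  choose! y hy0 hy using fun T (hT : 0 ≤ T) => hG.exists_isTraj (T := T) hz hT
  have heq {S T : ℝ} (hS : 0 ≤ S) (hST : S ≤ T) : y S S = y T S :=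
    (hy S hS).eqOn hG.differentiableOn ((hy T (hS.trans hST)).mono hST)
      (by rw [hy0 S hS, hy0 T (hS.trans hST)]) (right_mem_Icc.2 hS)
  refine ⟨fun t => y t t, hy0 0 le_rfl, fun T t ht => ?_⟩
  obtain ⟨hlt, hderiv⟩ := hy T (ht.1.trans ht.2) t ht
  rw [← heq ht.1 ht.2] at hlt hderiv
  exact ⟨hlt, hderiv.congr (fun s hs => heq hs.1 hs.2) (heq ht.1 ht.2)⟩

theorem IsContracting.exists_isFlow (hG : IsContracting G) : ∃ X, IsFlow G X := by
  choose! X hX using fun z (hz : ‖z‖ < 1) => hG.exists_isTraj_forall hz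
  exact ⟨X, hX⟩

variable {X : ℂ → ℝ → ℂ}

theorem IsFlow.norm_lt_one (hX : IsFlow G X) {z : ℂ} (hz : ‖z‖ < 1) {t : ℝ} (ht : 0 ≤ t) :
    ‖X z t‖ < 1 :=
  ((hX z hz).2 t t ⟨ht, le_rfl⟩).1

theorem IsFlow.hasDerivWithinAt (hX : IsFlow G X) {z : ℂ} (hz : ‖z‖ < 1) {t : ℝ} (ht : 0 ≤ t) :
    HasDerivWithinAt (X z) (G (X z t)) (Ici 0) t := by
  refine ((hX z hz).2 (t + 1) t ⟨ht, by linarith⟩).2.mono_of_mem_nhdsWithin ?_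
  rw [← Ici_inter_Iic]
  exact inter_mem self_mem_nhdsWithin (nhdsWithin_le_nhds (Iic_mem_nhds (by linarith)))

theorem IsFlow.add (hG : DifferentiableOn ℂ G (ball 0 1)) (hX : IsFlow G X) {z : ℂ}
    (hz : ‖z‖ < 1) {s t : ℝ} (hs : 0 ≤ s) (ht : 0 ≤ t) : X z (s + t) = X (X z t) s := by
  have hw := hX.norm_lt_one hz ht
  have hshift : IsTraj G s fun u => X z (u + t) := fun u hu => by
    have hut : 0 ≤ u + t := add_nonneg hu.1 ht
    have hadd : HasDerivWithinAt (fun u : ℝ => u + t) 1 (Icc 0 s) u :=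
      ((hasDerivAt_id u).add_const t).hasDerivWithinAt
    refine ⟨hX.norm_lt_one hz hut, ?_⟩
    have hcomp := (hX.hasDerivWithinAt hz hut).scomp u hadd fun v hv => add_nonneg hv.1 ht
    rw [one_smul] at hcomp
    exact hcomp
  exact hshift.eqOn hG ((hX _ hw).2 s) (by rw [zero_add, (hX _ hw).1]) (right_mem_Icc.2 hs)

theorem IsFlow.differentiableAt (hG : IsContracting G) (hX : IsFlow G X) {t : ℝ} (ht : 0 ≤ t)
    {z : ℂ} (hz : ‖z‖ < 1) : DifferentiableAt ℂ (fun w => X w t) z := by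
  set g := boundaryGap G t
  have hg : 0 < g z := boundaryGap_pos hz
  have hρ : √(1 - g z / 2) < 1 := by
    rw [Real.sqrt_lt' one_pos]
    linarith
  have hle {w : ℂ} (hw : ‖w‖ < 1) (hgw : g z / 2 < g w) (s : ℝ) (hs : s ∈ Icc 0 t) :
      ‖X w s‖ ≤ √(1 - g z / 2) := by
    have hgap := IsTraj.boundaryGap_le (c := fun _ => 1) hG (fun _ => ⟨zero_le_one, le_rfl⟩)
      (by simpa only [Complex.ofReal_one, one_mul] using (hX w hw).2 t) hs
    rw [(hX w hw).1] at hgap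
    exact Real.le_sqrt_of_sq_le (by linarith)
  obtain ⟨E, C, hC⟩ := ((hX z hz).2 t).exists_norm_sub_sub_mul_le hG.differentiableOn hρ ht
    (hle hz (by linarith))
  have hbound : ∀ᶠ w in 𝓝 z, ‖X w t - X z t - (w - z) • E‖ ≤ C * ‖‖w - z‖ ^ 2‖ := by
    filter_upwards [(continuous_norm.tendsto z).eventually (gt_mem_nhds hz),
      (continuousAt_boundaryGap hG.differentiableOn hz).eventually (lt_mem_nhds (half_lt_self hg))]
      with w hw hgw
    have hCw := hC (X w) ((hX w hw).2 t) (hle hw hgw)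
    rwa [(hX w hw).1, (hX z hz).1, ← smul_eq_mul, ← Real.norm_of_nonneg (sq_nonneg ‖w - z‖)] at hCw
  have hderiv : HasDerivAt (fun w => X w t) E z := hasDerivAt_iff_isLittleO.2
    ((Asymptotics.IsBigO.of_bound C hbound).trans_isLittleO
      (Asymptotics.isLittleO_pow_sub_sub z one_lt_two))
  exact hderiv.differentiableAt

theorem isHol_coe_of_differentiableOn {F : ℂ → ℂ} (hF : DifferentiableOn ℂ F (ball 0 1)) :
    IsHol (fun z : 𝔻 => F z) :=
  hF.congr fun _ hz => dif_pos (mem_ball_zero_iff.1 hz)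

theorem IsContracting.exists_isSemigroup (hG : IsContracting G) :
    ∃ φ : ℝ≥0 → 𝔻 → 𝔻, IsSemigroup φ ∧ IsGenerator φ (fun z => G z) := by
  obtain ⟨X, hX⟩ := hG.exists_isFlow
  let φ (t : ℝ≥0) (z : 𝔻) : 𝔻 := .mk (X z t) (hX.norm_lt_one z.norm_lt_one t.2)
  have hcoe (z : 𝔻) : EqOn (fun s : ℝ => (φ s.toNNReal z : ℂ)) (X z) (Ici 0) :=
    fun s hs => congrArg (X z) (Real.coe_toNNReal s hs)
  refine ⟨φ, ⟨fun t => ?_, fun z => ?_, fun s t z => ?_, fun z => ?_⟩,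
    isHol_coe_of_differentiableOn hG.differentiableOn, fun z t => ?_⟩
  · exact isHol_coe_of_differentiableOn (F := fun z => X z t) fun z hz =>
      (hX.differentiableAt hG t.2 (mem_ball_zero_iff.1 hz)).differentiableWithinAt
  · exact Complex.UnitDisc.coe_injective (hX z z.norm_lt_one).1
  · exact Complex.UnitDisc.coe_injective
      (hX.add hG.differentiableOn z.norm_lt_one s.2 t.2)
  · rw [Complex.UnitDisc.isEmbedding_coe.tendsto_nhds_iff]
    have hcont := (hX.hasDerivWithinAt z.norm_lt_one le_rfl).continuousWithinAt.tendsto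
    rw [(hX z z.norm_lt_one).1] at hcont
    exact hcont.comp (tendsto_nhdsWithin_iff.2
      ⟨(NNReal.continuous_coe.tendsto 0).mono_left nhdsWithin_le_nhds, .of_forall fun t => t.2⟩)
  · exact (hX.hasDerivWithinAt z.norm_lt_one t.2).congr (hcoe z) (hcoe z t.2)

end Flow

section SelfMap

theorem IsHol.exists_differentiableOn {f : 𝔻 → ℂ} (hf : IsHol f) :
    ∃ F : ℂ → ℂ, DifferentiableOn ℂ F (ball 0 1) ∧ ∀ z : 𝔻, F z = f z :=
  ⟨_, hf, fun z => by simp [z.norm_lt_one]⟩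

theorem norm_lt_one_of_coe_eq {f : 𝔻 → 𝔻} {F : ℂ → ℂ} (hFf : ∀ z : 𝔻, F z = f z) {z : ℂ}
    (hz : ‖z‖ < 1) : ‖F z‖ < 1 := by
  rw [← Complex.UnitDisc.coe_mk z hz, hFf]
  exact (f _).norm_lt_one

theorem ne_zero_of_norm_eq_one {σ : ℂ} (hσ : ‖σ‖ = 1) : σ ≠ 0 :=
  norm_ne_zero_iff.1 (hσ ▸ one_ne_zero)

theorem re_add_div_sub_pos {σ z : ℂ} (hσ : ‖σ‖ = 1) (hz : ‖z‖ < 1) :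
    0 < ((σ + z) / (σ - z)).re := by
  rw [re_add_div_sub hσ]
  exact div_pos (one_sub_sq_norm_pos hz)
    (pow_pos (norm_pos_iff.2 (sub_ne_zero_of_norm_eq_one hσ hz)) 2)

theorem IsHerglotz.exists_mass {ι : Type*} [Fintype ι] {p : ℂ → ℂ} (hp : IsHerglotz p) {σ : ι → ℂ}
    (hσ : ∀ k, ‖σ k‖ = 1) (hinj : Function.Injective σ) :
    ∃ β : ι → ℝ, (∀ k, 0 ≤ β k) ∧
      IsHerglotz (fun z => p z - ∑ k, (β k : ℂ) * ((σ k + z) / (σ k - z))) ∧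
      ∀ k, HasAngularLimit (fun z => (σ k - z) * p z) (σ k) (2 * σ k * β k) := by
  obtain ⟨μ, _, b, hμ⟩ := hp.exists_eq_herglotz
  let ζ (k : ι) : 𝕊 := ⟨σ k, mem_sphere_zero_iff_norm.2 (hσ k)⟩
  have hrest := isHerglotz_herglotz_sub_sum (μ := μ) (σ := ζ)
    fun j k h => hinj (congrArg Subtype.val h)
  refine ⟨fun k => μ.real {ζ k}, fun k => measureReal_nonneg, ⟨?_, fun z hz => ?_⟩, fun k => ?_⟩
  · exact (hrest.differentiableOn.const_add (Complex.I * b)).congr fun z hz => by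
      rw [hμ z (mem_ball_zero_iff.1 hz), add_sub_assoc]
  · rw [hμ z hz, add_sub_assoc, Complex.add_re, Complex.I_mul_re, Complex.ofReal_im, neg_zero,
      zero_add]
    exact hrest.re_nonneg z hz
  · have hconst : HasAngularLimit (fun z => (σ k - z) * (Complex.I * b)) (σ k)
        ((σ k - σ k) * (Complex.I * b)) :=
      hasAngularLimit_of_continuousAt (F := fun z => (σ k - z) * (Complex.I * b)) (by fun_prop)
    refine ((hconst.add (hasAngularLimit_sub_mul_herglotz (σ := ζ k))).congr fun z => ?_).congr_lim
      (by rw [sub_self, zero_mul, zero_add])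
    rw [hμ z z.norm_lt_one, mul_add]

variable {f : 𝔻 → 𝔻} {σ : ℂ}

theorem exists_mass_cayley (hf : IsHol fun z => (f z : ℂ)) (hσ : ‖σ‖ = 1) {c : ℝ}
    (hc : ∀ z : 𝔻, c * ((σ + z) / (σ - z) : ℂ).re ≤ ((σ + f z) / (σ - f z) : ℂ).re) :
    ∃ β : ℝ, c ≤ β ∧ (∀ z : 𝔻, β * ((σ + z) / (σ - z) : ℂ).re ≤ ((σ + f z) / (σ - f z) : ℂ).re) ∧
      HasAngularLimit (fun z => (σ - z) * ((σ + f z) / (σ - f z))) σ (2 * σ * β) := by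
  obtain ⟨F, hF, hFf⟩ := hf.exists_differentiableOn
  have hq : IsHerglotz fun z => (σ + F z) / (σ - F z) - c * ((σ + z) / (σ - z)) := by
    refine ⟨.sub (.div (by fun_prop) (by fun_prop) fun z hz =>
      sub_ne_zero_of_norm_eq_one hσ (norm_lt_one_of_coe_eq hFf (mem_ball_zero_iff.1 hz)))
      (.const_mul (.div (by fun_prop) (by fun_prop) fun z hz =>
        sub_ne_zero_of_norm_eq_one hσ (mem_ball_zero_iff.1 hz)) _), fun z hz => ?_⟩
    rw [Complex.sub_re, Complex.re_ofReal_mul, sub_nonneg, ← Complex.UnitDisc.coe_mk z hz, hFf]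
    exact hc _
  obtain ⟨β, hβ, hmass, hlim⟩ := hq.exists_mass (ι := Unit) (fun _ => hσ) fun _ _ _ => rfl
  refine ⟨β () + c, le_add_of_nonneg_left (hβ ()), fun z => ?_, ?_⟩
  · have hre := hmass.re_nonneg z z.norm_lt_one
    simp only [Finset.univ_unique, Finset.sum_singleton, Complex.sub_re, Complex.re_ofReal_mul,
      hFf, PUnit.default_eq_unit] at hre
    linarith
  · have hc : HasAngularLimit (fun z => c * (σ + z)) σ (c * (σ + σ)) :=
      hasAngularLimit_of_continuousAt (F := fun z => c * (σ + z)) (by fun_prop)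
    refine (((hlim ()).add hc).congr fun z => ?_).congr_lim (by push_cast; ring)
    have := sub_ne_zero_of_norm_eq_one hσ z.norm_lt_one
    rw [hFf]
    field_simp
    ring

theorem hasAngularLimit_sub_self (σ : ℂ) : HasAngularLimit (fun z => σ - z) σ 0 :=
  HasAngularLimit.congr_lim
    (hasAngularLimit_of_continuousAt (F := fun z => σ - z) (by fun_prop)) (sub_self σ)

theorem hasAngularLimit_sub_div_sub (hσ : ‖σ‖ = 1) {l : ℂ}
    (h : HasAngularLimit (fun z => (σ - z) * ((σ + f z) / (σ - f z))) σ (2 * σ * l)) :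
    HasAngularLimit (fun z => (σ - z) / (σ - f z)) σ l := by
  have hσ0 : 2 * σ ≠ 0 := mul_ne_zero two_ne_zero (ne_zero_of_norm_eq_one hσ)
  refine (((h.add (hasAngularLimit_sub_self σ)).div (hasAngularLimit_const (2 * σ))
    hσ0).congr fun z => ?_).congr_lim (by rw [add_zero, mul_div_cancel_left₀ _ hσ0])
  have := sub_ne_zero_of_norm_eq_one hσ (f z).norm_lt_one
  have := ne_zero_of_norm_eq_one hσ
  field_simp
  ring

theorem isBoundaryFixedPoint_of_julia (hf : IsHol fun z => (f z : ℂ)) (hσ : ‖σ‖ = 1) {c : ℝ}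
    (hc0 : 0 < c)
    (hc : ∀ z : 𝔻, c * ((σ + z) / (σ - z) : ℂ).re ≤ ((σ + f z) / (σ - f z) : ℂ).re) :
    IsBoundaryFixedPoint f σ ∧ ∃ d : ℝ, d ≤ c⁻¹ ∧ HasAngularDerivAt f σ d := by
  obtain ⟨β, hcβ, -, hlim⟩ := exists_mass_cayley hf hσ hc
  have hβ : (β : ℂ) ≠ 0 := Complex.ofReal_ne_zero.2 (hc0.trans_le hcβ).ne'
  have hderiv : HasAngularDerivAt f σ (β⁻¹ : ℝ) := by
    refine (((hasAngularLimit_const 1).div (hasAngularLimit_sub_div_sub hσ hlim) hβ).congr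
      fun z => ?_).congr_lim (by push_cast; rw [one_div])
    rw [one_div_div, ← neg_sub σ (f z : ℂ), ← neg_sub σ (z : ℂ), neg_div_neg_eq]
  refine ⟨⟨hσ, ?_⟩, β⁻¹, inv_anti₀ hc0 hcβ, hderiv⟩
  refine (((hasAngularLimit_const σ).sub ((hasAngularLimit_sub_self σ).mul hderiv)).congr
    fun z => ?_).congr_lim (by rw [zero_mul, sub_zero])
  have := sub_ne_zero.1 (sub_ne_zero_of_norm_eq_one hσ z.norm_lt_one)
  have : (z : ℂ) - σ ≠ 0 := sub_ne_zero.2 this.symm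
  field_simp
  ring

theorem julia_of_deriv_le_one (hf : IsHol fun z => (f z : ℂ)) (hσ : ‖σ‖ = 1) {d : ℝ} (hd1 : d ≤ 1)
    (hd : HasAngularDerivAt f σ d) (z : 𝔻) :
    ((σ + z) / (σ - z) : ℂ).re ≤ ((σ + f z) / (σ - f z) : ℂ).re := by
  obtain ⟨β, hβ0, hβ, hlim⟩ := exists_mass_cayley hf hσ (c := 0) fun z => by
    rw [zero_mul]
    exact (re_add_div_sub_pos hσ (f z).norm_lt_one).le
  have hone : HasAngularLimit (fun _ => 1) σ (β * d) := by
    refine ((hasAngularLimit_sub_div_sub hσ hlim).mul hd).congr fun z => ?_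
    rw [← neg_sub σ (f z : ℂ), ← neg_sub σ (z : ℂ), neg_div_neg_eq,
      div_mul_div_cancel₀ (sub_ne_zero_of_norm_eq_one hσ (f z).norm_lt_one),
      div_self (sub_ne_zero_of_norm_eq_one hσ z.norm_lt_one)]
  have hβd : β * d = 1 := by exact_mod_cast hone.unique hσ (hasAngularLimit_const 1)
  have hβ1 : 1 ≤ β := by nlinarith
  nlinarith [hβ z, re_add_div_sub_pos hσ z.norm_lt_one]

end SelfMap

section Mobius

theorem one_sub_conj_mul_ne_zero {w z : ℂ} (hw : ‖w‖ ≤ 1) (hz : ‖z‖ < 1) :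
    1 - conj w * z ≠ 0 := by
  refine sub_ne_zero_of_norm_eq_one norm_one ?_
  rw [norm_mul, RCLike.norm_conj]
  exact (mul_le_of_le_one_left (norm_nonneg z) hw).trans_lt hz

/-- The involutive automorphism of the unit disc interchanging `0` and `w`. -/
noncomputable def mobius (w z : ℂ) : ℂ := (w - z) / (1 - conj w * z)

theorem sq_norm_one_sub_conj_mul_sub (w z : ℂ) :
    ‖1 - conj w * z‖ ^ 2 - ‖w - z‖ ^ 2 = (1 - ‖w‖ ^ 2) * (1 - ‖z‖ ^ 2) := by
  simp only [Complex.sq_norm, Complex.normSq_apply, Complex.sub_re, Complex.sub_im, Complex.mul_re,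
    Complex.mul_im, Complex.conj_re, Complex.conj_im, Complex.one_re, Complex.one_im]
  ring

variable {w z : ℂ}

theorem norm_mobius_lt_one (hw : ‖w‖ < 1) (hz : ‖z‖ < 1) : ‖mobius w z‖ < 1 := by
  rw [mobius, norm_div, div_lt_one (norm_pos_iff.2 (one_sub_conj_mul_ne_zero hw.le hz)),
    ← sq_lt_sq₀ (norm_nonneg _) (norm_nonneg _), ← sub_pos, sq_norm_one_sub_conj_mul_sub]
  exact mul_pos (one_sub_sq_norm_pos hw) (one_sub_sq_norm_pos hz)

theorem mobius_mobius (hw : ‖w‖ < 1) (hz : ‖z‖ < 1) : mobius w (mobius w z) = z := by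
  have hwz := one_sub_conj_mul_ne_zero hw.le hz
  have hww := one_sub_conj_mul_ne_zero hw.le hw
  have hden : 1 - conj w * mobius w z = (1 - conj w * w) / (1 - conj w * z) := by
    rw [mobius]
    field_simp
    ring
  rw [mobius, hden, mobius, div_div_eq_mul_div, div_eq_iff hww, sub_mul, div_mul_cancel₀ _ hwz]
  ring

theorem hasDerivAt_mobius (hw : ‖w‖ ≤ 1) (hz : ‖z‖ < 1) :
    HasDerivAt (mobius w) (-(1 - ‖w‖ ^ 2 : ℝ) / (1 - conj w * z) ^ 2) z := by
  refine (((hasDerivAt_id z).const_sub w).div (((hasDerivAt_id z).const_mul (conj w)).const_sub 1)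
    (one_sub_conj_mul_ne_zero hw hz)).congr_deriv ?_
  rw [Complex.ofReal_sub, ofReal_sq_norm, id, Complex.ofReal_one]
  ring

theorem norm_mobius_le_of_eq {F : ℂ → ℂ} (hF : DifferentiableOn ℂ F (ball 0 1))
    (hmaps : ∀ z, ‖z‖ < 1 → ‖F z‖ < 1) (hw : ‖w‖ < 1) (hFw : F w = w) (hz : ‖z‖ < 1) :
    ‖mobius w (F z)‖ ≤ ‖mobius w z‖ := by
  have hdiff : DifferentiableOn ℂ (mobius w) (ball 0 1) := fun z hz =>
    (hasDerivAt_mobius hw.le (mem_ball_zero_iff.1 hz)).differentiableAt.differentiableWithinAt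
  have hball : MapsTo (mobius w) (ball 0 1) (ball 0 1) := fun z hz =>
    mem_ball_zero_iff.2 (norm_mobius_lt_one hw (mem_ball_zero_iff.1 hz))
  have hFball : MapsTo F (ball 0 1) (ball 0 1) := fun z hz =>
    mem_ball_zero_iff.2 (hmaps z (mem_ball_zero_iff.1 hz))
  have hzero : (mobius w ∘ F ∘ mobius w) 0 = 0 := by
    simp [mobius, hFw]
  have := Complex.norm_le_norm_of_mapsTo_ball
    (hdiff.comp (hF.comp hdiff hball) (hFball.comp hball))
    ((hball.comp (hFball.comp hball)).mono_right ball_subset_closedBall) hzero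
    (norm_mobius_lt_one hw hz)
  rwa [Function.comp_apply, Function.comp_apply, mobius_mobius hw hz] at this

end Mobius

section BerksonPorta

variable {φ : ℝ≥0 → 𝔻 → 𝔻} {G : 𝔻 → ℂ} {τ σ : ℂ} {p : ℂ → ℂ}

theorem nonneg_of_hasDerivWithinAt_Ici {g : ℝ → ℝ} {g' : ℝ} (h : HasDerivWithinAt g g' (Ici 0) 0)
    (hmin : ∀ t, 0 ≤ t → g 0 ≤ g t) : 0 ≤ g' := by
  have hslope := hasDerivWithinAt_iff_tendsto_slope.1 h
  rw [Ici_sdiff_left] at hslope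
  refine ge_of_tendsto hslope (eventually_nhdsWithin_of_forall fun t ht => ?_)
  rw [slope_def_field]
  exact div_nonneg (sub_nonneg.2 (hmin t (le_of_lt ht))) (sub_nonneg.2 (le_of_lt ht))

theorem IsGenerator.hasDerivWithinAt (hG : IsGenerator φ G) (z : 𝔻) {t : ℝ} (ht : 0 ≤ t) :
    HasDerivWithinAt (fun s : ℝ => (φ s.toNNReal z : ℂ)) (G (φ t.toNNReal z)) (Ici 0) t := by
  have := hG.2 z t.toNNReal
  rwa [Real.coe_toNNReal t ht] at this

theorem coe_apply_toNNReal_zero (hφ : IsSemigroup φ) (z : 𝔻) :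
    (φ (Real.toNNReal 0) z : ℂ) = z := by
  rw [Real.toNNReal_zero, hφ.zero]

theorem IsGenerator.hasDerivWithinAt_zero (hφ : IsSemigroup φ) (hG : IsGenerator φ G) (z : 𝔻) :
    HasDerivWithinAt (fun s : ℝ => (φ s.toNNReal z : ℂ)) (G z) (Ici 0) 0 := by
  have := hG.hasDerivWithinAt z le_rfl
  rwa [Real.toNNReal_zero, hφ.zero] at this

theorem IsGenerator.hasDerivWithinAt_re_cayley (hG : IsGenerator φ G) (hσ : ‖σ‖ = 1) (z : 𝔻)
    {t : ℝ} (ht : 0 ≤ t) :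
    HasDerivWithinAt (fun s : ℝ => ((σ + φ s.toNNReal z) / (σ - φ s.toNNReal z) : ℂ).re)
      (2 * σ * G (φ t.toNNReal z) / (σ - φ t.toNNReal z) ^ 2).re (Ici 0) t := by
  have hx := hG.hasDerivWithinAt z ht
  have hquot := (hx.const_add σ).div (hx.const_sub σ)
    (sub_ne_zero_of_norm_eq_one hσ (φ t.toNNReal z).norm_lt_one)
  refine (Complex.reCLM.hasFDerivAt.comp_hasDerivWithinAt t hquot).congr_deriv
    (congrArg Complex.re ?_)
  ring

theorem mul_conj_of_norm_eq_one (hσ : ‖σ‖ = 1) : σ * conj σ = 1 := by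
  rw [← ofReal_sq_norm, hσ, one_pow, Complex.ofReal_one]

theorem two_mul_mul_berksonPorta_div (hτ : ‖τ‖ = 1) {z : ℂ} (hz : ‖z‖ < 1) :
    2 * τ * berksonPorta τ p z / (τ - z) ^ 2 = 2 * p z := by
  rw [berksonPorta, div_eq_iff (pow_ne_zero 2 (sub_ne_zero_of_norm_eq_one hτ hz))]
  linear_combination (-2 * (τ - z) * z * p z) * mul_conj_of_norm_eq_one hτ

theorem HasDWPoint.apply_eq_of_norm_lt_one (hDW : HasDWPoint φ τ) (hτ : ‖τ‖ < 1) (t : ℝ≥0) :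
    φ t (.mk τ hτ) = .mk τ hτ := by
  by_cases hid : φ t = id
  · rw [hid, id]
  · rcases hDW t hid with ⟨w, rfl, hw⟩ | ⟨-, hfix, -⟩
    · exact hw
    · exact absurd hfix.1 hτ.ne

theorem deriv_mobius_mul_berksonPorta (hτ : ‖τ‖ ≤ 1) {z : ℂ} (hz : ‖z‖ < 1) :
    -(1 - ‖τ‖ ^ 2 : ℝ) / (1 - conj τ * z) ^ 2 * berksonPorta τ p z =
      -((1 - ‖τ‖ ^ 2 : ℝ) * (mobius τ z * p z)) := by
  have := one_sub_conj_mul_ne_zero hτ hz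
  rw [berksonPorta, mobius]
  field_simp

theorem re_nonneg_of_berksonPorta_interior (hφ : IsSemigroup φ) (hG : IsGenerator φ G)
    (hDW : HasDWPoint φ τ) (hτ : ‖τ‖ < 1) {z : 𝔻} (hzτ : (z : ℂ) ≠ τ)
    (hGz : G z = berksonPorta τ p z) : 0 ≤ (p z).re := by
  have hderiv : HasDerivWithinAt (fun t : ℝ => mobius τ (φ t.toNNReal z))
      (-((1 - ‖τ‖ ^ 2 : ℝ) * (mobius τ z * p z))) (Ici 0) 0 := by
    rw [← deriv_mobius_mul_berksonPorta hτ.le z.norm_lt_one, ← hGz]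
    refine HasDerivAt.comp_hasDerivWithinAt_of_eq (0 : ℝ) (hasDerivAt_mobius hτ.le z.norm_lt_one)
      (hG.hasDerivWithinAt_zero hφ z) (coe_apply_toNNReal_zero hφ z).symm
  have hmax := nonneg_of_hasDerivWithinAt_Ici hderiv.norm_sq.neg fun t _ => by
    obtain ⟨F, hF, hFf⟩ := (hφ.hol t.toNNReal).exists_differentiableOn
    simp only [Pi.neg_apply, coe_apply_toNNReal_zero hφ, neg_le_neg_iff, ← hFf z]
    refine pow_le_pow_left₀ (norm_nonneg _) (norm_mobius_le_of_eq hF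
      (fun z => norm_lt_one_of_coe_eq hFf) hτ ?_ z.norm_lt_one) 2
    exact (hFf (.mk τ hτ)).trans (by rw [hDW.apply_eq_of_norm_lt_one hτ]; rfl)
  have hinner : inner ℝ (mobius τ z) (-((1 - ‖τ‖ ^ 2 : ℝ) * (mobius τ z * p z))) =
      -((1 - ‖τ‖ ^ 2) * ‖mobius τ z‖ ^ 2 * (p z).re) := by
    rw [Complex.inner, ← Complex.re_ofReal_mul, ← Complex.neg_re, Complex.ofReal_mul,
      ofReal_sq_norm (mobius τ z)]
    ring_nf
  have hmob : 0 < ‖mobius τ z‖ := norm_pos_iff.2 (div_ne_zero (sub_ne_zero.2 hzτ.symm)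
    (one_sub_conj_mul_ne_zero hτ.le z.norm_lt_one))
  rw [coe_apply_toNNReal_zero hφ, hinner] at hmax
  exact nonneg_of_mul_nonneg_right (by linarith)
    (mul_pos (one_sub_sq_norm_pos hτ) (pow_pos hmob 2))

theorem exists_isHerglotz_eq_berksonPorta_of_norm_lt_one (hφ : IsSemigroup φ)
    (hG : IsGenerator φ G) (hDW : HasDWPoint φ τ) (hτ : ‖τ‖ < 1) :
    ∃ p, IsHerglotz p ∧ ∀ z : 𝔻, G z = berksonPorta τ p z := by
  obtain ⟨F, hF, hFG⟩ := hG.1.exists_differentiableOn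
  have hFτ : F τ = 0 := by
    have hconst := hG.hasDerivWithinAt_zero hφ (.mk τ hτ)
    simp only [hDW.apply_eq_of_norm_lt_one hτ, ← hFG] at hconst
    exact (uniqueDiffOn_Ici (0 : ℝ) 0 self_mem_Ici).eq_deriv _ hconst (hasDerivWithinAt_const ..)
  have hτn : ball (0 : ℂ) 1 ∈ 𝓝 τ := isOpen_ball.mem_nhds (mem_ball_zero_iff.2 hτ)
  let p (z : ℂ) : ℂ := -dslope F τ z / (1 - conj τ * z)
  have hp : DifferentiableOn ℂ p (ball 0 1) :=
    .div ((Complex.differentiableOn_dslope hτn).2 hF).neg (by fun_prop) fun z hz =>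
      one_sub_conj_mul_ne_zero hτ.le (mem_ball_zero_iff.1 hz)
  have hGp (z : 𝔻) : G z = berksonPorta τ p z := by
    have hslope := sub_smul_dslope F τ z
    rw [hFτ, smul_eq_mul, sub_zero, hFG] at hslope
    rw [berksonPorta, mul_assoc, mul_div_cancel₀ _ (one_sub_conj_mul_ne_zero hτ.le z.norm_lt_one),
      ← hslope]
    ring
  refine ⟨p, ⟨hp, fun z hz => ?_⟩, hGp⟩
  rcases eq_or_ne z τ with rfl | hzτ
  · have hcont : ContinuousAt (fun z => (p z).re) z :=
      Complex.continuous_re.continuousAt.comp (hp.continuousOn.continuousAt hτn)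
    refine ge_of_tendsto (hcont.tendsto.mono_left (nhdsWithin_le_nhds (s := {z}ᶜ))) ?_
    filter_upwards [self_mem_nhdsWithin, nhdsWithin_le_nhds hτn] with u huz hu
    exact re_nonneg_of_berksonPorta_interior hφ hG hDW hτ
      (z := .mk u (mem_ball_zero_iff.1 hu)) huz (hGp _)
  · exact re_nonneg_of_berksonPorta_interior hφ hG hDW hτ (z := .mk z hz) hzτ (hGp _)

theorem exists_isHerglotz_eq_berksonPorta_of_norm_eq_one (hφ : IsSemigroup φ)
    (hG : IsGenerator φ G) (hDW : HasDWPoint φ τ) (hτ : ‖τ‖ = 1) :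
    ∃ p, IsHerglotz p ∧ ∀ z : 𝔻, G z = berksonPorta τ p z := by
  obtain ⟨F, hF, hFG⟩ := hG.1.exists_differentiableOn
  let p (z : ℂ) : ℂ := τ * F z / (τ - z) ^ 2
  have hGp (z : 𝔻) : G z = berksonPorta τ p z := by
    have hz := sub_ne_zero_of_norm_eq_one hτ z.norm_lt_one
    rw [← hFG, berksonPorta, mul_div_assoc', eq_div_iff (pow_ne_zero 2 hz)]
    linear_combination ((τ - z) * z * F z) * mul_conj_of_norm_eq_one hτ
  refine ⟨p, ⟨.div (by fun_prop) (by fun_prop) fun z hz =>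
    pow_ne_zero 2 (sub_ne_zero_of_norm_eq_one hτ (mem_ball_zero_iff.1 hz)), fun z hz => ?_⟩, hGp⟩
  have hmin := nonneg_of_hasDerivWithinAt_Ici
    (hG.hasDerivWithinAt_re_cayley hτ (.mk z hz) le_rfl) fun t _ => by
    rw [coe_apply_toNNReal_zero hφ]
    by_cases hid : φ t.toNNReal = id
    · rw [hid, id]
    · rcases hDW _ hid with ⟨w, rfl, -⟩ | ⟨-, -, d, hd1, hd⟩
      · exact absurd hτ w.norm_lt_one.ne
      · exact julia_of_deriv_le_one (hφ.hol _) hτ hd1 hd _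
  rw [Real.toNNReal_zero, hφ.zero, hGp, two_mul_mul_berksonPorta_div hτ (by exact hz)] at hmin
  simpa using hmin

theorem exists_isHerglotz_eq_berksonPorta (hφ : IsSemigroup φ) (hG : IsGenerator φ G)
    (hDW : HasDWPoint φ τ) (hτ : ‖τ‖ ≤ 1) :
    ∃ p, IsHerglotz p ∧ ∀ z : 𝔻, G z = berksonPorta τ p z :=
  hτ.lt_or_eq.elim (exists_isHerglotz_eq_berksonPorta_of_norm_lt_one hφ hG hDW)
    (exists_isHerglotz_eq_berksonPorta_of_norm_eq_one hφ hG hDW)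

end BerksonPorta

section BoundaryFixedPoints

variable {φ : ℝ≥0 → 𝔻 → 𝔻} {G : 𝔻 → ℂ} {τ σ : ℂ} {p : ℂ → ℂ} {l : ℝ}

theorem sub_mul_one_sub_conj_mul (hσ : ‖σ‖ = 1) (τ : ℂ) :
    (τ - σ) * (1 - conj τ * σ) = -(σ * (‖τ - σ‖ ^ 2 : ℝ)) := by
  rw [ofReal_sq_norm, map_sub]
  linear_combination (σ - τ) * mul_conj_of_norm_eq_one hσ

theorem hasSpectralValue_berksonPorta_iff (hτ : ‖τ‖ ≤ 1) (hσ : ‖σ‖ = 1) (hτσ : τ ≠ σ) :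
    HasSpectralValue (fun z => berksonPorta τ p z) σ l ↔
      HasAngularLimit (fun z => p z / (σ - z)) σ (conj σ * (-l / ‖τ - σ‖ ^ 2 : ℝ)) := by
  have hσσ := mul_conj_of_norm_eq_one hσ
  have hfactor : HasAngularLimit (fun z => (τ - z) * (1 - conj τ * z)) σ
      (-(σ * (‖τ - σ‖ ^ 2 : ℝ))) := by
    rw [← sub_mul_one_sub_conj_mul hσ]
    exact hasAngularLimit_of_continuousAt (F := fun z => (τ - z) * (1 - conj τ * z)) (by fun_prop)
  have hN : (‖τ - σ‖ : ℂ) ≠ 0 := Complex.ofReal_ne_zero.2 (norm_ne_zero_iff.2 (sub_ne_zero.2 hτσ))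
  have hfactor0 : -(σ * ((‖τ - σ‖ ^ 2 : ℝ) : ℂ)) ≠ 0 :=
    neg_ne_zero.2 (mul_ne_zero (ne_zero_of_norm_eq_one hσ) (by exact_mod_cast pow_ne_zero 2 hN))
  refine ⟨fun h M hM => ?_, fun h => ?_⟩
  · have hlim : (l : ℂ) / -(σ * (‖τ - σ‖ ^ 2 : ℝ)) = conj σ * (-l / ‖τ - σ‖ ^ 2 : ℝ) := by
      rw [div_eq_iff hfactor0]
      push_cast
      field_simp
      linear_combination (-l : ℂ) * hσσ
    rw [← hlim]
    refine (h.div hfactor hfactor0 M hM).congr' ?_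
    filter_upwards [tendsto_coe_angularFilter.eventually (isOpen_ne.mem_nhds hτσ.symm)] with z hz
    have hz0 : (τ - z) * (1 - conj τ * z) ≠ 0 :=
      mul_ne_zero (sub_ne_zero.2 hz.symm) (one_sub_conj_mul_ne_zero hτ z.norm_lt_one)
    rw [berksonPorta, mul_div_assoc, mul_div_cancel_left₀ _ hz0]
  · refine ((hfactor.mul h).congr fun z => ?_).congr_lim ?_
    · exact (mul_div_assoc _ _ _).symm
    · push_cast
      field_simp
      linear_combination (l : ℂ) * hσσ

theorem hasAngularLimit_sub_mul_inv (hτ : ‖τ‖ ≤ 1) (hσ : ‖σ‖ = 1) (hτσ : τ ≠ σ) (hl : l < 0)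
    (h : HasSpectralValue (fun z => berksonPorta τ p z) σ l) :
    HasAngularLimit (fun z => (σ - z) * (p z)⁻¹) σ (2 * σ * (‖τ - σ‖ ^ 2 / (2 * |l|) : ℝ)) := by
  rw [hasSpectralValue_berksonPorta_iff hτ hσ hτσ] at h
  have hσσ := mul_conj_of_norm_eq_one hσ
  have hσ0 : conj σ ≠ 0 := right_ne_zero_of_mul_eq_one hσσ
  have hl0 : (l : ℂ) ≠ 0 := Complex.ofReal_ne_zero.2 hl.ne
  have hN : (‖τ - σ‖ : ℂ) ≠ 0 := Complex.ofReal_ne_zero.2 (norm_ne_zero_iff.2 (sub_ne_zero.2 hτσ))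
  have hne : conj σ * ((-l / ‖τ - σ‖ ^ 2 : ℝ) : ℂ) ≠ 0 := by
    push_cast
    exact mul_ne_zero hσ0 (div_ne_zero (neg_ne_zero.2 hl0) (pow_ne_zero 2 hN))
  refine (((hasAngularLimit_const 1).div h hne).congr fun z => ?_).congr_lim ?_
  · rw [one_div_div, div_eq_mul_inv]
  · rw [abs_of_neg hl]
    push_cast
    field_simp
    linear_combination hσσ

theorem IsHerglotz.re_pos_or_exists_eq (hp : IsHerglotz p) :
    (∀ z, ‖z‖ < 1 → 0 < (p z).re) ∨ ∃ b : ℝ, ∀ z, ‖z‖ < 1 → p z = Complex.I * b := by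
  obtain ⟨μ, _, b, hμ⟩ := hp.exists_eq_herglotz
  by_cases hμ0 : μ = 0
  · exact Or.inr ⟨b, fun z hz => by rw [hμ z hz, hμ0, herglotz, integral_zero_measure, add_zero]⟩
  · refine Or.inl fun z hz => ?_
    rw [hμ z hz, Complex.add_re, Complex.I_mul_re, Complex.ofReal_im, neg_zero, zero_add,
      re_herglotz hz]
    have hsupp : Function.support (fun ζ : 𝕊 => (1 - ‖z‖ ^ 2) / ‖(ζ : ℂ) - z‖ ^ 2) = univ :=
      eq_univ_of_forall fun ζ => (div_pos (one_sub_sq_norm_pos hz) (pow_pos (norm_pos_iff.2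
        (sub_ne_zero_of_norm_eq_one (norm_coe_sphere ζ) hz)) 2)).ne'
    rw [integral_pos_iff_support_of_nonneg (fun ζ : 𝕊 => poisson_kernel_nonneg hz ζ)
      (integrable_of_continuous_sphere (continuous_poisson_kernel hz)), hsupp]
    exact Measure.measure_univ_pos.2 hμ0

theorem IsHerglotz.re_pos_of_hasAngularLimit_div (hp : IsHerglotz p) (hσ : ‖σ‖ = 1) {c : ℂ}
    (hc : c ≠ 0) (h : HasAngularLimit (fun z => p z / (σ - z)) σ c) :
    ∀ z, ‖z‖ < 1 → 0 < (p z).re := by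
  refine hp.re_pos_or_exists_eq.resolve_right fun ⟨b, hb⟩ => hc ?_
  have hb0 : Complex.I * b = 0 := by
    refine (hasAngularLimit_const _).unique hσ
      ((((hasAngularLimit_sub_self σ).mul h).congr fun z => ?_).congr_lim (zero_mul c))
    rw [mul_div_cancel₀ _ (sub_ne_zero_of_norm_eq_one hσ z.norm_lt_one), hb z z.norm_lt_one]
  refine h.unique hσ ((hasAngularLimit_const 0).congr fun z => ?_)
  rw [hb z z.norm_lt_one, hb0, zero_div]

theorem IsHerglotz.inv (hp : IsHerglotz p) (hre : ∀ z, ‖z‖ < 1 → 0 < (p z).re) :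
    IsHerglotz fun z => (p z)⁻¹ where
  differentiableOn := hp.differentiableOn.inv fun z hz h =>
    (hre z (mem_ball_zero_iff.1 hz)).ne' (by rw [h, Complex.zero_re])
  re_nonneg z hz := by
    rw [Complex.inv_re]
    exact div_nonneg (hre z hz).le (Complex.normSq_nonneg _)

theorem re_sq_mul_le {w p : ℂ} {α : ℝ} (hα : 0 < α) (hw : 0 ≤ w.re)
    (hp : α * w.re * ‖p‖ ^ 2 ≤ p.re) : (w ^ 2 * p).re ≤ w.re / α := by
  have hsq : w ^ 2 * p = (2 * w.re : ℝ) * (w * p) - (‖w‖ ^ 2 : ℝ) * p := by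
    rw [ofReal_sq_norm, ← Complex.add_conj]
    ring
  have hwp : (w * p).re ≤ ‖w‖ * ‖p‖ := (Complex.re_le_norm _).trans_eq (norm_mul w p)
  rw [hsq, Complex.sub_re, Complex.re_ofReal_mul, Complex.re_ofReal_mul, le_div_iff₀ hα]
  nlinarith [mul_le_mul_of_nonneg_left hwp (mul_nonneg hα.le hw),
    mul_le_mul_of_nonneg_left hp (mul_nonneg hα.le (sq_nonneg ‖w‖)),
    mul_nonneg hw (sq_nonneg (α * (‖w‖ * ‖p‖) - 1))]

theorem re_sub_mul_add_conj_mul_ge {ω w p : ℂ} {α : ℝ} (hα : 0 < α) (hw : 0 ≤ w.re)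
    (hp : α * w.re * ‖p‖ ^ 2 ≤ p.re) : -(w.re / α) ≤ ((ω - w) * (w + conj ω) * p).re := by
  have hshift : (w - ω.im * Complex.I).re = w.re := by simp
  have heq : (ω - w) * (w + conj ω) * p =
      (ω.re ^ 2 : ℝ) * p - (w - ω.im * Complex.I) ^ 2 * p := by
    have hω := Complex.re_add_im ω
    have hconj : conj ω = ω.re - ω.im * Complex.I := Complex.ext (by simp) (by simp)
    rw [hconj]
    nth_rw 1 [← hω]
    push_cast
    ring
  have hp0 : 0 ≤ p.re := le_trans (by positivity) hp
  have := re_sq_mul_le (w := w - ω.im * Complex.I) (p := p) hα (hshift ▸ hw) (by rwa [hshift])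
  rw [heq, Complex.sub_re, Complex.re_ofReal_mul]
  rw [hshift] at this
  nlinarith [mul_nonneg (sq_nonneg ω.re) hp0]

theorem two_mul_mul_berksonPorta_div_eq (hσ : ‖σ‖ = 1) (hτσ : τ ≠ σ) {z : ℂ} (hz : ‖z‖ < 1) :
    2 * σ * berksonPorta τ p z / (σ - z) ^ 2 = (‖τ - σ‖ ^ 2 / 2 : ℝ) *
      (((σ + τ) / (σ - τ) - (σ + z) / (σ - z)) *
        ((σ + z) / (σ - z) + conj ((σ + τ) / (σ - τ))) * p z) := by
  have hσz := sub_ne_zero_of_norm_eq_one hσ hz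
  have hσσ := mul_conj_of_norm_eq_one hσ
  have hστ : σ - τ ≠ 0 := sub_ne_zero.2 hτσ.symm
  have hcτ : conj σ - conj τ ≠ 0 := by rw [← map_sub]; exact (map_ne_zero _).2 hστ
  have hsub : (σ + τ) / (σ - τ) - (σ + z) / (σ - z) = 2 * σ * (τ - z) / ((σ - τ) * (σ - z)) := by
    field_simp
    ring
  have hadd : (σ + z) / (σ - z) + conj ((σ + τ) / (σ - τ)) =
      2 * (1 - conj τ * z) / ((σ - z) * (conj σ - conj τ)) := by
    rw [map_div₀, map_add, map_sub, div_add_div _ _ hσz hcτ]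
    congr 1
    linear_combination 2 * hσσ
  rw [hsub, hadd, Complex.ofReal_div, norm_sub_rev, ofReal_sq_norm, map_sub, berksonPorta]
  push_cast
  field_simp

theorem IsGenerator.exp_mul_re_cayley_le (hφ : IsSemigroup φ) (hG : IsGenerator φ G)
    (hσ : ‖σ‖ = 1) {c : ℝ}
    (hc : ∀ z : 𝔻, -c * ((σ + z) / (σ - z) : ℂ).re ≤ (2 * σ * G z / (σ - z) ^ 2).re)
    (t : ℝ≥0) (z : 𝔻) :
    Real.exp (-(c * t)) * ((σ + z) / (σ - z) : ℂ).re ≤ ((σ + φ t z) / (σ - φ t z) : ℂ).re := by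
  have hd : ∀ s ∈ Ici (0 : ℝ), HasDerivWithinAt
      (fun s : ℝ => ((σ + φ s.toNNReal z) / (σ - φ s.toNNReal z) : ℂ).re * Real.exp (c * s)) _
      (Ici 0) s := fun s hs =>
    (hG.hasDerivWithinAt_re_cayley hσ z hs).mul
      (((hasDerivAt_id s).const_mul c).exp.hasDerivWithinAt)
  have hmono := monotoneOn_of_hasDerivWithinAt_nonneg (convex_Ici 0)
    (fun s hs => (hd s hs).continuousWithinAt)
    (fun s hs => (hd s (interior_subset hs)).mono interior_subset) fun s _ => by
      have hpos := Real.exp_pos (c * s)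
      simp only [id, mul_one]
      nlinarith [hc (φ s.toNNReal z)]
  have h := hmono self_mem_Ici (mem_Ici.2 t.2) t.2
  simp only [Real.toNNReal_zero, hφ.zero, mul_zero, Real.exp_zero, mul_one] at h
  rw [Real.exp_neg, mul_comm, ← div_eq_mul_inv, div_le_iff₀ (Real.exp_pos _)]
  simpa using h

theorem isSemigroupBRFP_of_mass_pos (hp : IsHerglotz p) (hre : ∀ z, ‖z‖ < 1 → 0 < (p z).re)
    (hφ : IsSemigroup φ) (hG : IsGenerator φ fun z => berksonPorta τ p z) (hσ : ‖σ‖ = 1)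
    (hτσ : τ ≠ σ) {α : ℝ} (hα : 0 < α)
    (hmass : HasAngularLimit (fun z => (σ - z) * (p z)⁻¹) σ (2 * σ * α)) :
    IsSemigroupBRFP φ σ := by
  obtain ⟨β, -, hβ, hlim⟩ := (hp.inv hre).exists_mass (ι := Unit) (fun _ => hσ) fun _ _ _ => rfl
  obtain rfl : β () = α := by
    have := (hlim ()).unique hσ hmass
    exact_mod_cast mul_left_cancel₀ (mul_ne_zero two_ne_zero (ne_zero_of_norm_eq_one hσ)) this
  have hfield (z : 𝔻) : -(‖τ - σ‖ ^ 2 / (2 * β ())) * ((σ + z) / (σ - z) : ℂ).re ≤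
      (2 * σ * berksonPorta τ p z / (σ - z) ^ 2).re := by
    have hinv := hβ.re_nonneg z z.norm_lt_one
    simp only [Finset.univ_unique, Finset.sum_singleton, Complex.sub_re, Complex.re_ofReal_mul,
      PUnit.default_eq_unit, Complex.inv_re, sub_nonneg, Complex.normSq_eq_norm_sq] at hinv
    have hpz := hre z z.norm_lt_one
    have hnorm : 0 < ‖p z‖ ^ 2 := pow_pos (hpz.trans_le (Complex.re_le_norm _)) 2
    have hge := re_sub_mul_add_conj_mul_ge (ω := (σ + τ) / (σ - τ)) hα
      (re_add_div_sub_pos hσ z.norm_lt_one).le ((le_div_iff₀ hnorm).1 hinv)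
    rw [two_mul_mul_berksonPorta_div_eq hσ hτσ z.norm_lt_one, Complex.re_ofReal_mul]
    calc _ = ‖τ - σ‖ ^ 2 / 2 * -(((σ + z) / (σ - z) : ℂ).re / β ()) := by field_simp
      _ ≤ _ := by gcongr
  intro t
  obtain ⟨hfix, d, -, hd⟩ := isBoundaryFixedPoint_of_julia (hφ.hol t) hσ (Real.exp_pos _)
    (hG.exp_mul_re_cayley_le hφ hσ hfield t)
  exact ⟨hfix, d, hd⟩

end BoundaryFixedPoints

section GenClass

variable {φ : ℝ≥0 → 𝔻 → 𝔻} {τ : ℂ} {p : ℂ → ℂ} {n : ℕ} {σ : Fin n → ℂ}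

theorem hasDWPoint_of_isGenerator_berksonPorta (hp : DifferentiableOn ℂ p (ball 0 1))
    (hre : ∀ z, ‖z‖ < 1 → 0 < (p z).re) (hτ : ‖τ‖ ≤ 1) (hφ : IsSemigroup φ)
    (hG : IsGenerator φ fun z => berksonPorta τ p z) : HasDWPoint φ τ := by
  intro t ht
  rcases hτ.lt_or_eq with hτ1 | hτ1
  · have hconst : IsTraj (berksonPorta τ p) t fun _ => τ := fun s _ =>
      ⟨hτ1, by simpa [berksonPorta] using hasDerivWithinAt_const s (Icc 0 (t : ℝ)) τ⟩
    have horbit : IsTraj (berksonPorta τ p) t fun s => (φ s.toNNReal (.mk τ hτ1) : ℂ) :=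
      fun s hs => ⟨(φ _ _).norm_lt_one, (hG.hasDerivWithinAt _ hs.1).mono Icc_subset_Ici_self⟩
    have heq := horbit.eqOn (.mul (by fun_prop) hp) hconst (coe_apply_toNNReal_zero hφ _)
      (right_mem_Icc.2 t.coe_nonneg)
    exact Or.inl ⟨.mk τ hτ1, rfl, Complex.UnitDisc.coe_injective (by simpa using heq)⟩
  · have hfield (z : 𝔻) : (2 * τ * berksonPorta τ p z / (τ - z) ^ 2).re = 2 * (p z).re := by
      rw [two_mul_mul_berksonPorta_div hτ1 z.norm_lt_one, Complex.mul_re, Complex.re_ofNat,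
        Complex.im_ofNat, zero_mul, sub_zero]
    obtain ⟨hfix, d, hd, hderiv⟩ := isBoundaryFixedPoint_of_julia (hφ.hol t) hτ1
      (Real.exp_pos _) (hG.exp_mul_re_cayley_le hφ hτ1 (c := 0) (fun z => by
        rw [hfield, neg_zero, zero_mul]
        linarith [hre z z.norm_lt_one]) t)
    refine Or.inr ⟨fun w hw => ?_, hfix, d, by simpa using hd, hderiv⟩
    have ht0 : (0 : ℝ) < t := NNReal.coe_pos.2 <| pos_iff_ne_zero.2 fun h =>
      ht (funext fun z => by rw [h, hφ.zero, id])
    have hmono := strictMonoOn_of_hasDerivWithinAt_pos (convex_Ici 0)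
      (fun s hs => (hG.hasDerivWithinAt_re_cayley hτ1 w hs).continuousWithinAt)
      (fun s hs => (hG.hasDerivWithinAt_re_cayley hτ1 w (interior_subset hs)).mono
        interior_subset) fun s _ => by
          rw [hfield]
          exact mul_pos two_pos (hre _ (φ _ w).norm_lt_one)
    have hlt := hmono self_mem_Ici (mem_Ici.2 t.coe_nonneg) ht0
    simp only [Real.toNNReal_zero, hφ.zero, Real.toNNReal_coe, hw, lt_self_iff_false] at hlt

theorem berksonPorta_mem_genClass (hσ : ∀ k, ‖σ k‖ = 1) (hτ : ‖τ‖ ≤ 1) (hτσ : ∀ k, τ ≠ σ k)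
    (hp : IsHerglotz p) (hre : ∀ z, ‖z‖ < 1 → 0 < (p z).re) {l : Fin n → ℝ}
    (hl : ∀ k, l k < 0 ∧ HasSpectralValue (fun z => berksonPorta τ p z) (σ k) (l k))
    (hsum : ∑ k, |l k| ≤ 1) :
    (fun z : 𝔻 => berksonPorta τ p z) ∈ GenClass τ σ := by
  obtain ⟨φ, hφ, hG⟩ := (hp.isContracting_berksonPorta τ).exists_isSemigroup
  refine Or.inr ⟨φ, hφ, hG, hasDWPoint_of_isGenerator_berksonPorta hp.differentiableOn hre hτ hφ hG,
    fun k => isSemigroupBRFP_of_mass_pos hp hre hφ hG (hσ k) (hτσ k) ?_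
      (hasAngularLimit_sub_mul_inv hτ (hσ k) (hτσ k) (hl k).1 (hl k).2), l, hl, hsum⟩
  have := norm_pos_iff.2 (sub_ne_zero.2 (hτσ k))
  have := abs_pos.2 (hl k).1.ne
  positivity

theorem exists_isHerglotz_of_mem_genClass {G : 𝔻 → ℂ} (hG : G ∈ GenClass τ σ) (hG0 : G ≠ 0)
    (hτ : ‖τ‖ ≤ 1) :
    ∃ p, IsHerglotz p ∧ G = (fun z : 𝔻 => berksonPorta τ p z) ∧ ∃ l : Fin n → ℝ,
      (∀ k, l k < 0 ∧ HasSpectralValue G (σ k) (l k)) ∧ ∑ k, |l k| ≤ 1 := by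
  obtain ⟨φ, hφ, hGφ, hDW, -, hl⟩ := hG.resolve_left hG0
  obtain ⟨p, hp, hGp⟩ := exists_isHerglotz_eq_berksonPorta hφ hGφ hDW hτ
  exact ⟨p, hp, funext hGp, hl⟩

theorem smul_mem_genClass {G : 𝔻 → ℂ} {l : Fin n → ℝ} (hG : G ∈ GenClass τ σ)
    (hl : ∀ k, l k < 0 ∧ HasSpectralValue G (σ k) (l k)) {c : ℝ} (hc : 0 < c)
    (hsum : ∑ k, |c * l k| ≤ 1) : (fun z => (c : ℂ) * G z) ∈ GenClass τ σ := by
  rcases hG with rfl | ⟨φ, hφ, hGφ, hDW, hB, -⟩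
  · exact Or.inl (funext fun _ => mul_zero _)
  lift c to ℝ≥0 using hc.le
  rw [NNReal.coe_pos] at hc
  refine Or.inr ⟨fun t => φ (c * t), ⟨fun t => hφ.hol _, fun z => ?_, fun s t z => ?_, fun z => ?_⟩,
    ⟨?_, fun z t => ?_⟩, fun t => hDW _, fun k t => hB k _, fun k => c * l k,
    fun k => ⟨mul_neg_of_pos_of_neg hc (hl k).1, ?_⟩, hsum⟩
  · rw [mul_zero, hφ.zero]
  · rw [mul_add, hφ.add]
  · refine (hφ.tendsto z).comp (tendsto_nhdsWithin_iff.2 ⟨?_, ?_⟩)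
    · exact ((continuous_const_mul c).tendsto' 0 0 (mul_zero c)).mono_left nhdsWithin_le_nhds
    · exact eventually_nhdsWithin_of_forall fun t ht => mul_pos hc ht
  · obtain ⟨F, hF, hFG⟩ := hGφ.1.exists_differentiableOn
    simp only [← hFG]
    exact isHol_coe_of_differentiableOn (hF.const_mul _)
  · have hscale : HasDerivWithinAt (fun s : ℝ => c * s) c (Ici 0) t := by
      simpa using (hasDerivWithinAt_id (t : ℝ) (Ici 0)).const_mul (c : ℝ)
    have hcomp := (hGφ.2 z (c * t)).scomp_of_eq (t : ℝ) hscale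
      (fun s hs => mul_nonneg c.2 hs) (NNReal.coe_mul c t)
    refine (hcomp.congr_deriv (Complex.real_smul ..)).congr (fun _ _ => ?_) ?_
    all_goals simp [Real.toNNReal_mul]
  · refine ((hasAngularLimit_const ((c : ℝ) : ℂ)).mul (hl k).2).congr (fun z => ?_) |>.congr_lim ?_
    · exact (mul_div_assoc _ _ _).symm
    · exact (Complex.ofReal_mul _ _).symm

end GenClass

section Sufficiency

theorem add_smul_sq_norm_eq_of_barycenter {E : Type*} [NormedAddCommGroup E]
    [InnerProductSpace ℝ E] {u v : ℝ} {x y m : E} (hm : u • x + v • y = (u + v) • m) :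
    u * ‖x‖ ^ 2 + v * ‖y‖ ^ 2 =
      (u + v) * ‖m‖ ^ 2 + (u * ‖x - m‖ ^ 2 + v * ‖y - m‖ ^ 2) := by
  have hinner : u * inner ℝ x m + v * inner ℝ y m = (u + v) * ‖m‖ ^ 2 := by
    rw [← real_inner_smul_left, ← real_inner_smul_left, ← inner_add_left, hm,
      real_inner_smul_left, real_inner_self_eq_norm_sq]
  rw [norm_sub_sq_real, norm_sub_sq_real]
  linear_combination 2 * hinner

theorem smul_eq_smul_of_sum_mul_sq_norm_le {ι E : Type*} [Fintype ι] [NormedAddCommGroup E]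
    [InnerProductSpace ℝ E] {w u v : ι → ℝ} {x y m : ι → E} (hw : ∀ k, 0 < w k)
    (hu : ∀ k, 0 ≤ u k) (hv : ∀ k, 0 ≤ v k)
    (hm : ∀ k, u k • x k + v k • y k = (u k + v k) • m k)
    (hle : ∑ k, w k * (u k * ‖x k‖ ^ 2 + v k * ‖y k‖ ^ 2) ≤
      ∑ k, w k * ((u k + v k) * ‖m k‖ ^ 2)) (k : ι) : u k • x k = u k • m k := by
  have hnonneg (j : ι) : 0 ≤ w j * (u j * ‖x j - m j‖ ^ 2 + v j * ‖y j - m j‖ ^ 2) :=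
    mul_nonneg (hw j).le (add_nonneg (mul_nonneg (hu j) (sq_nonneg _))
      (mul_nonneg (hv j) (sq_nonneg _)))
  have hzero : ∑ j, w j * (u j * ‖x j - m j‖ ^ 2 + v j * ‖y j - m j‖ ^ 2) = 0 := by
    refine le_antisymm ?_ (Finset.sum_nonneg fun j _ => hnonneg j)
    simpa only [add_smul_sq_norm_eq_of_barycenter (hm _), mul_add, Finset.sum_add_distrib,
      add_le_iff_nonpos_right] using hle
  have hk := (Finset.sum_eq_zero_iff_of_nonneg fun j _ => hnonneg j).1 hzero k (Finset.mem_univ k)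
  have hsum := (mul_eq_zero.1 hk).resolve_left (hw k).ne'
  have hux := (add_eq_zero_iff_of_nonneg (mul_nonneg (hu k) (sq_nonneg _))
    (mul_nonneg (hv k) (sq_nonneg _))).1 hsum |>.1
  rw [← sub_eq_zero, ← smul_sub, smul_eq_zero]
  simpa [sub_eq_zero] using hux

theorem eq_of_sum_mul_sq_norm_le {ι E : Type*} [Fintype ι] [NormedAddCommGroup E]
    [InnerProductSpace ℝ E] {w a a₁ a₂ : ι → ℝ} {s t r₁ r₂ : ℝ} {x₁ x₂ : E} {q₁ q₂ : ι → E}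
    (hw : ∀ k, 0 < w k) (ha : ∀ k, 0 < a k) (ha₁ : ∀ k, 0 ≤ a₁ k) (ha₂ : ∀ k, 0 ≤ a₂ k)
    (hs : 0 < s) (ht : 0 < t) (hst : s + t = 1) (hcomb : ∀ k, s * a₁ k + t * a₂ k = a k)
    (hsum : ∑ k, a k = 1) (hsum₁ : ∑ k, a₁ k ≤ 1) (hsum₂ : ∑ k, a₂ k ≤ 1)
    (hq₁ : ∀ k, a₁ k • q₁ k = x₁) (hq₂ : ∀ k, a₂ k • q₂ k = x₂)
    (hr₁ : ∑ k, w k * (a₁ k * ‖q₁ k‖ ^ 2) ≤ r₁) (hr₂ : ∑ k, w k * (a₂ k * ‖q₂ k‖ ^ 2) ≤ r₂)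
    (hr : s * r₁ + t * r₂ ≤ ∑ k, w k / a k * ‖s • x₁ + t • x₂‖ ^ 2) :
    x₁ = s • x₁ + t • x₂ := by
  set x := s • x₁ + t • x₂
  have hprop (k : ι) : a k • x₁ = a₁ k • x := by
    have h := smul_eq_smul_of_sum_mul_sq_norm_le (w := w) (u := fun k => s * a₁ k)
      (v := fun k => t * a₂ k) (x := q₁) (y := q₂) (m := fun k => (a k)⁻¹ • x) hw
      (fun k => mul_nonneg hs.le (ha₁ k)) (fun k => mul_nonneg ht.le (ha₂ k)) (fun k => ?_) ?_ k
    · rw [mul_smul, mul_smul, hq₁] at h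
      rw [smul_right_injective E hs.ne' h, smul_comm, smul_inv_smul₀ (ha k).ne']
    · rw [mul_smul, mul_smul, hq₁, hq₂, hcomb, smul_inv_smul₀ (ha k).ne']
    · calc ∑ k, w k * (s * a₁ k * ‖q₁ k‖ ^ 2 + t * a₂ k * ‖q₂ k‖ ^ 2)
          = s * ∑ k, w k * (a₁ k * ‖q₁ k‖ ^ 2) + t * ∑ k, w k * (a₂ k * ‖q₂ k‖ ^ 2) := by
            rw [Finset.mul_sum, Finset.mul_sum, ← Finset.sum_add_distrib]
            exact Finset.sum_congr rfl fun k _ => by ring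
        _ ≤ s * r₁ + t * r₂ := by gcongr
        _ ≤ _ := hr
        _ = ∑ k, w k * ((s * a₁ k + t * a₂ k) * ‖(a k)⁻¹ • x‖ ^ 2) := by
            refine Finset.sum_congr rfl fun k _ => ?_
            have := (ha k).ne'
            rw [hcomb, norm_smul, norm_inv, Real.norm_of_nonneg (ha k).le]
            field_simp
  have hone : ∑ k, a₁ k = 1 := by
    have htotal : s * ∑ k, a₁ k + t * ∑ k, a₂ k = 1 := by
      simp only [← hsum, ← hcomb, Finset.sum_add_distrib, Finset.mul_sum]
    nlinarith
  calc x₁ = (∑ k, a k) • x₁ := by rw [hsum, one_smul]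
    _ = (∑ k, a₁ k) • x := by simp only [Finset.sum_smul, hprop]
    _ = x := by rw [hone, one_smul]

variable {τ : ℂ} {p : ℂ → ℂ} {n : ℕ} {σ : Fin n → ℂ} {l : Fin n → ℝ}

theorem re_p0 (z : ℂ) :
    (p0 τ σ l z).re = ∑ k, ‖τ - σ k‖ ^ 2 / (2 * |l k|) * ((σ k + z) / (σ k - z)).re := by
  simp only [p0, Complex.re_sum, Complex.re_ofReal_mul]

theorem IsHerglotz.re_pos_of_hasSpectralValue (hp : IsHerglotz p) (hτ : ‖τ‖ ≤ 1)
    {σ : ℂ} (hσ : ‖σ‖ = 1) (hτσ : τ ≠ σ) {l : ℝ} (hl : l ≠ 0)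
    (h : HasSpectralValue (fun z => berksonPorta τ p z) σ l) :
    ∀ z, ‖z‖ < 1 → 0 < (p z).re := by
  have hN := norm_ne_zero_iff.2 (sub_ne_zero.2 hτσ)
  have hσ0 : conj σ ≠ 0 := right_ne_zero_of_mul_eq_one (mul_conj_of_norm_eq_one hσ)
  refine hp.re_pos_of_hasAngularLimit_div hσ (mul_ne_zero hσ0 (Complex.ofReal_ne_zero.2 ?_))
    ((hasSpectralValue_berksonPorta_iff hτ hσ hτσ).1 h)
  exact div_ne_zero (neg_ne_zero.2 hl) (pow_ne_zero 2 hN)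

theorem IsHerglotz.re_p0_mul_sq_norm_le (hp : IsHerglotz p) (hτ : ‖τ‖ ≤ 1) (hσ : ∀ k, ‖σ k‖ = 1)
    (hinj : Function.Injective σ) (hτσ : ∀ k, τ ≠ σ k)
    (hl : ∀ k, l k < 0 ∧ HasSpectralValue (fun z => berksonPorta τ p z) (σ k) (l k)) {z : ℂ}
    (hz : ‖z‖ < 1) : (p0 τ σ l z).re * ‖p z‖ ^ 2 ≤ (p z).re := by
  rcases eq_zero_or_neZero n with rfl | hn
  · simpa [p0] using hp.re_nonneg z hz
  have hre := hp.re_pos_of_hasSpectralValue hτ (hσ 0) (hτσ 0) (hl 0).1.ne (hl 0).2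
  obtain ⟨β, -, hrest, hβ⟩ := (hp.inv hre).exists_mass hσ hinj
  have hβl (k : Fin n) : β k = ‖τ - σ k‖ ^ 2 / (2 * |l k|) := by
    have := (hβ k).unique (hσ k)
      (hasAngularLimit_sub_mul_inv hτ (hσ k) (hτσ k) (hl k).1 (hl k).2)
    exact Complex.ofReal_injective
      (mul_left_cancel₀ (mul_ne_zero two_ne_zero (ne_zero_of_norm_eq_one (hσ k))) this)
  have hnonneg := hrest.re_nonneg z hz
  simp only [hβl] at hnonneg
  rw [Complex.sub_re, Complex.inv_re, Complex.normSq_eq_norm_sq, sub_nonneg] at hnonneg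
  have hpz : 0 < ‖p z‖ ^ 2 :=
    pow_pos ((hre z hz).trans_le ((le_abs_self _).trans (Complex.abs_re_le_norm _))) 2
  exact (le_div_iff₀ hpz).1 hnonneg

/-- `q k` is `p z / |l k|`; the form without division also covers the zero generator,
with `l = 0`. -/
theorem exists_forall_le_re_of_mem_genClass (hτ : ‖τ‖ ≤ 1) (hσ : ∀ k, ‖σ k‖ = 1)
    (hinj : Function.Injective σ) (hτσ : ∀ k, τ ≠ σ k) {G : 𝔻 → ℂ} (hG : G ∈ GenClass τ σ) :
    ∃ (p : ℂ → ℂ) (l : Fin n → ℝ), G = (fun z : 𝔻 => berksonPorta τ p z) ∧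
      (∀ k, l k ≤ 0 ∧ HasSpectralValue G (σ k) (l k)) ∧ ∑ k, |l k| ≤ 1 ∧
      ∀ z, ‖z‖ < 1 → ∃ q : Fin n → ℂ, (∀ k, |l k| • q k = p z) ∧
        ∑ k, ‖τ - σ k‖ ^ 2 / 2 * ((σ k + z) / (σ k - z)).re * (|l k| * ‖q k‖ ^ 2) ≤ (p z).re := by
  rcases eq_or_ne G 0 with rfl | hG0
  · refine ⟨0, 0, ?_, fun k => ⟨le_rfl, ?_⟩, by simp, fun z _ => ⟨0, by simp⟩⟩
    · simp [berksonPorta, funext_iff]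
    · exact (hasAngularLimit_const 0).congr (fun z => by simp) |>.congr_lim (by simp)
  · obtain ⟨p, hp, rfl, l, hl, hsum⟩ := exists_isHerglotz_of_mem_genClass hG hG0 hτ
    refine ⟨p, l, rfl, fun k => ⟨(hl k).1.le, (hl k).2⟩, hsum, fun z hz =>
      ⟨fun k => |l k|⁻¹ • p z, fun k => smul_inv_smul₀ (abs_ne_zero.2 (hl k).1.ne) _, ?_⟩⟩
    refine le_of_eq_of_le ?_ (hp.re_p0_mul_sq_norm_le hτ hσ hinj hτσ hl hz)
    rw [re_p0, Finset.sum_mul]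
    refine Finset.sum_congr rfl fun k _ => ?_
    have := abs_ne_zero.2 (hl k).1.ne
    rw [norm_smul, norm_inv, Real.norm_eq_abs, abs_abs]
    field_simp

theorem hasAngularLimit_sub_mul_sum_cayley {ι : Type*} [Fintype ι] {σ : ι → ℂ}
    (hσ : ∀ k, ‖σ k‖ = 1) (hinj : Function.Injective σ) (α : ι → ℂ) (k : ι) :
    HasAngularLimit (fun z => (σ k - z) * ∑ j, α j * ((σ j + z) / (σ j - z))) (σ k)
      (2 * σ k * α k) := by
  classical
  have hterm (j : ι) : HasAngularLimit (fun z => (σ k - z) * (α j * ((σ j + z) / (σ j - z)))) (σ k)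
      (if j = k then 2 * σ k * α k else 0) := by
    split_ifs with hjk
    · subst hjk
      refine ((hasAngularLimit_of_continuousAt (F := fun z => α j * (σ j + z))
        (by fun_prop)).congr fun z => ?_).congr_lim (by ring)
      have := sub_ne_zero_of_norm_eq_one (hσ j) z.norm_lt_one
      field_simp
    · have hne : σ j - σ k ≠ 0 := sub_ne_zero.2 (hinj.ne hjk)
      exact (hasAngularLimit_of_continuousAt
        (F := fun z => (σ k - z) * (α j * ((σ j + z) / (σ j - z))))
        (by fun_prop (disch := exact hne))).congr_lim (by rw [sub_self, zero_mul])
  refine ((HasAngularLimit.sum Finset.univ fun j _ => hterm j).congr fun z =>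
    (Finset.mul_sum ..).symm).congr_lim ?_
  rw [Finset.sum_ite_eq' _ _ fun _ => _, if_pos (Finset.mem_univ k)]

theorem isHerglotz_add_p0 (hσ : ∀ k, ‖σ k‖ = 1) (b : ℝ) :
    IsHerglotz fun z => Complex.I * b + p0 τ σ l z where
  differentiableOn := by
    refine .const_add _ (.fun_sum fun k _ => .const_mul (.div (by fun_prop) (by fun_prop) ?_) _)
    exact fun z hz => sub_ne_zero_of_norm_eq_one (hσ k) (mem_ball_zero_iff.1 hz)
  re_nonneg z hz := by
    rw [Complex.add_re, Complex.I_mul_re, Complex.ofReal_im, neg_zero, zero_add, re_p0]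
    exact Finset.sum_nonneg fun k _ => mul_nonneg (by positivity) (re_add_div_sub_pos (hσ k) hz).le

theorem re_p0_pos [NeZero n] (hσ : ∀ k, ‖σ k‖ = 1) (hτσ : ∀ k, τ ≠ σ k) (hl : ∀ k, l k < 0)
    {z : ℂ} (hz : ‖z‖ < 1) : 0 < (p0 τ σ l z).re := by
  rw [re_p0]
  refine Finset.sum_pos (fun k _ => mul_pos (div_pos ?_ ?_) (re_add_div_sub_pos (hσ k) hz))
    Finset.univ_nonempty
  · exact pow_pos (norm_pos_iff.2 (sub_ne_zero.2 (hτσ k))) 2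
  · exact mul_pos two_pos (abs_pos.2 (hl k).ne)

theorem hasSpectralValue_berksonPorta_inv_add_p0 (hτ : ‖τ‖ ≤ 1) (hσ : ∀ k, ‖σ k‖ = 1)
    (hinj : Function.Injective σ) (hτσ : ∀ k, τ ≠ σ k) (hl : ∀ k, l k < 0) (b : ℝ) (k : Fin n) :
    HasSpectralValue (fun z => berksonPorta τ (fun z => (Complex.I * b + p0 τ σ l z)⁻¹) z) (σ k)
      (l k) := by
  rw [hasSpectralValue_berksonPorta_iff hτ (hσ k) (hτσ k)]
  have hσσ := mul_conj_of_norm_eq_one (hσ k)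
  have hσ0 := ne_zero_of_norm_eq_one (hσ k)
  have hl0 : (l k : ℂ) ≠ 0 := Complex.ofReal_ne_zero.2 (hl k).ne
  have hN : (‖τ - σ k‖ : ℂ) ≠ 0 :=
    Complex.ofReal_ne_zero.2 (norm_ne_zero_iff.2 (sub_ne_zero.2 (hτσ k)))
  have hden : HasAngularLimit (fun z => (σ k - z) * (Complex.I * b + p0 τ σ l z)) (σ k)
      (2 * σ k * (‖τ - σ k‖ ^ 2 / (2 * |l k|) : ℝ)) := by
    refine ((((hasAngularLimit_sub_self _).mul (hasAngularLimit_const (Complex.I * b))).add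
      (hasAngularLimit_sub_mul_sum_cayley hσ hinj _ k)).congr fun z => ?_).congr_lim
      (by rw [zero_mul, zero_add])
    rw [p0, mul_add]
  rw [abs_of_neg (hl k)] at hden
  refine (((hasAngularLimit_const 1).div hden ?_).congr fun z => ?_).congr_lim ?_
  · push_cast
    simp [hσ0, hN, hl0]
  · rw [div_mul_eq_div_div_swap, one_div]
  · push_cast
    field_simp
    linear_combination hσσ

theorem HasSpectralValue.mul_add_mul {σ : ℂ} {G₁ G₂ : 𝔻 → ℂ} {l₁ l₂ : ℝ}
    (h₁ : HasSpectralValue G₁ σ l₁) (h₂ : HasSpectralValue G₂ σ l₂) (s t : ℝ) :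
    HasSpectralValue (fun z => s * G₁ z + t * G₂ z) σ (s * l₁ + t * l₂) :=
  ((((hasAngularLimit_const (s : ℂ)).mul h₁).add
    ((hasAngularLimit_const (t : ℂ)).mul h₂)).congr fun z => by ring).congr_lim (by push_cast; rfl)

theorem re_inv_add_p0 (b : ℝ) (z : ℂ) :
    ((Complex.I * b + p0 τ σ l z)⁻¹).re =
      ∑ k, ‖τ - σ k‖ ^ 2 / 2 * ((σ k + z) / (σ k - z)).re / |l k| *
        ‖(Complex.I * b + p0 τ σ l z)⁻¹‖ ^ 2 := by
  rw [Complex.inv_re, Complex.normSq_eq_norm_sq, Complex.add_re, Complex.I_mul_re,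
    Complex.ofReal_im, neg_zero, zero_add, re_p0, norm_inv, inv_pow, Finset.sum_div]
  refine Finset.sum_congr rfl fun k _ => ?_
  ring

theorem eq_of_openSegment_berksonPorta_inv_add_p0 (hτ : ‖τ‖ ≤ 1) (hσ : ∀ k, ‖σ k‖ = 1)
    (hinj : Function.Injective σ) (hτσ : ∀ k, τ ≠ σ k) (hl : ∀ k, l k < 0)
    (hsum : ∑ k, |l k| = 1) (b : ℝ) {G₁ G₂ : 𝔻 → ℂ} (h₁ : G₁ ∈ GenClass τ σ)
    (h₂ : G₂ ∈ GenClass τ σ) {s t : ℝ} (hs : 0 < s) (ht : 0 < t)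
    (hG : ∀ z : 𝔻, s * G₁ z + t * G₂ z =
      berksonPorta τ (fun z => (Complex.I * b + p0 τ σ l z)⁻¹) z) (hst : s + t = 1) (z : 𝔻) :
    G₁ z = berksonPorta τ (fun z => (Complex.I * b + p0 τ σ l z)⁻¹) z := by
  obtain ⟨p₁, l₁, rfl, hl₁, hsum₁, hp₁⟩ := exists_forall_le_re_of_mem_genClass hτ hσ hinj hτσ h₁
  obtain ⟨p₂, l₂, rfl, hl₂, hsum₂, hp₂⟩ := exists_forall_le_re_of_mem_genClass hτ hσ hinj hτσ h₂
  have hll (k : Fin n) : s * |l₁ k| + t * |l₂ k| = |l k| := by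
    have hspec := (hl₁ k).2.mul_add_mul (hl₂ k).2 s t
    rw [funext hG] at hspec
    have heq := Complex.ofReal_injective (hspec.unique (hσ k)
      (hasSpectralValue_berksonPorta_inv_add_p0 hτ hσ hinj hτσ hl b k))
    rw [abs_of_nonpos (hl₁ k).1, abs_of_nonpos (hl₂ k).1, abs_of_neg (hl k), ← heq]
    ring
  rcases eq_or_ne τ z with rfl | hτz
  · simp only [berksonPorta, sub_self, zero_mul]
  obtain ⟨q₁, hq₁, hle₁⟩ := hp₁ z z.norm_lt_one
  obtain ⟨q₂, hq₂, hle₂⟩ := hp₂ z z.norm_lt_one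
  have hpz : s • p₁ z + t • p₂ z = (Complex.I * b + p0 τ σ l z)⁻¹ := by
    refine mul_left_cancel₀ (mul_ne_zero (sub_ne_zero.2 hτz)
      (one_sub_conj_mul_ne_zero hτ z.norm_lt_one)) ?_
    rw [Complex.real_smul, Complex.real_smul]
    exact .trans (by simp only [berksonPorta]; ring) (hG z)
  have hw (k : Fin n) : 0 < ‖τ - σ k‖ ^ 2 / 2 * ((σ k + z) / (σ k - z) : ℂ).re :=
    mul_pos (half_pos (pow_pos (norm_pos_iff.2 (sub_ne_zero.2 (hτσ k))) 2))
      (re_add_div_sub_pos (hσ k) z.norm_lt_one)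
  have hr : s * (p₁ z).re + t * (p₂ z).re ≤
      ∑ k, ‖τ - σ k‖ ^ 2 / 2 * ((σ k + z) / (σ k - z) : ℂ).re / |l k| *
        ‖s • p₁ z + t • p₂ z‖ ^ 2 := by
    rw [← Complex.re_ofReal_mul, ← Complex.re_ofReal_mul, ← Complex.real_smul,
      ← Complex.real_smul, ← Complex.add_re, hpz, re_inv_add_p0]
  have heq := eq_of_sum_mul_sq_norm_le hw (fun k => abs_pos.2 (hl k).ne) (fun k => abs_nonneg _)
    (fun k => abs_nonneg _) hs ht hst hll hsum hsum₁ hsum₂ hq₁ hq₂ hle₁ hle₂ hr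
  simp only [berksonPorta, heq.trans hpz]

theorem berksonPorta_inv_add_p0_mem_extremePoints (hτ : ‖τ‖ ≤ 1) (hσ : ∀ k, ‖σ k‖ = 1)
    (hinj : Function.Injective σ) (hτσ : ∀ k, τ ≠ σ k) (hl : ∀ k, l k < 0)
    (hsum : ∑ k, |l k| = 1) (b : ℝ) :
    (fun z : 𝔻 => berksonPorta τ (fun z => (Complex.I * b + p0 τ σ l z)⁻¹) z) ∈
      extremePoints ℝ (GenClass τ σ) := by
  have hn : NeZero n := ⟨by rintro rfl; simp at hsum⟩
  have hre (z : ℂ) (hz : ‖z‖ < 1) : 0 < (Complex.I * b + p0 τ σ l z).re := by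
    simpa using re_p0_pos hσ hτσ hl hz
  refine ⟨berksonPorta_mem_genClass hσ hτ hτσ ((isHerglotz_add_p0 hσ b).inv hre)
    (fun z hz => ?_) (fun k => ⟨hl k,
      hasSpectralValue_berksonPorta_inv_add_p0 hτ hσ hinj hτσ hl b k⟩) hsum.le,
    fun G₁ h₁ G₂ h₂ ⟨s, t, hs, ht, hst, hG⟩ => funext ?_⟩
  · rw [Complex.inv_re]
    exact div_pos (hre z hz) (Complex.normSq_pos.2 fun h => (hre z hz).ne' (by rw [h]; rfl))
  · exact eq_of_openSegment_berksonPorta_inv_add_p0 hτ hσ hinj hτσ hl hsum b h₁ h₂ hs ht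
      (congrFun hG) hst

end Sufficiency

section Rigidity

theorem eq_zero_of_add_mem_of_sub_mem {E : Type*} [AddCommGroup E] [Module ℝ E] {A : Set E}
    {x v : E} (hx : x ∈ extremePoints ℝ A) (hadd : x + v ∈ A) (hsub : x - v ∈ A) : v = 0 := by
  have hmid : x ∈ openSegment ℝ (x + v) (x - v) :=
    ⟨1 / 2, 1 / 2, by norm_num, by norm_num, by norm_num, by module⟩
  exact left_eq_add.1 (hx.2 hadd hsub hmid).symm

variable {τ : ℂ} {p h : ℂ → ℂ} {n : ℕ} {σ : Fin n → ℂ} {l d : Fin n → ℝ}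

theorem sum_abs_eq_one_of_mem_extremePoints {G : 𝔻 → ℂ} (hG : G ∈ extremePoints ℝ (GenClass τ σ))
    (hG0 : G ≠ 0) (hl : ∀ k, l k < 0 ∧ HasSpectralValue G (σ k) (l k)) (hsum : ∑ k, |l k| ≤ 1) :
    ∑ k, |l k| = 1 := by
  by_contra hne
  have hlt : ∑ k, |l k| < 1 := hsum.lt_of_ne hne
  have hnonneg : 0 ≤ ∑ k, |l k| := Finset.sum_nonneg fun k _ => abs_nonneg _
  obtain ⟨δ, hδ⟩ : ∃ δ, δ = (1 - ∑ k, |l k|) / 2 := ⟨_, rfl⟩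
  have hscale {c : ℝ} (hc : 0 < c) (hcs : c * ∑ k, |l k| ≤ 1) :
      (fun z => (c : ℂ) * G z) ∈ GenClass τ σ :=
    smul_mem_genClass hG.1 hl hc (by simpa only [abs_mul, abs_of_pos hc, Finset.mul_sum] using hcs)
  have hδG : (δ : ℂ) • G = 0 := eq_zero_of_add_mem_of_sub_mem hG
    (by simpa [funext_iff, Pi.add_def, add_mul] using
      hscale (c := 1 + δ) (by linarith) (by nlinarith))
    (by simpa [Pi.sub_def, sub_mul] using hscale (c := 1 - δ) (by linarith) (by nlinarith))
  exact hG0 ((smul_eq_zero.1 hδG).resolve_left (Complex.ofReal_ne_zero.2 (by linarith)))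

theorem eq_zero_of_berksonPorta_eq_zero (hτ : ‖τ‖ ≤ 1) (hh : ContinuousOn h (ball 0 1))
    (h0 : ∀ z : 𝔻, berksonPorta τ h z = 0) {z : ℂ} (hz : ‖z‖ < 1) : h z = 0 := by
  have hne : ∀ w ∈ ball 0 1 ∩ {τ}ᶜ, h w = 0 := fun w ⟨hw, hwτ⟩ => by
    rw [mem_ball_zero_iff] at hw
    exact (mul_eq_zero.1 (h0 (.mk w hw))).resolve_left
      (mul_ne_zero (sub_ne_zero.2 (Ne.symm hwτ)) (one_sub_conj_mul_ne_zero hτ hw))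
  exact EqOn.of_subset_closure (t := ball 0 1) hne hh continuousOn_const inter_subset_left
    ((dense_compl_singleton τ).open_subset_closure_inter isOpen_ball) (mem_ball_zero_iff.2 hz)

theorem HasSpectralValue.berksonPorta_add_mul (hτ : ‖τ‖ ≤ 1) {σ : ℂ} (hσ : ‖σ‖ = 1) (hτσ : τ ≠ σ)
    {l d : ℝ} (hl : HasSpectralValue (fun z => berksonPorta τ p z) σ l)
    (hd : HasAngularLimit (fun z => h z / (σ - z)) σ (conj σ * d)) (ε : ℝ) :
    HasSpectralValue (fun z => berksonPorta τ (fun z => p z + ε * h z) z) σ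
      (l - ε * (‖τ - σ‖ ^ 2 * d)) := by
  rw [hasSpectralValue_berksonPorta_iff hτ hσ hτσ] at hl ⊢
  have hN : (‖τ - σ‖ : ℂ) ≠ 0 := Complex.ofReal_ne_zero.2 (norm_ne_zero_iff.2 (sub_ne_zero.2 hτσ))
  refine ((hl.add ((hasAngularLimit_const (ε : ℂ)).mul hd)).congr fun z => by ring).congr_lim ?_
  push_cast
  field_simp
  ring

theorem eq_zero_of_eventually_isHerglotz_add_mul (hτ : ‖τ‖ ≤ 1) (hσ : ∀ k, ‖σ k‖ = 1)
    (hτσ : ∀ k, τ ≠ σ k) (hG : (fun z : 𝔻 => berksonPorta τ p z) ∈ extremePoints ℝ (GenClass τ σ))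
    (hl : ∀ k, l k < 0 ∧ HasSpectralValue (fun z => berksonPorta τ p z) (σ k) (l k))
    (hsum : ∑ k, |l k| = 1)
    (hd : ∀ k, HasAngularLimit (fun z => h z / (σ k - z)) (σ k) (conj (σ k) * d k))
    (hbal : ∑ k, ‖τ - σ k‖ ^ 2 * d k = 0) (hh : ContinuousOn h (ball 0 1))
    (hher : ∀ᶠ ε : ℝ in 𝓝 0, IsHerglotz fun z => p z + ε * h z) {z : ℂ} (hz : ‖z‖ < 1) :
    h z = 0 := by
  have hn : NeZero n := ⟨by rintro rfl; simp at hsum⟩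
  have hneg : ∀ᶠ ε : ℝ in 𝓝 0, ∀ k, l k - ε * (‖τ - σ k‖ ^ 2 * d k) < 0 :=
    eventually_all.2 fun k => ContinuousAt.eventually_lt (by fun_prop) (by fun_prop)
      (by simpa using (hl k).1)
  have hmem : ∀ᶠ ε : ℝ in 𝓝 0,
      (fun z : 𝔻 => berksonPorta τ (fun z => p z + ε * h z) z) ∈ GenClass τ σ := by
    filter_upwards [hher, hneg] with ε hε hlε
    have hspec (k : Fin n) := (hl k).2.berksonPorta_add_mul hτ (hσ k) (hτσ k) (hd k) ε
    refine berksonPorta_mem_genClass hσ hτ hτσ hε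
      (hε.re_pos_of_hasSpectralValue hτ (hσ 0) (hτσ 0) (hlε 0).ne (hspec 0))
      (fun k => ⟨hlε k, hspec k⟩) ?_
    simp only [abs_of_neg (hl _).1, Finset.sum_neg_distrib] at hsum
    simp only [abs_of_neg (hlε _), Finset.sum_neg_distrib, Finset.sum_sub_distrib,
      ← Finset.mul_sum, hbal, mul_zero, sub_zero, hsum, le_refl]
  have hneg_zero : Tendsto (fun ε : ℝ => -ε) (𝓝[>] 0) (𝓝 0) :=
    (continuous_neg.tendsto' 0 0 neg_zero).mono_left nhdsWithin_le_nhds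
  obtain ⟨ε, ⟨hadd, hsub⟩, hε⟩ := ((hmem.filter_mono nhdsWithin_le_nhds).and
    (hneg_zero.eventually hmem)).and self_mem_nhdsWithin |>.exists
  have hv := eq_zero_of_add_mem_of_sub_mem (v := fun z : 𝔻 => ε * berksonPorta τ h z) hG
    (by convert hadd using 2; simp only [berksonPorta, Pi.add_apply]; ring)
    (by convert hsub using 2; simp only [berksonPorta, Pi.sub_apply]; push_cast; ring)
  exact eq_zero_of_berksonPorta_eq_zero hτ hh (fun z => (mul_eq_zero.1 (congrFun hv z)).resolve_left
    (Complex.ofReal_ne_zero.2 (ne_of_gt hε))) hz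

end Rigidity

section FiniteSupport

variable {ι : Type*} [Fintype ι]

theorem exists_ne_zero_sum_mul_add_eq_zero {K κ : Type*} [Field K] [Fintype κ]
    (hcard : Fintype.card κ < Fintype.card ι) (y : ι → κ → K) (r : ι → K) :
    ∃ (c : ι → K) (s : K), (c ≠ 0 ∨ s ≠ 0) ∧ (∀ k, ∑ j, c j * y j k + s = 0) ∧
      ∑ j, c j * r j = 0 := by
  let f : ((ι → K) × K) →ₗ[K] (κ → K) × K :=
    { toFun := fun x => (fun k => ∑ j, x.1 j * y j k + x.2, ∑ j, x.1 j * r j)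
      map_add' := fun x x' => by
        ext <;> simp [add_mul, Finset.sum_add_distrib, add_add_add_comm]
      map_smul' := fun a x => by ext <;> simp [mul_assoc, Finset.mul_sum, mul_add] }
  obtain ⟨x, hx, hx0⟩ := (Submodule.ne_bot_iff _).1
    (f.ker_ne_bot_of_finrank_lt (by simpa using hcard))
  rw [LinearMap.mem_ker, Prod.ext_iff] at hx
  refine ⟨x.1, x.2, ?_, congrFun hx.1, hx.2⟩
  contrapose! hx0
  exact Prod.ext hx0.1 hx0.2

theorem hasAngularLimit_sum_mul_herglotz_div {ν : ι → Measure 𝕊} [∀ j, IsFiniteMeasure (ν j)]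
    {σ : 𝕊} (h0 : ∀ j, ν j {σ} = 0)
    (hint : ∀ j, Integrable (fun ζ : 𝕊 => (‖(ζ : ℂ) - σ‖ ^ 2)⁻¹) (ν j)) {c : ι → ℝ} {s : ℝ}
    (hs : ∑ j, c j * (herglotz (ν j) σ).im + s = 0) :
    HasAngularLimit (fun z => (Complex.I * s + ∑ j, c j * herglotz (ν j) z) / (σ - z)) σ
      (conj (σ : ℂ) * (∑ j, c j * (2 * ∫ ζ : 𝕊, (‖(ζ : ℂ) - σ‖ ^ 2)⁻¹ ∂ν j) : ℝ)) := by
  have hvalue : Complex.I * s = -∑ j, c j * herglotz (ν j) σ := Complex.ext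
    (by simp [Complex.re_sum, re_herglotz_self (hint _)])
    (by simpa [Complex.im_sum] using eq_neg_of_add_eq_zero_right hs)
  refine ((HasAngularLimit.sum Finset.univ fun j _ => (hasAngularLimit_const (c j : ℂ)).mul
    (hasAngularLimit_herglotz_sub_div (h0 j) (hint j))).congr fun z => ?_).congr_lim ?_
  · simp only [hvalue, mul_div_assoc', ← Finset.sum_div, mul_sub, Finset.sum_sub_distrib]
    ring
  · push_cast
    simp only [Finset.mul_sum, mul_left_comm]

variable {μ : Measure 𝕊} [IsFiniteMeasure μ] {U : ι → Set 𝕊}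

theorem herglotz_eq_add_sum_restrict (hU : ∀ j, MeasurableSet (U j))
    (hdisj : Pairwise (Function.onFun Disjoint U)) {z : ℂ} (hz : ‖z‖ < 1) :
    herglotz μ z = herglotz (μ.restrict (⋃ j, U j)ᶜ) z + ∑ j, herglotz (μ.restrict (U j)) z := by
  rw [← herglotz_restrict_add_compl (.iUnion hU) hz, add_comm, add_right_inj]
  exact integral_iUnion_fintype hU hdisj fun j => (integrable_herglotz_kernel hz).integrableOn

theorem eventually_isHerglotz_add_mul_sum (hU : ∀ j, MeasurableSet (U j))
    (hdisj : Pairwise (Function.onFun Disjoint U)) (b s : ℝ) (c : ι → ℝ) :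
    ∀ᶠ ε : ℝ in 𝓝 0, IsHerglotz fun z => Complex.I * b + herglotz μ z +
      ε * (Complex.I * s + ∑ j, c j * herglotz (μ.restrict (U j)) z) := by
  have hpos : ∀ᶠ ε : ℝ in 𝓝 0, ∀ j, 0 < 1 + ε * c j :=
    eventually_all.2 fun j => ContinuousAt.eventually_lt (by fun_prop) (by fun_prop) (by simp)
  filter_upwards [hpos] with ε hε
  refine ⟨(differentiableOn_herglotz.const_add _).add (.const_mul (.const_add _
    (.fun_sum fun j _ => differentiableOn_herglotz.const_mul _)) _), fun z hz => ?_⟩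
  have hsplit : (Complex.I * b + herglotz μ z +
      ε * (Complex.I * s + ∑ j, c j * herglotz (μ.restrict (U j)) z)).re =
      (herglotz (μ.restrict (⋃ j, U j)ᶜ) z).re +
        ∑ j, (1 + ε * c j) * (herglotz (μ.restrict (U j)) z).re := by
    rw [herglotz_eq_add_sum_restrict hU hdisj hz]
    simp [Complex.re_sum, add_mul, Finset.sum_add_distrib, Finset.mul_sum, mul_assoc, add_assoc]
  rw [hsplit]
  exact add_nonneg (isHerglotz_herglotz.re_nonneg z hz) (Finset.sum_nonneg fun j _ =>
    mul_nonneg (hε j).le (isHerglotz_herglotz.re_nonneg z hz))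

theorem exists_finset_measure_compl_eq_zero_of_mem_extremePoints {n : ℕ} {τ : ℂ} {σ : Fin n → ℂ}
    (hτ : ‖τ‖ ≤ 1) (hσ : ∀ k, ‖σ k‖ = 1) (hτσ : ∀ k, τ ≠ σ k) {b : ℝ}
    (hG : (fun z : 𝔻 => berksonPorta τ (fun z => Complex.I * b + herglotz μ z) z) ∈
      extremePoints ℝ (GenClass τ σ)) {l : Fin n → ℝ}
    (hl : ∀ k, l k < 0 ∧ HasSpectralValue
      (fun z => berksonPorta τ (fun z => Complex.I * b + herglotz μ z) z) (σ k) (l k))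
    (hsum : ∑ k, |l k| = 1) :
    ∃ S : Finset 𝕊, S.card ≤ n ∧ μ (S : Set 𝕊)ᶜ = 0 := by
  refine (exists_finset_or_exists_disjoint_of_card n).resolve_right ?_
  rintro ⟨U, hU, hdisj, hμ⟩
  lift σ to Fin n → 𝕊 using fun k => mem_sphere_zero_iff_norm.2 (hσ k)
  have hlim (k : Fin n) := (hasSpectralValue_berksonPorta_iff hτ (hσ k) (hτσ k)).1 (hl k).2
  have hint (k : Fin n) := integrable_inv_normSq_sub_of_hasAngularLimit_div (hlim k)
  have h0 (k : Fin n) := measure_singleton_eq_zero_of_hasAngularLimit_div (hlim k)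
  let r (j : Fin (n + 1)) (k : Fin n) : ℝ := 2 * ∫ ζ in U j, (‖(ζ : ℂ) - σ k‖ ^ 2)⁻¹ ∂μ
  obtain ⟨c, s, hcs, hvalue, hbal⟩ := exists_ne_zero_sum_mul_add_eq_zero (by simp)
    (fun (j : Fin (n + 1)) k => (herglotz (μ.restrict (U j)) (σ k)).im)
    (fun j => ∑ k, ‖τ - σ k‖ ^ 2 * r j k)
  let h (z : ℂ) : ℂ := Complex.I * s + ∑ j, c j * herglotz (μ.restrict (U j)) z
  have hh (k : Fin n) : HasAngularLimit (fun z => h z / (σ k - z)) (σ k)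
      (conj (σ k : ℂ) * (∑ j, c j * r j k : ℝ)) :=
    hasAngularLimit_sum_mul_herglotz_div
      (fun j => Measure.restrict_le_self.absolutelyContinuous (h0 k)) (fun j => (hint k).restrict)
      (hvalue k)
  have hzero : ∀ z, ‖z‖ < 1 → h z = 0 := fun z hz => by
    refine eq_zero_of_eventually_isHerglotz_add_mul hτ hσ hτσ hG hl hsum
      (d := fun k => ∑ j, c j * r j k) hh ?_ ?_ (eventually_isHerglotz_add_mul_sum hU hdisj b s c)
      hz
    · simp only [Finset.mul_sum] at hbal ⊢
      rw [Finset.sum_comm]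
      simpa only [mul_left_comm] using hbal
    · exact (DifferentiableOn.const_add _ (.fun_sum fun j _ =>
        differentiableOn_herglotz.const_mul _)).continuousOn
  have hc : c = 0 := eq_zero_of_sum_smul_herglotz_restrict_eq (b := -s) hU hdisj hμ fun z hz => by
    push_cast
    linear_combination hzero z hz
  have hs : s = 0 := by simpa [h, hc] using hzero 0 (by simp)
  exact hcs.elim (· hc) (· hs)

end FiniteSupport

section Rational

open Polynomial Lagrange

theorem exists_eval_eq_nodal_mul {K ι : Type*} [Field K] (s : Finset ι) (v : ι → K) (c : K)
    (m : ι → K) :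
    ∃ P : K[X], P.natDegree ≤ s.card ∧ ∀ z, (∀ i ∈ s, v i - z ≠ 0) →
      P.eval z = (nodal s v).eval z * (c + ∑ i ∈ s, m i * ((v i + z) / (v i - z))) := by
  classical
  refine ⟨C c * nodal s v - ∑ i ∈ s, C (m i) * ((X + C (v i)) * nodal (s.erase i) v),
    (natDegree_sub_le_of_le ?_ (natDegree_sum_le_of_forall_le _ _ fun i hi => ?_)).trans_eq
      (max_self _), fun z hz => ?_⟩
  · exact (natDegree_C_mul_le _ _).trans natDegree_nodal.le
  · refine (natDegree_C_mul_le _ _).trans (natDegree_mul_le.trans ?_)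
    rw [natDegree_X_add_C, natDegree_nodal, add_comm, Finset.card_erase_add_one hi]
  · simp only [eval_sub, eval_finsetSum, eval_mul, eval_add, eval_C, eval_X]
    rw [mul_add, Finset.mul_sum, sub_eq_add_neg, ← Finset.sum_neg_distrib, mul_comm c]
    refine congrArg _ (Finset.sum_congr rfl fun i hi => ?_)
    rw [nodal_eq_mul_nodal_erase hi, eval_mul, eval_sub, eval_X, eval_C]
    have := hz i hi
    field_simp
    ring

theorem eq_C_mul_nodal {K ι : Type*} [Field K] {s : Finset ι} {v : ι → K}
    (hv : Set.InjOn v s) {P : K[X]} (hdeg : P.natDegree ≤ s.card)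
    (hroot : ∀ i ∈ s, P.eval (v i) = 0) : P = C P.leadingCoeff * nodal s v := by
  refine eq_leadingCoeff_mul_of_monic_of_dvd_of_natDegree_le nodal_monic ?_
    (hdeg.trans natDegree_nodal.ge)
  exact Finset.prod_dvd_of_coprime (fun i hi j hj hij => isCoprime_X_sub_C_of_isUnit_sub
    (sub_ne_zero.2 (hv.ne hi hj hij)).isUnit) fun i hi => dvd_iff_isRoot.2 (hroot i hi)

variable {n : ℕ} {σ : Fin n → ℂ} {p : ℂ → ℂ}

theorem eq_C_mul_nodal_of_hasAngularLimit (hσ : ∀ k, ‖σ k‖ = 1) (hinj : Function.Injective σ)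
    {P : ℂ[X]} (hdeg : P.natDegree ≤ n) (h : ∀ k, HasAngularLimit (fun z => P.eval ↑z) (σ k) 0) :
    P = C P.leadingCoeff * nodal Finset.univ σ :=
  eq_C_mul_nodal hinj.injOn (by simpa using hdeg) fun k _ =>
    (hasAngularLimit_of_continuousAt P.continuous.continuousAt).unique (hσ k) (h k)

theorem eval_nodal_ne_zero {ι : Type*} (s : Finset ι) {v : ι → ℂ} (hv : ∀ i, ‖v i‖ = 1) {z : ℂ}
    (hz : ‖z‖ < 1) : (nodal s v).eval z ≠ 0 :=
  eval_nodal_not_at_node fun i _ => (sub_ne_zero.1 (sub_ne_zero_of_norm_eq_one (hv i) hz)).symm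

theorem exists_nodal_mul_eq_mul_nodal {ι : Type*} {s : Finset ι} {v : ι → ℂ}
    (hσ : ∀ k, ‖σ k‖ = 1) (hinj : Function.Injective σ) (hv : ∀ i, ‖v i‖ = 1) (hcard : s.card ≤ n)
    {c : ℂ} {m : ι → ℂ} (hp : ∀ z, ‖z‖ < 1 → p z = c + ∑ i ∈ s, m i * ((v i + z) / (v i - z)))
    (hlim : ∀ k, HasAngularLimit (fun z => p z) (σ k) 0) :
    ∃ a, ∀ z, ‖z‖ < 1 → (nodal s v).eval z * p z = a * (nodal Finset.univ σ).eval z := by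
  obtain ⟨P, hdeg, hP⟩ := exists_eval_eq_nodal_mul s v c m
  have heval : ∀ z, ‖z‖ < 1 → P.eval z = (nodal s v).eval z * p z := fun z hz => by
    rw [hp z hz, hP z fun i _ => sub_ne_zero_of_norm_eq_one (hv i) hz]
  have hnodal := eq_C_mul_nodal_of_hasAngularLimit hσ hinj (hdeg.trans hcard) fun k =>
    (((hasAngularLimit_of_continuousAt (nodal s v).continuous.continuousAt).mul (hlim k)).congr
      fun z => (heval z z.norm_lt_one).symm).congr_lim (mul_zero _)
  refine ⟨P.leadingCoeff, fun z hz => ?_⟩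
  rw [← heval z hz, ← eval_C_mul, ← hnodal]

theorem exists_inv_eq_add_sum_of_mul_eq_mul_nodal (hσ : ∀ k, ‖σ k‖ = 1)
    (hinj : Function.Injective σ) {Q : ℂ[X]} (hdeg : Q.natDegree ≤ n) {a : ℂ} (ha : a ≠ 0)
    (hp : ∀ z, ‖z‖ < 1 → Q.eval z * p z = a * (nodal Finset.univ σ).eval z)
    {α : Fin n → ℂ}
    (hinv : ∀ k, HasAngularLimit (fun z => (σ k - z) * (p z)⁻¹) (σ k) (2 * σ k * α k)) :
    ∃ κ, ∀ z, ‖z‖ < 1 → (p z)⁻¹ = κ + ∑ k, α k * ((σ k + z) / (σ k - z)) := by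
  obtain ⟨T, hTdeg, hT⟩ := exists_eval_eq_nodal_mul Finset.univ σ 0 α
  obtain ⟨q, hq⟩ : ∃ q : ℂ → ℂ, ∀ z, q z = (p z)⁻¹ - ∑ k, α k * ((σ k + z) / (σ k - z)) :=
    ⟨_, fun _ => rfl⟩
  have heval : ∀ z, ‖z‖ < 1 →
      (Q - C a * T).eval z = a * (nodal Finset.univ σ).eval z * q z := fun z hz => by
    have hpz : p z ≠ 0 := right_ne_zero_of_mul
      (hp z hz ▸ mul_ne_zero ha (eval_nodal_ne_zero _ hσ hz))
    rw [eval_sub, eval_C_mul, hT z fun k _ => sub_ne_zero_of_norm_eq_one (hσ k) hz, zero_add,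
      ← mul_assoc, ← hp z hz, hq]
    field_simp
  have hqlim (k : Fin n) : HasAngularLimit (fun z => (σ k - z) * q z) (σ k) 0 :=
    (((hinv k).sub (hasAngularLimit_sub_mul_sum_cayley hσ hinj α k)).congr fun z => by
      rw [hq, mul_sub]).congr_lim (sub_self _)
  have hnodal := eq_C_mul_nodal_of_hasAngularLimit (P := Q - C a * T) hσ hinj
    ((natDegree_sub_le_of_le hdeg ((natDegree_C_mul_le _ _).trans hTdeg)).trans (by simp))
    fun k => ?_
  · refine ⟨(Q - C a * T).leadingCoeff / a, fun z hz => ?_⟩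
    have hR := hnodal ▸ heval z hz
    rw [eval_C_mul, mul_right_comm] at hR
    rw [← sub_eq_iff_eq_add, ← hq, mul_right_cancel₀ (eval_nodal_ne_zero _ hσ hz) hR,
      mul_div_cancel_left₀ _ ha]
  · refine (((hasAngularLimit_of_continuousAt (F := fun z => -a *
      (nodal (Finset.univ.erase k) σ).eval z) (by fun_prop)).mul (hqlim k)).congr
      fun z => ?_).congr_lim (mul_zero _)
    rw [heval z z.norm_lt_one, nodal_eq_mul_nodal_erase (Finset.mem_univ k), eval_mul, eval_sub,
      eval_X, eval_C]
    ring

theorem exists_norm_eq_one_notMem {T : Set ℂ} (hT : T.Finite) : ∃ ζ : ℂ, ‖ζ‖ = 1 ∧ ζ ∉ T := by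
  have hinf : (sphere (0 : ℂ) 1).Infinite :=
    (isPreconnected_sphere (by simp [Complex.rank_real_complex]) 0 1).infinite_of_nontrivial
      ⟨1, by simp, -1, by simp, by norm_num⟩
  simpa using hinf.exists_notMem_finite hT

theorem re_sum_cayley_eq_zero {ι : Type*} (s : Finset ι) {v : ι → ℂ} (hv : ∀ i, ‖v i‖ = 1)
    (m : ι → ℝ) {ζ : ℂ} (hζ : ‖ζ‖ = 1) :
    (∑ i ∈ s, (m i : ℂ) * ((v i + ζ) / (v i - ζ))).re = 0 := by
  simp [Complex.re_sum, re_add_div_sub (hv _), hζ]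

theorem hasAngularLimit_add_sum_cayley {ι : Type*} (s : Finset ι) {v : ι → ℂ} {ζ : ℂ}
    (hv : ∀ i ∈ s, v i - ζ ≠ 0) (c : ℂ) (m : ι → ℂ) :
    HasAngularLimit (fun z => c + ∑ i ∈ s, m i * ((v i + z) / (v i - z))) ζ
      (c + ∑ i ∈ s, m i * ((v i + ζ) / (v i - ζ))) :=
  hasAngularLimit_of_continuousAt (F := fun z => c + ∑ i ∈ s, m i * ((v i + z) / (v i - z)))
    (continuousAt_const.add (tendsto_finsetSum s fun i hi =>
      continuousAt_const.mul (.div (by fun_prop) (by fun_prop) (hv i hi))))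

theorem re_eq_zero_of_inv_eq_add_sum {ι : Type*} {s : Finset ι} {v : ι → ℂ}
    (hσ : ∀ k, ‖σ k‖ = 1) (hv : ∀ i, ‖v i‖ = 1) {b : ℝ} {m : ι → ℝ} {α : Fin n → ℝ} {κ : ℂ}
    (hp : ∀ z, ‖z‖ < 1 → p z = Complex.I * b + ∑ i ∈ s, m i * ((v i + z) / (v i - z)))
    (hp0 : ∀ z, ‖z‖ < 1 → p z ≠ 0)
    (hinv : ∀ z, ‖z‖ < 1 → (p z)⁻¹ = κ + ∑ k, α k * ((σ k + z) / (σ k - z))) : κ.re = 0 := by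
  obtain ⟨ζ, hζ, hζT⟩ := exists_norm_eq_one_notMem
    ((s.finite_toSet.image v).union (finite_range σ))
  have hvζ : ∀ i ∈ s, v i - ζ ≠ 0 := fun i hi => sub_ne_zero.2 fun h =>
    hζT (.inl ⟨i, hi, h⟩)
  have hσζ : ∀ k, σ k - ζ ≠ 0 := fun k => sub_ne_zero.2 fun h => hζT (.inr ⟨k, h⟩)
  have hone : (Complex.I * b + ∑ i ∈ s, m i * ((v i + ζ) / (v i - ζ))) *
      (κ + ∑ k, α k * ((σ k + ζ) / (σ k - ζ))) = 1 := by
    refine (((hasAngularLimit_add_sum_cayley s hvζ _ _).mul (hasAngularLimit_add_sum_cayley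
      Finset.univ (fun k _ => hσζ k) _ _)).congr fun z => ?_).unique hζ (hasAngularLimit_const 1)
    rw [← hp z z.norm_lt_one, ← hinv z z.norm_lt_one, mul_inv_cancel₀ (hp0 z z.norm_lt_one)]
  have hre := congrArg Complex.re (eq_inv_of_mul_eq_one_right hone)
  rw [Complex.inv_re] at hre
  simpa [re_sum_cayley_eq_zero _ hσ _ hζ, re_sum_cayley_eq_zero _ hv _ hζ] using hre

theorem exists_eq_add_sum_of_mem_extremePoints {τ : ℂ} (hτ : ‖τ‖ ≤ 1) (hσ : ∀ k, ‖σ k‖ = 1)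
    (hτσ : ∀ k, τ ≠ σ k) (hp : IsHerglotz p)
    (hG : (fun z : 𝔻 => berksonPorta τ p z) ∈ extremePoints ℝ (GenClass τ σ)) {l : Fin n → ℝ}
    (hl : ∀ k, l k < 0 ∧ HasSpectralValue (fun z => berksonPorta τ p z) (σ k) (l k))
    (hsum : ∑ k, |l k| = 1) :
    ∃ (S : Finset 𝕊) (b : ℝ) (m : 𝕊 → ℝ), S.card ≤ n ∧
      ∀ z, ‖z‖ < 1 → p z = Complex.I * b + ∑ ζ ∈ S, m ζ * (((ζ : ℂ) + z) / (ζ - z)) := by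
  obtain ⟨μ, _, b, hμ⟩ := hp.exists_eq_herglotz
  have hG_eq : (fun z : 𝔻 => berksonPorta τ p z) =
      fun z : 𝔻 => berksonPorta τ (fun z => Complex.I * b + herglotz μ z) z :=
    funext fun z => by simp only [berksonPorta, hμ z z.norm_lt_one]
  rw [hG_eq] at hG hl
  obtain ⟨S, hcard, hS⟩ :=
    exists_finset_measure_compl_eq_zero_of_mem_extremePoints hτ hσ hτσ hG hl hsum
  refine ⟨S, b, fun ζ => μ.real {ζ}, hcard, fun z hz => ?_⟩
  rw [hμ z hz, ← herglotz_restrict_finset S hz, Measure.restrict_eq_self_of_ae_mem]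
  exact measure_eq_zero_iff_ae_notMem.1 hS |>.mono fun ζ hζ => not_not.1 hζ

theorem exists_inv_eq_add_p0_of_mem_extremePoints {τ : ℂ} (hτ : ‖τ‖ ≤ 1) (hσ : ∀ k, ‖σ k‖ = 1)
    (hinj : Function.Injective σ) (hτσ : ∀ k, τ ≠ σ k) (hp : IsHerglotz p)
    (hG : (fun z : 𝔻 => berksonPorta τ p z) ∈ extremePoints ℝ (GenClass τ σ)) {l : Fin n → ℝ}
    (hl : ∀ k, l k < 0 ∧ HasSpectralValue (fun z => berksonPorta τ p z) (σ k) (l k))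
    (hsum : ∑ k, |l k| = 1) :
    ∃ b : ℝ, ∀ z, ‖z‖ < 1 → (p z)⁻¹ = Complex.I * b + p0 τ σ l z := by
  have hn : NeZero n := ⟨by rintro rfl; simp at hsum⟩
  have hp0 : ∀ z, ‖z‖ < 1 → p z ≠ 0 := fun z hz h =>
    (hp.re_pos_of_hasSpectralValue hτ (hσ 0) (hτσ 0) (hl 0).1.ne (hl 0).2 z hz).ne' (by simp [h])
  have hlim (k : Fin n) : HasAngularLimit (fun z => p z) (σ k) 0 :=
    (((hasAngularLimit_sub_self (σ k)).mul ((hasSpectralValue_berksonPorta_iff hτ (hσ k)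
      (hτσ k)).1 (hl k).2)).congr fun z => mul_div_cancel₀ _
        (sub_ne_zero_of_norm_eq_one (hσ k) z.norm_lt_one)).congr_lim (zero_mul _)
  obtain ⟨S, b, m, hcard, hsupp⟩ := exists_eq_add_sum_of_mem_extremePoints hτ hσ hτσ hp hG hl hsum
  obtain ⟨a, ha⟩ := exists_nodal_mul_eq_mul_nodal hσ hinj norm_coe_sphere hcard hsupp hlim
  have ha0 : a ≠ 0 := left_ne_zero_of_mul (ha 0 (by simp) ▸ mul_ne_zero
    (eval_nodal_ne_zero S norm_coe_sphere (by simp)) (hp0 0 (by simp)))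
  obtain ⟨κ, hκ⟩ := exists_inv_eq_add_sum_of_mul_eq_mul_nodal hσ hinj
    (natDegree_nodal.trans_le hcard) ha0 ha fun k =>
      hasAngularLimit_sub_mul_inv hτ (hσ k) (hτσ k) (hl k).1 (hl k).2
  have hre : κ.re = 0 := re_eq_zero_of_inv_eq_add_sum hσ norm_coe_sphere hsupp hp0 hκ
  refine ⟨κ.im, fun z hz => ?_⟩
  rw [hκ z hz, p0, mul_comm Complex.I, ← zero_add ((κ.im : ℂ) * Complex.I), ← Complex.ofReal_zero,
    ← hre, Complex.re_add_im]

end Rational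

end DiscSemigroup

theorem mainTheorem9 {n : ℕ} (σ : Fin n → ℂ) (hσ : ∀ k, ‖σ k‖ = 1)
    (hσinj : Function.Injective σ) (τ : ℂ) (hτ : ‖τ‖ ≤ 1) (hτσ : ∀ k, τ ≠ σ k)
    (G : 𝔻 → ℂ) (hG : G ≠ 0) :
    G ∈ Set.extremePoints ℝ (DiscSemigroup.GenClass τ σ) ↔
      ∃ (b : ℝ) (L : Fin n → ℝ), (∀ k, L k < 0) ∧ ∑ k, |L k| = 1 ∧
        ∀ z : 𝔻, G z = (τ - (z : ℂ)) * (1 - conj τ * (z : ℂ)) /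
          (Complex.I * (b : ℂ) + DiscSemigroup.p0 τ σ L (z : ℂ)) := by
  constructor
  · intro hmem
    obtain ⟨p, hp, rfl, l, hl, hle⟩ :=
      DiscSemigroup.exists_isHerglotz_of_mem_genClass hmem.1 hG hτ
    have hsum := DiscSemigroup.sum_abs_eq_one_of_mem_extremePoints hmem hG hl hle
    obtain ⟨b, hb⟩ := DiscSemigroup.exists_inv_eq_add_p0_of_mem_extremePoints hτ hσ hσinj hτσ
      hp hmem hl hsum
    exact ⟨b, l, fun k => (hl k).1, hsum, fun z => by
      rw [← hb z z.norm_lt_one, div_inv_eq_mul]; rfl⟩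
  · rintro ⟨b, L, hL, hsum, hGz⟩
    convert DiscSemigroup.berksonPorta_inv_add_p0_mem_extremePoints hτ hσ hσinj hτσ hL hsum b
      using 1
    funext z
    rw [hGz, div_eq_mul_inv]
    rfl
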